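/- **Setting.** Let $\mathcal S,\mathcal A$ be (measurable) state and action spaces, each pair $x=(s,a)$ being represented by a vector of $\mathbb R^d$, $d\ge 3$, with $\|x\|_2\le 1$. For $m\ge 1$, signs $b\in\{-1,1\}^m$ and weights $\alpha=([\alpha]_1,\dots,[\alpha]_m)\in\mathbb R^{md}$ put $$u_\alpha(x)=\frac1{\sqrt m}\sum_{i=1}^m b_i\max(0,[\alpha]_i^\top x),\qquad u^0_\alpha(x)=\frac1{\sqrt m}\sum_{i=1}^m b_i\mathbf 1\{[\alpha(0)]_i^\top x>0\}[\alpha]_i^\top x,$$ where $b_i\sim\mathrm{Unif}\{-1,1\}$ and $[\alpha(0)]_i\sim\mathcal N(0,I_d/d)$ are all independent. The gradient $\nabla_\alpha u_\alpha(x)$ is the vector with blocks $m^{-1/2}b_i\mathbf 1\{[\alpha]_i^\top x>0\}x$. For $R>0$ let $B^0(R)=\{\alpha:\|\alpha-\alpha(0)\|_2\le R\}$, let $\Pi_{B^0(R)}$ be the Euclidean projection on it, and let $\mathcal F=\{u^0_\alpha:\alpha\in B^0(R)\}$. Let $\mu\in[0,1)$. Let $\mathcal P$ be a transition kernel; let the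 policy $\pi$, the distribution $\rho$ on $\mathcal S\times\mathcal A$ and the square-$\rho$-integrable function $v$ on $\mathcal S\times\mathcal A$ be given (they may depend, measurably, on the initialization and on other randomness prior to the run), such that almost surely, conditionally on these: * $\rho$ is stationary: if $(s,a)\sim\rho$, $s'\sim\mathcal P(\cdot|s,a)$, $a'\sim\pi(\cdot|s')$, then $(s',a')\sim\rho$; * $\rho(|z^\top x|\le\zeta)\le c\,\zeta/\|z\|_2$ for all $z\ne0$ and $\zeta>0$; * $\mathbb E_\rho[v^2]\le\bar v_1\mathbb E_\rho[u_{\alpha(0)}^2]+\bar v_2R^2+\bar v_3$, with constants $c>0$ and $\bar v_1,\bar v_2,\bar v_3\ge0$. Given these data, draw i.i.d. transitions $(x_t,x_t')=((s_t,a_t),(s_t',a_t'))$ as in the first item and run, from $\alpha(0)$, for $t=0,\dots,T-1$, $$\alpha(t+1)=\Pi_{B^0(R)}\Bigl(\alpha(t)-\eta\bigl(u_{\alpha(t)}(x_t)-v(x_t)-\mu u_{\alpha(t)}(x_t')\bigr)\nabla_\alpha u_{\alpha(t)}(x_t)\Bigr),\qquad \eta=T^{-1/2},$$ and let $\bar\alpha=\frac1T\sum_{t=0}^{T-1}\alpha(t)$.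 Put $\mathcal Tu(s,a)=v(s,a)+\mu\,\mathbb E[u(s',a')\mid s,a]$ and $\bar g^0_\alpha=\mathbb E_\rho[(u^0_\alpha(x)-v(x)-\mu u^0_\alpha(x'))\nabla_\alpha u^0_\alpha(x)]$, and call $\alpha^*\in B^0(R)$ stationary if $\alpha^*=\Pi_{B^0(R)}(\alpha^*-\eta\bar g^0_{\alpha^*})$. **Theorem.** For all $\mu\in[0,1)$, $c$, $\bar v_1,\bar v_2,\bar v_3$ and $R_0>0$ there is a constant $C$, depending only on these, such that for all $d\ge3$, $m\ge1$, $R\ge R_0$, $T\ge 64/(1-\mu)^2$ and all data as above: 1. almost surely, a stationary $\alpha^*$ exists; a point $\alpha\in B^0(R)$ is stationary if and only if $u^0_\alpha=\Pi_{\mathcal F}\mathcal Tu^0_\alpha$, where $\Pi_{\mathcal F}$ is the projection on $\mathcal F$ in $L^2(\rho)$; and this fixed point of $\Pi_{\mathcal F}\mathcal T$ is unique up to $\rho$-null sets; 2. for stationary $\alpha^*$, $$\mathbb E\bigl[(u_{\bar\alpha}(x)-u^0_{\alpha^*}(x))^2\bigr]\le C\bigl(R^2T^{-1/2}+R^{5/2}m^{-1/4}+R^3m^{-1/2}\bigr),$$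 where the expectation is over the initialization (and prior randomness), the samples, and an independent $x\sim\rho$. -/

import Mathlib

open MeasureTheory ProbabilityTheory
open scoped ENNReal

universe u v w

namespace NeuralTD

noncomputable section

/-- Network inputs: state-action pairs are represented by vectors of `ℝ^d`. -/
abbrev Vec (d : ℕ) : Type := EuclideanSpace ℝ (Fin d)

/-- Input weights `α ∈ ℝ^{md}` with the Euclidean norm; `(i, j)` is the `j`-th coordinate of the
`i`-th block. -/
abbrev Params (m d : ℕ) : Type := EuclideanSpace ℝ (Fin m × Fin d)

/-- The `i`-th block `[α]_i ∈ ℝ^d`. -/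
def block {m d : ℕ} (α : Params m d) (i : Fin m) : Vec d :=
  WithLp.toLp 2 fun j => α (i, j)

/-- Two-layer ReLU network `u_α(x) = m^{-1/2} ∑ b_i · max(0, [α]_iᵀ x)`. -/
def net {m d : ℕ} (b : Fin m → ℝ) (α : Params m d) (x : Vec d) : ℝ :=
  1 / √(m : ℝ) * ∑ i, b i * max 0 (inner ℝ (block α i) x)

/-- Local linearization at `α₀`:
`u⁰_α(x) = m^{-1/2} ∑ b_i · 1{[α₀]_iᵀ x > 0} · [α]_iᵀ x`. -/
def linNet {m d : ℕ} (b : Fin m → ℝ) (α₀ α : Params m d) (x : Vec d) : ℝ :=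
  1 / √(m : ℝ) *
    ∑ i, b i * ((if 0 < (inner ℝ (block α₀ i) x : ℝ) then 1 else 0) * inner ℝ (block α i) x)

/-- The weight gradient `∇_α u_α(x)`, whose `i`-th block is
`m^{-1/2} b_i 1{[α]_iᵀ x > 0} x` (with this convention at the kinks of the ReLU).
The gradient of `linNet b α₀ · x` is `netGrad b α₀ x`. -/
def netGrad {m d : ℕ} (b : Fin m → ℝ) (α : Params m d) (x : Vec d) : Params m d :=
  WithLp.toLp 2 fun p =>
    1 / √(m : ℝ) * (b p.1 * ((if 0 < (inner ℝ (block α p.1) x : ℝ) then 1 else 0) * x p.2))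

/-- Euclidean projection onto the closed ball of centre `c` and radius `R`. -/
def projBall {E : Type*} [NormedAddCommGroup E] [NormedSpace ℝ E] (c : E) (R : ℝ) (y : E) : E :=
  if ‖y - c‖ ≤ R then y else c + (R / ‖y - c‖) • (y - c)

/-- `projBall c R y` lies in the ball and minimizes the distance to `y`. -/
theorem projBall_isMinimizer {E : Type*} [NormedAddCommGroup E] [NormedSpace ℝ E]
    (c : E) {R : ℝ} (hR : 0 ≤ R) (y : E) :
    projBall c R y ∈ Metric.closedBall c R ∧
      ∀ z ∈ Metric.closedBall c R, ‖projBall c R y - y‖ ≤ ‖z - y‖ := by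
  unfold projBall
  split_ifs with h
  · refine ⟨by simpa [Metric.mem_closedBall, dist_eq_norm] using h, fun z _ => by simp⟩
  · push Not at h
    have hpos : 0 < ‖y - c‖ := lt_of_le_of_lt hR h
    refine ⟨?_, fun z hz => ?_⟩
    · rw [Metric.mem_closedBall, dist_eq_norm, add_sub_cancel_left, norm_smul, Real.norm_eq_abs,
        abs_of_nonneg (by positivity), div_mul_cancel₀ _ hpos.ne']
    · rw [Metric.mem_closedBall, dist_eq_norm] at hz
      have e : c + (R / ‖y - c‖) • (y - c) - y = (R / ‖y - c‖ - 1) • (y - c) := by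
        rw [sub_smul, one_smul]; abel
      have h1 : R / ‖y - c‖ ≤ 1 := (div_le_one hpos).2 h.le
      rw [e, norm_smul, Real.norm_eq_abs, abs_of_nonpos (by linarith)]
      have h2 : -(R / ‖y - c‖ - 1) * ‖y - c‖ = ‖y - c‖ - R := by field_simp; ring
      have h3 : ‖y - c‖ ≤ ‖z - y‖ + ‖z - c‖ := by
        have := norm_sub_le (z - c) (z - y)
        rw [show z - c - (z - y) = y - c by abel] at this
        linarith
      rw [h2]; linarith

/-- The residual `f(x) - v(x) - μ f(x')` on a transition `z = (x, x')`. -/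
def residual {X : Type*} (f v : X → ℝ) (μ : ℝ) (z : X × X) : ℝ :=
  f z.1 - v z.1 - μ * f z.2

/-- Stochastic (semi)gradient `g_α(x, x') = δ_α(x, x') ∇_α u_α(x)`. -/
def update {X : Type*} {m d : ℕ} (φ : X → Vec d) (b : Fin m → ℝ) (v : X → ℝ) (μ : ℝ)
    (α : Params m d) (z : X × X) : Params m d :=
  residual (fun x => net b α (φ x)) v μ z • netGrad b α (φ z.1)

/-- Linearized population (semi)gradient `ḡ⁰_α = E[δ⁰_α(x, x') ∇_α u⁰_α(x)]`, where `J` is the law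
of the transition `(x, x')`. -/
def linMeanUpdate {X : Type*} [MeasurableSpace X] {m d : ℕ} (φ : X → Vec d) (b : Fin m → ℝ)
    (α₀ : Params m d) (v : X → ℝ) (μ : ℝ) (J : Measure (X × X)) (α : Params m d) : Params m d :=
  ∫ z, residual (fun x => linNet b α₀ α (φ x)) v μ z • netGrad b α₀ (φ z.1) ∂J

/-- The iterates `α(t+1) = Π_{B⁰(R)}(α(t) - η g_{α(t)}(z_t))`, `α(0) = α₀`, driven by a stream of
sampled transitions `z₀, z₁, …`. -/
def iterate {X : Type*} {m d : ℕ} (φ : X → Vec d) (b : Fin m → ℝ) (α₀ : Params m d) (v : X → ℝ)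
    (μ R η : ℝ) (z : ℕ → X × X) : ℕ → Params m d
  | 0 => α₀
  | t + 1 =>
      let α := iterate φ b α₀ v μ R η z t
      projBall α₀ R (α - η • update φ b v μ α (z t))

/-- The averaged iterate `ᾱ = T⁻¹ ∑_{t < T} α(t)`. -/
def averagedIterate {X : Type*} {m d : ℕ} (φ : X → Vec d) (b : Fin m → ℝ) (α₀ : Params m d)
    (v : X → ℝ) (μ R η : ℝ) (T : ℕ) (z : ℕ → X × X) : Params m d :=
  (1 / (T : ℝ)) • ∑ t ∈ Finset.range T, iterate φ b α₀ v μ R η z t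

/-- Approximate stationary points: `α = Π_{B⁰(R)}(α - η ḡ⁰_α)`. -/
def IsStationaryPoint {X : Type*} [MeasurableSpace X] {m d : ℕ} (φ : X → Vec d) (b : Fin m → ℝ)
    (α₀ : Params m d) (v : X → ℝ) (μ R η : ℝ) (J : Measure (X × X)) (α : Params m d) : Prop :=
  α ∈ Metric.closedBall α₀ R ∧ α = projBall α₀ R (α - η • linMeanUpdate φ b α₀ v μ J α)

/-- The class `F_{R,m}` of linearized networks `u⁰_α` with `‖α - α₀‖ ≤ R`, as functions of the
state-action pair. -/
def linClass {X : Type*} {m d : ℕ} (φ : X → Vec d) (b : Fin m → ℝ) (α₀ : Params m d) (R : ℝ) :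
    Set (X → ℝ) :=
  {f | ∃ α ∈ Metric.closedBall α₀ R, f = fun x => linNet b α₀ α (φ x)}

/-- `p` is a projection of `g` on the class `F` for the `L²(ρ)` distance. -/
def IsL2Proj {X : Type*} [MeasurableSpace X] (ρ : Measure X) (F : Set (X → ℝ)) (g p : X → ℝ) :
    Prop :=
  p ∈ F ∧ ∀ f ∈ F,
    ∫⁻ x, ENNReal.ofReal ((p x - g x) ^ 2) ∂ρ ≤ ∫⁻ x, ENNReal.ofReal ((f x - g x) ^ 2) ∂ρ

/-- The kernel `(s, a) ↦ law of (s', a')` with `s' ∼ P(· | s, a)` and `a' ∼ π(· | s')`. -/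
abbrev nextPair {S : Type*} {A : Type*} [MeasurableSpace S] [MeasurableSpace A]
    (P : Kernel (S × A) S) (π : Kernel S A) : Kernel (S × A) (S × A) :=
  P.compProd (Kernel.prodMkLeft (S × A) π)

/-- The law of a transition `((s, a), (s', a'))` with `(s, a) ∼ ρ`. -/
abbrev transitionLaw {S : Type*} {A : Type*} [MeasurableSpace S] [MeasurableSpace A]
    (P : Kernel (S × A) S) (π : Kernel S A) (ρ : Measure (S × A)) :
    Measure ((S × A) × (S × A)) :=
  ρ.compProd (nextPair P π)

/-- The operator `[T u](s, a) = v(s, a) + μ E[u(s', a')]`. -/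
def bellman {S : Type*} {A : Type*} [MeasurableSpace S] [MeasurableSpace A]
    (P : Kernel (S × A) S) (π : Kernel S A) (v : S × A → ℝ) (μ : ℝ) (f : S × A → ℝ) :
    S × A → ℝ :=
  fun x => v x + μ * ∫ y, f y ∂(nextPair P π x)

/-- Regularity of `ρ`: `ρ(|zᵀ x| ≤ ζ) ≤ c ζ / ‖z‖` for every nonzero `z` and every `ζ > 0`. -/
def AntiConcentrated {X : Type*} [MeasurableSpace X] {d : ℕ} (φ : X → Vec d) (c : ℝ) (ρ : Measure X) :
    Prop :=
  ∀ z : Vec d, z ≠ 0 → ∀ ζ : ℝ, 0 < ζ →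
    ρ.real {x | |(inner ℝ z (φ x) : ℝ)| ≤ ζ} ≤ c * ζ / ‖z‖

/-- The law of the random initialization `(b, α(0))`: independent entries, `b_i` uniform on
`{-1, 1}` and every coordinate of `α(0)` centred Gaussian with variance `1 / d`, that is,
`[α(0)]_i ∼ N(0, I_d / d)` independently. -/
def initLaw (m d : ℕ) : Measure ((Fin m → ℝ) × (Fin m × Fin d → ℝ)) :=
  (Measure.pi fun _ : Fin m =>
      (2⁻¹ : ℝ≥0∞) • Measure.dirac (-1 : ℝ) + (2⁻¹ : ℝ≥0∞) • Measure.dirac (1 : ℝ)).prod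
    (Measure.pi fun _ : Fin m × Fin d => gaussianReal 0 (1 / (d : NNReal)))

end

end NeuralTD

open NeuralTD

/-! The linearized network is linear in its weights: `u⁰_α(x) = ⟨netGrad b α₀ x, α⟩`, with features
of norm at most 1 (`inner_netGrad`, `norm_netGrad_le_one`). Hence the population semigradient `G =
linMeanUpdate` is affine. Let `J` be the law of a transition; both its marginals are `ρ`. Writing
`I` for the `L²(ρ)` norm squared of `u⁰_{α-β}`, one has `⟨G α - G β, α - β⟩ ≥ (1 - μ) I` and `‖G α -
G β‖² ≤ 4 I` (`inner_linMeanUpdate_sub_ge`, `norm_linMeanUpdate_sub_sq_le`). For `2η ≤ 1 - μ` the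
map `α ↦ α - η G α` is therefore nonexpansive, and its projection to the ball has a fixed point by
compactness. Stationarity is the variational inequality `⟨G α, β - α⟩ ≥ 0` on the ball. Conditioning
on `x` turns it into the first-order condition for projecting `𝒯u⁰_α` on the class
(`isL2Proj_bellman_iff`), and monotonicity gives uniqueness in `L²(ρ)`.

For the rate, monotonicity and the variational inequality at the stationary point make `⟨G α, α -
αs⟩` dominate `(1 - μ)` times the squared error, so the usual potential argument for projected
stochastic approximation applies (`sum_lintegral_projected_sgd_le`). The true update differs from
the linearized one only through neurons whose activation has changed. Such a neuron satisfies
`|⟨[α₀]_i, x⟩| ≤ ‖[α - α₀]_i‖`, so anti-concentration bounds the mean fraction of changed neurons by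
a multiple of `R m^{-1/2} (1 + invMoment α₀)` (`integral_mismatchFrac_le`). Young's inequality with
tuned weights turns this into a drift error of order `R^{5/2} m^{-1/4}`; replacing `u` by `u⁰` at
the averaged iterate costs `R³ m^{-1/2}`, and the potential argument itself leaves `R² T^{-1/2}`.

All this is conditional on the initialization, and the constant involves the second moment of the
initial network under `ρ` and `invMoment`. Since `ρ` may depend on the initialization, the former is
replaced by the supremum over the unit ball, whose expected square is at most 2 by a Rademacher
contraction argument (`lintegral_supNetSq_le`). The inverse moment has mean at most 3 because `d ≥
3` (`lintegral_einvMoment_le`). -/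

namespace NeuralTD

/-! ### The network, its gradient and the activation changes. -/

section Network

variable {m d : ℕ}

theorem inner_params (α β : Params m d) :
    inner ℝ α β = ∑ i, inner ℝ (block α i) (block β i) := by
  simp [PiLp.inner_apply, block, Fintype.sum_prod_type]

theorem norm_sq_params (α : Params m d) : ‖α‖ ^ 2 = ∑ i, ‖block α i‖ ^ 2 := by
  rw [← real_inner_self_eq_norm_sq, inner_params]
  simp only [real_inner_self_eq_norm_sq]

theorem block_sub (α β : Params m d) (i : Fin m) :
    block (α - β) i = block α i - block β i := by
  ext j; simp [block]

theorem block_netGrad (b : Fin m → ℝ) (α : Params m d) (x : Vec d) (i : Fin m) :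
    block (netGrad b α x) i =
      (1 / √(m : ℝ) * (b i * if 0 < (inner ℝ (block α i) x : ℝ) then 1 else 0)) • x := by
  ext j; simp [block, netGrad, mul_assoc]

/-- Linearity of the linearized network in `α`, in the form used throughout: bounds on the feature
vector become bounds on `linNet`. -/
theorem inner_netGrad (b : Fin m → ℝ) (α₀ α : Params m d) (x : Vec d) :
    inner ℝ (netGrad b α₀ x) α = linNet b α₀ α x := by
  rw [inner_params, linNet, Finset.mul_sum]
  refine Finset.sum_congr rfl fun i _ => ?_
  rw [block_netGrad, real_inner_smul_left, real_inner_comm (block α i)]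
  ring

theorem linNet_self (b : Fin m → ℝ) (α : Params m d) (x : Vec d) :
    linNet b α α x = net b α x := by
  unfold linNet net
  congr 1
  refine Finset.sum_congr rfl fun i _ => ?_
  split_ifs with h
  · rw [max_eq_right h.le, one_mul]
  · rw [max_eq_left (not_lt.1 h), zero_mul]

theorem one_div_sqrt_sq (m : ℕ) : (1 / √(m : ℝ)) ^ 2 = 1 / m := by
  rw [div_pow, Real.sq_sqrt (Nat.cast_nonneg m), one_pow]

theorem mul_one_div_le_one' (m : ℕ) : (m : ℝ) * (1 / m) ≤ 1 := by
  rw [mul_one_div]; exact div_self_le_one _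

theorem abs_eq_one_of_sq {t : ℝ} (h : t ^ 2 = 1) : |t| = 1 := by
  rcases sq_eq_one_iff.1 h with h | h <;> simp [h]

theorem norm_netGrad_le_one {b : Fin m → ℝ} (hb : ∀ i, b i ^ 2 = 1) (α : Params m d) {x : Vec d}
    (hx : ‖x‖ ≤ 1) : ‖netGrad b α x‖ ≤ 1 := by
  have hx2 : ‖x‖ ^ 2 ≤ 1 := by nlinarith [norm_nonneg x]
  have : ‖netGrad b α x‖ ^ 2 ≤ 1 := by
    rw [norm_sq_params]
    calc ∑ i, ‖block (netGrad b α x) i‖ ^ 2 ≤ ∑ _i : Fin m, 1 / (m : ℝ) := by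
          refine Finset.sum_le_sum fun i _ => ?_
          rw [block_netGrad, norm_smul, mul_pow, Real.norm_eq_abs, sq_abs, mul_pow, mul_pow, hb,
            one_div_sqrt_sq]
          have hm : 0 ≤ 1 / (m : ℝ) := by positivity
          split_ifs
          · nlinarith
          · simp
      _ ≤ 1 := by
          rw [Finset.sum_const, Finset.card_univ, Fintype.card_fin, nsmul_eq_mul]
          exact mul_one_div_le_one' m
  nlinarith [norm_nonneg (netGrad b α x)]

/-- The fraction of the neurons whose activation at `x` differs between `α₀` and `α`. -/
noncomputable def mismatchFrac (α₀ α : Params m d) (x : Vec d) : ℝ :=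
  1 / m * ∑ i, if (0 < (inner ℝ (block α i) x : ℝ) ↔ 0 < (inner ℝ (block α₀ i) x : ℝ)) then 0 else 1

theorem mismatchFrac_nonneg (α₀ α : Params m d) (x : Vec d) : 0 ≤ mismatchFrac α₀ α x :=
  mul_nonneg (by positivity) (Finset.sum_nonneg fun i _ => by split_ifs <;> norm_num)

theorem mismatchFrac_le_one (α₀ α : Params m d) (x : Vec d) : mismatchFrac α₀ α x ≤ 1 := by
  refine le_trans (mul_le_mul_of_nonneg_left (Finset.sum_le_sum (g := fun _ => (1 : ℝ))
    fun i _ => by split_ifs <;> norm_num) (by positivity)) ?_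
  simp only [Finset.sum_const, Finset.card_univ, Fintype.card_fin, nsmul_eq_mul, mul_one]
  rw [mul_comm]; exact mul_one_div_le_one' m

theorem norm_netGrad_sub_sq_le {b : Fin m → ℝ} (hb : ∀ i, b i ^ 2 = 1) (α₀ α : Params m d)
    {x : Vec d} (hx : ‖x‖ ≤ 1) :
    ‖netGrad b α x - netGrad b α₀ x‖ ^ 2 ≤ mismatchFrac α₀ α x := by
  have hx2 : ‖x‖ ^ 2 ≤ 1 := by nlinarith [norm_nonneg x]
  rw [norm_sq_params, mismatchFrac, Finset.mul_sum]
  refine Finset.sum_le_sum fun i _ => ?_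
  rw [block_sub, block_netGrad, block_netGrad, ← sub_smul, ← mul_sub, ← mul_sub, norm_smul, mul_pow,
    Real.norm_eq_abs, sq_abs, mul_pow, mul_pow, hb, one_div_sqrt_sq]
  have hm : 0 ≤ 1 / (m : ℝ) := by positivity
  have hm2 : 1 / (m : ℝ) * ‖x‖ ^ 2 ≤ 1 / m := mul_le_of_le_one_right hm hx2
  split_ifs <;> first | (exfalso; tauto) | (simp; done) | simpa using hm2

/-- If the activations differ, the two pre-activations lie on opposite sides of zero, so each is at
most their distance in absolute value. -/
theorem abs_inner_le_of_mismatch {a a₀ x : Vec d} (hx : ‖x‖ ≤ 1)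
    (h : ¬ (0 < (inner ℝ a x : ℝ) ↔ 0 < (inner ℝ a₀ x : ℝ))) :
    |(inner ℝ a x : ℝ)| ≤ ‖a - a₀‖ ∧ |(inner ℝ a₀ x : ℝ)| ≤ ‖a - a₀‖ := by
  have h1 : |(inner ℝ (a - a₀) x : ℝ)| ≤ ‖a - a₀‖ :=
    (abs_real_inner_le_norm _ _).trans (mul_le_of_le_one_right (norm_nonneg _) hx)
  rw [inner_sub_left] at h1
  have h2 := abs_le.1 h1
  constructor <;> rw [abs_le] <;>
  · by_cases h3 : 0 < (inner ℝ a x : ℝ)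
    · have h4 : ¬ 0 < (inner ℝ a₀ x : ℝ) := by tauto
      constructor <;> linarith
    · have h4 : 0 < (inner ℝ a₀ x : ℝ) := by tauto
      constructor <;> linarith

/-- Only neurons with a changed activation contribute, each at most the displacement of its block;
Cauchy–Schwarz over these neurons separates the total displacement from their fraction. -/
theorem sq_net_sub_linNet_le {b : Fin m → ℝ} (hb : ∀ i, b i ^ 2 = 1) (α₀ α : Params m d)
    {x : Vec d} (hx : ‖x‖ ≤ 1) :
    (net b α x - linNet b α₀ α x) ^ 2 ≤ ‖α - α₀‖ ^ 2 * mismatchFrac α₀ α x := by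
  set χ : Fin m → ℝ := fun i =>
    if (0 < (inner ℝ (block α i) x : ℝ) ↔ 0 < (inner ℝ (block α₀ i) x : ℝ)) then 0 else 1 with hχ
  have hχ2 : ∀ i, χ i ^ 2 = χ i := fun i => by simp only [hχ]; split_ifs <;> norm_num
  have key : |∑ i, b i * (((if 0 < (inner ℝ (block α i) x : ℝ) then 1 else 0)
      - (if 0 < (inner ℝ (block α₀ i) x : ℝ) then 1 else 0)) * inner ℝ (block α i) x)|
      ≤ ∑ i, χ i * ‖block (α - α₀) i‖ := by
    refine (Finset.abs_sum_le_sum_abs _ _).trans (Finset.sum_le_sum fun i _ => ?_)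
    have hbi : |b i| = 1 := abs_eq_one_of_sq (hb i)
    rw [abs_mul, hbi, one_mul, block_sub]
    by_cases h : (0 < (inner ℝ (block α i) x : ℝ) ↔ 0 < (inner ℝ (block α₀ i) x : ℝ))
    · simp [hχ, h]
    · have h1 := (abs_inner_le_of_mismatch hx h).1
      simp only [hχ, if_neg h, abs_mul, one_mul]
      refine le_trans (mul_le_of_le_one_left (abs_nonneg _) ?_) h1
      split_ifs <;> norm_num
  have e : net b α x - linNet b α₀ α x = 1 / √(m : ℝ) *
      ∑ i, b i * (((if 0 < (inner ℝ (block α i) x : ℝ) then 1 else 0)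
      - (if 0 < (inner ℝ (block α₀ i) x : ℝ) then 1 else 0)) * inner ℝ (block α i) x) := by
    rw [← linNet_self, linNet, linNet, ← mul_sub, ← Finset.sum_sub_distrib]
    congr 1
    exact Finset.sum_congr rfl fun i _ => by ring
  rw [e, mul_pow, one_div_sqrt_sq, ← sq_abs]
  calc 1 / (m : ℝ) * _ ≤ 1 / (m : ℝ) * (∑ i, χ i * ‖block (α - α₀) i‖) ^ 2 := by gcongr
    _ ≤ 1 / (m : ℝ) * ((∑ i, χ i ^ 2) * ∑ i, ‖block (α - α₀) i‖ ^ 2) := by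
        gcongr; exact Finset.sum_mul_sq_le_sq_mul_sq _ _ _
    _ = ‖α - α₀‖ ^ 2 * mismatchFrac α₀ α x := by
        rw [← norm_sq_params, mismatchFrac]; simp only [hχ2]; ring

theorem abs_linNet_sub_net_le {b : Fin m → ℝ} (hb : ∀ i, b i ^ 2 = 1) (α₀ α : Params m d)
    {x : Vec d} (hx : ‖x‖ ≤ 1) : |linNet b α₀ α x - net b α₀ x| ≤ ‖α - α₀‖ := by
  rw [← linNet_self, ← inner_netGrad, ← inner_netGrad, ← inner_sub_right]
  exact (abs_real_inner_le_norm _ _).trans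
    (mul_le_of_le_one_left (norm_nonneg _) (norm_netGrad_le_one hb _ hx))

/-- The ReLU is 1-Lipschitz, and in Cauchy–Schwarz over the blocks the factor `m` cancels the
normalization. Together with `abs_linNet_sub_net_le`, this reduces second moments over the ball to
those of the initial network. -/
theorem abs_net_sub_net_le {b : Fin m → ℝ} (hb : ∀ i, b i ^ 2 = 1) (α₀ α : Params m d)
    {x : Vec d} (hx : ‖x‖ ≤ 1) : |net b α x - net b α₀ x| ≤ ‖α - α₀‖ := by
  rcases Nat.eq_zero_or_pos m with rfl | hm
  · simp [net]
  have hm' : (0 : ℝ) < m := by exact_mod_cast hm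
  have h1 : |∑ i, (b i * max 0 (inner ℝ (block α i) x) - b i * max 0 (inner ℝ (block α₀ i) x))| ≤
      ∑ i, 1 * ‖block (α - α₀) i‖ := by
    refine (Finset.abs_sum_le_sum_abs _ _).trans (Finset.sum_le_sum fun i _ => ?_)
    have hbi : |b i| = 1 := abs_eq_one_of_sq (hb i)
    rw [← mul_sub, abs_mul, hbi, one_mul, one_mul, block_sub]
    refine (abs_max_sub_max_le_max _ _ _ _).trans ?_
    rw [sub_self, abs_zero, max_eq_right (abs_nonneg _), ← inner_sub_left]
    exact (abs_real_inner_le_norm _ _).trans (mul_le_of_le_one_right (norm_nonneg _) hx)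
  refine abs_le_of_sq_le_sq ?_ (norm_nonneg _)
  rw [net, net, ← mul_sub, ← Finset.sum_sub_distrib, mul_pow, one_div_sqrt_sq, ← sq_abs]
  calc 1 / (m : ℝ) * _ ≤ 1 / (m : ℝ) * (∑ i, 1 * ‖block (α - α₀) i‖) ^ 2 := by gcongr
    _ ≤ 1 / (m : ℝ) * ((∑ _i : Fin m, 1 ^ 2) * ∑ i, ‖block (α - α₀) i‖ ^ 2) := by
        gcongr; exact Finset.sum_mul_sq_le_sq_mul_sq _ _ _
    _ = ‖α - α₀‖ ^ 2 := by
        rw [← norm_sq_params]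
        simp
        field_simp

theorem measurable_block (i : Fin m) : Measurable fun α : Params m d => block α i := by
  unfold block; fun_prop

theorem measurable_net (b : Fin m → ℝ) :
    Measurable fun p : Params m d × Vec d => net b p.1 p.2 := by
  unfold net
  have := fun i => (measurable_block (m := m) (d := d) i)
  fun_prop

theorem measurable_netGrad (b : Fin m → ℝ) :
    Measurable fun p : Params m d × Vec d => netGrad b p.1 p.2 := by
  unfold netGrad
  have h : ∀ i, Measurable fun p : Params m d × Vec d => (inner ℝ (block p.1 i) p.2 : ℝ) := by
    have := fun i => (measurable_block (m := m) (d := d) i)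
    fun_prop
  refine (WithLp.measurable_toLp 2 _).comp (measurable_pi_lambda _ fun q => ?_)
  refine measurable_const.mul (measurable_const.mul (Measurable.mul ?_ (by fun_prop)))
  exact Measurable.ite (measurableSet_lt measurable_const (h q.1)) measurable_const measurable_const

theorem measurable_net_of_measurable {Z : Type*} [MeasurableSpace Z] (b : Fin m → ℝ)
    {f : Z → Params m d} {g : Z → Vec d} (hf : Measurable f) (hg : Measurable g) :
    Measurable fun z => net b (f z) (g z) := by
  have := (measurable_net b).comp (hf.prodMk hg)
  exact this

theorem measurable_netGrad_of_measurable {Z : Type*} [MeasurableSpace Z] (b : Fin m → ℝ)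
    {f : Z → Params m d} {g : Z → Vec d} (hf : Measurable f) (hg : Measurable g) :
    Measurable fun z => netGrad b (f z) (g z) := by
  have := (measurable_netGrad b).comp (hf.prodMk hg)
  exact this

theorem measurable_linNet (b : Fin m → ℝ) (α₀ : Params m d) :
    Measurable fun p : Params m d × Vec d => linNet b α₀ p.1 p.2 := by
  simp only [← inner_netGrad]
  have h0 : Measurable fun x : Vec d => netGrad b α₀ x :=
    (measurable_netGrad b).of_uncurry_left (f := fun α x => netGrad b α x)
  have h : Measurable fun p : Params m d × Vec d => netGrad b α₀ p.2 := h0.comp measurable_snd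
  exact h.inner measurable_fst

theorem measurable_mismatchFrac (α₀ α : Params m d) : Measurable (mismatchFrac α₀ α) := by
  unfold mismatchFrac
  have h : ∀ β : Params m d, ∀ i, Measurable fun x : Vec d => (inner ℝ (block β i) x : ℝ) := by
    intro β i; fun_prop
  refine measurable_const.mul (Finset.measurable_sum _ fun i _ => ?_)
  refine Measurable.ite ?_ measurable_const measurable_const
  exact (measurableSet_lt measurable_const (h α i)).iff (measurableSet_lt measurable_const (h α₀ i))

/-- The inverse second moment `m⁻¹ ∑ ‖[α₀]_i‖⁻²` of the initial weights. -/
noncomputable def invMoment (α₀ : Params m d) : ℝ := 1 / m * ∑ i, (‖block α₀ i‖ ^ 2)⁻¹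

theorem invMoment_nonneg (α₀ : Params m d) : 0 ≤ invMoment α₀ := by
  unfold invMoment; positivity

/-- Anti-concentration bounds the change probability of neuron `i` by `c ‖[α - α₀]_i‖ / ‖[α₀]_i‖`.
Averaging over `i` with a weighted AM–GM inequality separates `‖α - α₀‖²` from the inverse moment.
-/
theorem integral_mismatchFrac_le {X : Type*} [MeasurableSpace X] {φ : X → Vec d}
    (hφ : Measurable φ) (hφ1 : ∀ x, ‖φ x‖ ≤ 1) {c : ℝ} (hc : 0 < c) {ρ : Measure X}
    [IsProbabilityMeasure ρ] (hρ : AntiConcentrated φ c ρ) (hm : 0 < m) {α₀ α : Params m d}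
    (h0 : ∀ i, block α₀ i ≠ 0) {R : ℝ} (hR : 0 < R) (hα : ‖α - α₀‖ ≤ R) :
    ∫ x, mismatchFrac α₀ α (φ x) ∂ρ ≤ c / 2 * (R / √m) * (1 + invMoment α₀) := by
  have hm' : (0 : ℝ) < m := by exact_mod_cast hm
  have hs : 0 < √(m : ℝ) := Real.sqrt_pos.2 hm'
  have hss : √(m : ℝ) ^ 2 = m := Real.sq_sqrt hm'.le
  set M : Fin m → Set X := fun i =>
    {x | ¬ (0 < (inner ℝ (block α i) (φ x) : ℝ) ↔ 0 < (inner ℝ (block α₀ i) (φ x) : ℝ))} with hM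
  have hmeas : ∀ i, MeasurableSet (M i) := by
    have h : ∀ β : Params m d, ∀ i, Measurable fun x : X => (inner ℝ (block β i) (φ x) : ℝ) := by
      intro β i; fun_prop
    intro i
    exact ((measurableSet_lt measurable_const (h α i)).iff
      (measurableSet_lt measurable_const (h α₀ i))).compl
  have hbound : ∀ i, ρ.real (M i) ≤
      c / 2 * (√m / R * ‖block (α - α₀) i‖ ^ 2 + R / √m * (‖block α₀ i‖ ^ 2)⁻¹) := by
    intro i
    have hz : 0 < ‖block α₀ i‖ := norm_pos_iff.2 (h0 i)
    have h1 : ρ.real (M i) ≤ c * ‖block (α - α₀) i‖ / ‖block α₀ i‖ := by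
      -- Anti-concentration needs a positive threshold; an unmoved block has no activation change at
      -- all.
      rcases eq_or_lt_of_le (norm_nonneg (block (α - α₀) i)) with h | h
      · have : M i = ∅ := by
          rw [Set.eq_empty_iff_forall_notMem]
          intro x hx
          have : block α i = block α₀ i := by
            rw [← sub_eq_zero, ← block_sub]; exact norm_eq_zero.1 h.symm
          simp [hM, this] at hx
        rw [this, ← h]; simp
      · refine le_trans (measureReal_mono fun x hx => ?_) (hρ _ (h0 i) _ h)
        have := (abs_inner_le_of_mismatch (hφ1 x) hx).2
        rwa [← block_sub] at this
    refine h1.trans ?_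
    rw [mul_div_assoc, div_mul_eq_mul_div, mul_div_assoc]
    refine mul_le_mul_of_nonneg_left ?_ hc.le
    -- The weight `√m / R` balances the two sums: since `∑ ‖[α - α₀]_i‖² ≤ R²`, both end up of order
    -- `R / √m`.
    have h2 : √m / R * ‖block (α - α₀) i‖ ^ 2 + R / √m * (‖block α₀ i‖ ^ 2)⁻¹
        - 2 * (‖block (α - α₀) i‖ / ‖block α₀ i‖)
        = √m / R * (‖block (α - α₀) i‖ - R / √m / ‖block α₀ i‖) ^ 2 := by
      field_simp; ring
    have h3 : 0 ≤ √m / R * (‖block (α - α₀) i‖ - R / √m / ‖block α₀ i‖) ^ 2 := by positivity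
    linarith
  have e : ∀ x, mismatchFrac α₀ α (φ x) = 1 / m * ∑ i, (M i).indicator (fun _ => (1 : ℝ)) x := by
    intro x
    unfold mismatchFrac
    congr 1
    refine Finset.sum_congr rfl fun i _ => ?_
    simp only [Set.indicator, hM, Set.mem_ofPred_eq]
    split_ifs <;> rfl
  simp only [e]
  rw [integral_const_mul, integral_finsetSum _ fun i _ =>
    (integrable_const (1 : ℝ)).indicator (hmeas i)]
  simp only [integral_indicator_const _ (hmeas _), smul_eq_mul, mul_one]
  calc 1 / (m : ℝ) * ∑ i, ρ.real (M i) ≤ 1 / (m : ℝ) * ∑ i,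
        c / 2 * (√m / R * ‖block (α - α₀) i‖ ^ 2 + R / √m * (‖block α₀ i‖ ^ 2)⁻¹) := by
        gcongr with i; exact hbound i
    _ = c / 2 * (√m / R * ‖α - α₀‖ ^ 2 / m + R / √m * invMoment α₀) := by
        rw [← Finset.mul_sum, Finset.sum_add_distrib, ← Finset.mul_sum, ← Finset.mul_sum,
          ← norm_sq_params, invMoment]
        ring
    _ ≤ c / 2 * (√m / R * R ^ 2 / m + R / √m * invMoment α₀) := by gcongr
    _ = c / 2 * (R / √m) * (1 + invMoment α₀) := by
        have : √m / R * R ^ 2 / m = R / √(m : ℝ) := by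
          nth_rw 2 [← hss]; field_simp
        rw [this]; ring

end Network

/-! ### Euclidean projection on a ball and nonexpansive maps. -/

section Projection

variable {E : Type*} [NormedAddCommGroup E] [InnerProductSpace ℝ E]

theorem projBall_mem (c : E) {R : ℝ} (hR : 0 ≤ R) (y : E) :
    projBall c R y ∈ Metric.closedBall c R := (projBall_isMinimizer c hR y).1

theorem inner_sub_projBall_le (c : E) {R : ℝ} (hR : 0 ≤ R) (y : E) {z : E}
    (hz : z ∈ Metric.closedBall c R) :
    inner ℝ (y - projBall c R y) (z - projBall c R y) ≤ 0 := by
  have h := projBall_isMinimizer c hR y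
  refine (norm_eq_iInf_iff_real_inner_le_zero (convex_closedBall c R) h.1).1 ?_ z hz
  have : Nonempty (Metric.closedBall c R) := ⟨⟨_, h.1⟩⟩
  refine le_antisymm (le_ciInf fun w => ?_) ?_
  · rw [norm_sub_rev y, norm_sub_rev y]; exact h.2 _ w.2
  · exact ciInf_le ⟨0, by rintro _ ⟨w, rfl⟩; exact norm_nonneg _⟩
      (⟨_, h.1⟩ : Metric.closedBall c R)

theorem eq_projBall_iff (c : E) {R : ℝ} (hR : 0 ≤ R) (y : E) {p : E}
    (hp : p ∈ Metric.closedBall c R) :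
    p = projBall c R y ↔ ∀ z ∈ Metric.closedBall c R, inner ℝ (y - p) (z - p) ≤ 0 := by
  constructor
  · intro h z hz
    have := inner_sub_projBall_le c hR y hz
    rwa [← h] at this
  · intro h
    have h1 := h _ (projBall_mem c hR y)
    have h2 := inner_sub_projBall_le c hR y hp
    set q := projBall c R y
    have h3 : inner ℝ (y - p) (q - p) + inner ℝ (y - q) (p - q) = ‖p - q‖ ^ 2 := by
      rw [← real_inner_self_eq_norm_sq, ← neg_sub p q, inner_neg_right, ← sub_eq_neg_add,
        ← inner_sub_left]
      congr 1; abel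
    have h4 : ‖p - q‖ = 0 := by nlinarith [norm_nonneg (p - q)]
    exact sub_eq_zero.1 (norm_eq_zero.1 h4)

theorem norm_projBall_sub_projBall_le (c : E) {R : ℝ} (hR : 0 ≤ R) (y z : E) :
    ‖projBall c R y - projBall c R z‖ ≤ ‖y - z‖ := by
  have h1 := inner_sub_projBall_le c hR y (projBall_mem c hR z)
  have h2 := inner_sub_projBall_le c hR z (projBall_mem c hR y)
  set p := projBall c R y
  set q := projBall c R z
  have h3 : inner ℝ (y - p) (q - p) + inner ℝ (z - q) (p - q)
      = ‖p - q‖ ^ 2 - inner ℝ (y - z) (p - q) := by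
    rw [← real_inner_self_eq_norm_sq, ← neg_sub p q, inner_neg_right, ← sub_eq_neg_add,
      ← inner_sub_left, ← inner_sub_left]
    congr 1; abel
  have h4 := real_inner_le_norm (y - z) (p - q)
  by_contra h
  push Not at h
  nlinarith [norm_nonneg (y - z), norm_nonneg (p - q)]

theorem norm_projBall_sub_le (c : E) {R : ℝ} (hR : 0 ≤ R) (y : E) {z : E}
    (hz : z ∈ Metric.closedBall c R) : ‖projBall c R y - z‖ ≤ ‖y - z‖ := by
  have : z = projBall c R z := by
    rw [eq_projBall_iff c hR z hz]; simp
  conv_lhs => rw [this]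
  exact norm_projBall_sub_projBall_le c hR y z

/-- A nonexpansive map of a finite-dimensional space with values in a ball has a fixed point. -/
theorem exists_fixedPoint_of_nonexpansive [FiniteDimensional ℝ E] {c : E} {R : ℝ} {F : E → E}
    (hF : LipschitzWith 1 F) (hmem : ∀ x, F x ∈ Metric.closedBall c R) : ∃ x, F x = x := by
  have hR : 0 ≤ R := dist_nonneg.trans (hmem c)
  have : ProperSpace E := FiniteDimensional.proper ℝ E
  have : CompleteSpace E := FiniteDimensional.complete ℝ E
  set t : ℕ → ℝ := fun n => 1 / ((n : ℝ) + 1) with ht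
  have ht0 : ∀ n, 0 < t n := fun n => by positivity
  have ht1 : ∀ n, t n ≤ 1 := fun n => by
    rw [ht]; exact div_le_one_of_le₀ (by linarith [n.cast_nonneg (α := ℝ)]) (by positivity)
  -- Pulling `F` towards the centre by a fraction `t n` makes it a strict contraction. Its fixed
  -- point is an approximate fixed point of `F`, with defect at most `t n * R`.
  have hex : ∀ n, ∃ x, F x - t n • (F x - c) = x := by
    intro n
    have hc : ContractingWith (Real.toNNReal (1 - t n)) (fun x => F x - t n • (F x - c)) := by
      constructor
      · rw [← NNReal.coe_lt_coe, Real.coe_toNNReal _ (by linarith [ht1 n])]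
        simpa using ht0 n
      · refine LipschitzWith.of_dist_le_mul fun x y => ?_
        rw [Real.coe_toNNReal _ (by linarith [ht1 n]), dist_eq_norm]
        have e : F x - t n • (F x - c) - (F y - t n • (F y - c)) = (1 - t n) • (F x - F y) := by
          module
        rw [e, norm_smul, Real.norm_eq_abs, abs_of_nonneg (by linarith [ht1 n])]
        have := hF.dist_le_mul x y
        rw [dist_eq_norm, NNReal.coe_one, one_mul] at this
        exact mul_le_mul_of_nonneg_left this (by linarith [ht1 n])
    exact ⟨_, hc.fixedPoint_isFixedPt⟩
  choose x hx using hex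
  have hdist : ∀ n, ‖F (x n) - x n‖ ≤ t n * R := by
    intro n
    have : F (x n) - x n = t n • (F (x n) - c) := by
      nth_rw 2 [← hx n]; abel
    rw [this, norm_smul, Real.norm_eq_abs, abs_of_pos (ht0 n), ← dist_eq_norm]
    exact mul_le_mul_of_nonneg_left (hmem _) (ht0 n).le
  -- Compactness is applied to the values `F (x n)`, which lie in the ball by assumption; the points
  -- `x n` follow because the defect tends to zero.
  have hb : ∀ n, F (x n) ∈ Metric.closedBall c R := fun n => hmem _
  obtain ⟨y, -, s, hs, hlim⟩ := (isCompact_closedBall c R).tendsto_subseq hb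
  have htlim : Filter.Tendsto (fun n => t n * R) Filter.atTop (nhds 0) := by
    have := (tendsto_one_div_add_atTop_nhds_zero_nat (𝕜 := ℝ)).mul_const R
    rwa [zero_mul] at this
  have h0 : Filter.Tendsto (fun n => F (x n) - x n) Filter.atTop (nhds 0) :=
    squeeze_zero_norm hdist htlim
  have hxs : Filter.Tendsto (fun n => x (s n)) Filter.atTop (nhds y) := by
    have := hlim.sub (h0.comp hs.tendsto_atTop)
    simpa [Function.comp_def] using this
  refine ⟨y, tendsto_nhds_unique ((hF.continuous.tendsto y).comp hxs) hlim⟩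

end Projection

/-! ### Monotonicity of the mean semigradient and stationary points. -/

section Stationary

variable {X : Type*} [MeasurableSpace X] {m d : ℕ} {φ : X → Vec d} {b : Fin m → ℝ}
  {α₀ : Params m d} {v : X → ℝ} {μ : ℝ} {ρ : Measure X} {J : Measure (X × X)}

theorem linNet_sub (b : Fin m → ℝ) (α₀ α β : Params m d) (x : Vec d) :
    linNet b α₀ (α - β) x = linNet b α₀ α x - linNet b α₀ β x := by
  simp only [← inner_netGrad, inner_sub_right]

theorem abs_linNet_le (hb : ∀ i, b i ^ 2 = 1) (α₀ α : Params m d) {x : Vec d}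
    (hx : ‖x‖ ≤ 1) : |linNet b α₀ α x| ≤ ‖α‖ := by
  rw [← inner_netGrad]
  exact (abs_real_inner_le_norm _ _).trans
    (mul_le_of_le_one_left (norm_nonneg _) (norm_netGrad_le_one hb _ hx))

theorem measurable_netGrad_comp (hφ : Measurable φ) (b : Fin m → ℝ) (α : Params m d) :
    Measurable fun x => netGrad b α (φ x) :=
  ((measurable_netGrad b).of_uncurry_left (f := fun α x => netGrad b α x)).comp hφ

theorem measurable_linNet_comp (hφ : Measurable φ) (b : Fin m → ℝ) (α₀ α : Params m d) :
    Measurable fun x => linNet b α₀ α (φ x) := by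
  simp only [← inner_netGrad]
  exact (measurable_netGrad_comp hφ b α₀).inner measurable_const

theorem memLp_linNet (hφ : Measurable φ) (hφ1 : ∀ x, ‖φ x‖ ≤ 1) (hb : ∀ i, b i ^ 2 = 1)
    [IsFiniteMeasure ρ] (α₀ α : Params m d) (p : ℝ≥0∞) :
    MemLp (fun x => linNet b α₀ α (φ x)) p ρ :=
  MemLp.of_bound (measurable_linNet_comp hφ b α₀ α).aestronglyMeasurable ‖α‖
    (ae_of_all _ fun x => abs_linNet_le hb α₀ α (hφ1 x))

theorem memLp_net (hφ : Measurable φ) (hφ1 : ∀ x, ‖φ x‖ ≤ 1) (hb : ∀ i, b i ^ 2 = 1)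
    [IsFiniteMeasure ρ] (α : Params m d) (p : ℝ≥0∞) :
    MemLp (fun x => net b α (φ x)) p ρ := by
  simp only [← linNet_self]
  exact memLp_linNet hφ hφ1 hb α α p

theorem memLp_residual {f : X → ℝ} (hf : MemLp f 2 ρ) (hv : MemLp v 2 ρ)
    (h1 : MeasurePreserving Prod.fst J ρ) (h2 : MeasurePreserving Prod.snd J ρ) :
    MemLp (residual f v μ) 2 J :=
  ((hf.comp_measurePreserving h1).sub (hv.comp_measurePreserving h1)).sub
    ((hf.comp_measurePreserving h2).const_mul μ)

theorem integrable_smul_netGrad (hφ : Measurable φ) (hφ1 : ∀ x, ‖φ x‖ ≤ 1)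
    (hb : ∀ i, b i ^ 2 = 1) {k : X × X → ℝ} (hk : Integrable k J) (α : Params m d) :
    Integrable (fun z => k z • netGrad b α (φ z.1)) J := by
  have hm : Measurable fun z : X × X => netGrad b α (φ z.1) :=
    (measurable_netGrad_comp hφ b α).comp measurable_fst
  refine hk.mono (hk.1.smul hm.aestronglyMeasurable) (ae_of_all _ fun z => ?_)
  rw [norm_smul]
  exact mul_le_of_le_one_right (norm_nonneg _) (norm_netGrad_le_one hb α (hφ1 z.1))

theorem inner_linMeanUpdate (hφ : Measurable φ) (hφ1 : ∀ x, ‖φ x‖ ≤ 1) (hb : ∀ i, b i ^ 2 = 1)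
    [IsFiniteMeasure ρ] [IsFiniteMeasure J] (hv : MemLp v 2 ρ)
    (h1 : MeasurePreserving Prod.fst J ρ) (h2 : MeasurePreserving Prod.snd J ρ)
    (α β : Params m d) :
    inner ℝ (linMeanUpdate φ b α₀ v μ J α) β =
      ∫ z, residual (fun x => linNet b α₀ α (φ x)) v μ z * linNet b α₀ β (φ z.1) ∂J := by
  have hk : Integrable (residual (fun x => linNet b α₀ α (φ x)) v μ) J :=
    (memLp_residual (memLp_linNet hφ hφ1 hb α₀ α 2) hv h1 h2).integrable (by norm_num)
  rw [linMeanUpdate, real_inner_comm, ← integral_inner (integrable_smul_netGrad hφ hφ1 hb hk α₀)]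
  refine integral_congr_ae (ae_of_all _ fun z => ?_)
  simp only [real_inner_smul_right]
  rw [real_inner_comm, inner_netGrad]

theorem inner_linMeanUpdate_sub (hφ : Measurable φ) (hφ1 : ∀ x, ‖φ x‖ ≤ 1)
    (hb : ∀ i, b i ^ 2 = 1) [IsFiniteMeasure ρ] [IsFiniteMeasure J] (hv : MemLp v 2 ρ)
    (h1 : MeasurePreserving Prod.fst J ρ) (h2 : MeasurePreserving Prod.snd J ρ)
    (α β γ : Params m d) :
    inner ℝ (linMeanUpdate φ b α₀ v μ J α - linMeanUpdate φ b α₀ v μ J β) γ =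
      ∫ z, (linNet b α₀ (α - β) (φ z.1) - μ * linNet b α₀ (α - β) (φ z.2)) *
        linNet b α₀ γ (φ z.1) ∂J := by
  have hi : ∀ δ : Params m d, Integrable (fun z =>
      residual (fun x => linNet b α₀ δ (φ x)) v μ z * linNet b α₀ γ (φ z.1)) J := fun δ =>
    (memLp_residual (memLp_linNet hφ hφ1 hb α₀ δ 2) hv h1 h2).integrable_mul
      ((memLp_linNet (ρ := ρ) hφ hφ1 hb α₀ γ 2).comp_measurePreserving h1)
  rw [inner_sub_left, inner_linMeanUpdate hφ hφ1 hb hv h1 h2,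
    inner_linMeanUpdate hφ hφ1 hb hv h1 h2, ← integral_sub (hi α) (hi β)]
  refine integral_congr_ae (ae_of_all _ fun z => ?_)
  simp only [residual, linNet_sub]
  ring

theorem integral_sq_fst {f : X → ℝ} (h1 : MeasurePreserving Prod.fst J ρ) (hf : MemLp f 2 ρ) :
    ∫ z, f z.1 ^ 2 ∂J = ∫ x, f x ^ 2 ∂ρ := by
  rw [← h1.map_eq, integral_map h1.measurable.aemeasurable]
  rw [h1.map_eq]; exact (hf.1.pow 2)

theorem integral_sq_snd {f : X → ℝ} (h2 : MeasurePreserving Prod.snd J ρ) (hf : MemLp f 2 ρ) :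
    ∫ z, f z.2 ^ 2 ∂J = ∫ x, f x ^ 2 ∂ρ := by
  rw [← h2.map_eq, integral_map h2.measurable.aemeasurable]
  rw [h2.map_eq]; exact (hf.1.pow 2)

/-- Averaging over a stationary transition contracts: `E[(f(x) - μ f(x')) f(x)] ≥ (1 - μ) E f²`. -/
theorem one_sub_mul_integral_sq_le {f : X → ℝ} (hμ0 : 0 ≤ μ) (hf : MemLp f 2 ρ)
    (h1 : MeasurePreserving Prod.fst J ρ) (h2 : MeasurePreserving Prod.snd J ρ) :
    (1 - μ) * ∫ x, f x ^ 2 ∂ρ ≤ ∫ z, (f z.1 - μ * f z.2) * f z.1 ∂J := by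
  have m1 := hf.comp_measurePreserving h1
  have m2 := hf.comp_measurePreserving h2
  have i1 : Integrable (fun z : X × X => f z.1 ^ 2) J := m1.integrable_sq
  have i2 : Integrable (fun z : X × X => f z.2 ^ 2) J := m2.integrable_sq
  -- By stationarity both marginals carry the same second moment, so it can be split with weights `1
  -- - μ / 2` and `-μ / 2`; the pointwise bound is then `2 f(x) f(x') ≤ f(x)² + f(x')²`.
  calc (1 - μ) * ∫ x, f x ^ 2 ∂ρ
      = ∫ z, ((1 - μ / 2) * f z.1 ^ 2 - μ / 2 * f z.2 ^ 2) ∂J := by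
        rw [integral_sub (i1.const_mul _) (i2.const_mul _), integral_const_mul, integral_const_mul,
          integral_sq_fst h1 hf, integral_sq_snd h2 hf]
        ring
    _ ≤ _ := by
        refine integral_mono ((i1.const_mul _).sub (i2.const_mul _))
          ((m1.sub (m2.const_mul μ)).integrable_mul m1) fun z => ?_
        simp only
        nlinarith [mul_nonneg hμ0 (sq_nonneg (f z.1 - f z.2))]

theorem inner_linMeanUpdate_sub_ge (hφ : Measurable φ) (hφ1 : ∀ x, ‖φ x‖ ≤ 1)
    (hb : ∀ i, b i ^ 2 = 1) [IsFiniteMeasure ρ] [IsFiniteMeasure J] (hv : MemLp v 2 ρ)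
    (h1 : MeasurePreserving Prod.fst J ρ) (h2 : MeasurePreserving Prod.snd J ρ) (hμ0 : 0 ≤ μ)
    (α β : Params m d) :
    (1 - μ) * ∫ x, linNet b α₀ (α - β) (φ x) ^ 2 ∂ρ ≤
      inner ℝ (linMeanUpdate φ b α₀ v μ J α - linMeanUpdate φ b α₀ v μ J β) (α - β) := by
  rw [inner_linMeanUpdate_sub hφ hφ1 hb hv h1 h2]
  exact one_sub_mul_integral_sq_le hμ0 (memLp_linNet hφ hφ1 hb α₀ (α - β) 2) h1 h2

/-- The difference `D` is paired with itself. Young's inequality produces `‖D‖² / 2` on the right,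
which is absorbed. Unlike a Lipschitz bound in `‖α - β‖`, the bound is in the same seminorm as the
monotonicity estimate, so a small step size suffices although `G` need not be strongly monotone in
the weights. -/
theorem norm_linMeanUpdate_sub_sq_le (hφ : Measurable φ) (hφ1 : ∀ x, ‖φ x‖ ≤ 1)
    (hb : ∀ i, b i ^ 2 = 1) [IsFiniteMeasure ρ] [IsProbabilityMeasure J] (hv : MemLp v 2 ρ)
    (h1 : MeasurePreserving Prod.fst J ρ) (h2 : MeasurePreserving Prod.snd J ρ) (hμ0 : 0 ≤ μ)
    (hμ1 : μ < 1) (α β : Params m d) :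
    ‖linMeanUpdate φ b α₀ v μ J α - linMeanUpdate φ b α₀ v μ J β‖ ^ 2 ≤
      4 * ∫ x, linNet b α₀ (α - β) (φ x) ^ 2 ∂ρ := by
  set D := linMeanUpdate φ b α₀ v μ J α - linMeanUpdate φ b α₀ v μ J β with hD
  have e := inner_linMeanUpdate_sub (α₀ := α₀) (μ := μ) hφ hφ1 hb hv h1 h2 α β D
  rw [← hD, real_inner_self_eq_norm_sq] at e
  set f : X → ℝ := fun x => linNet b α₀ (α - β) (φ x) with hf
  have mf : MemLp f 2 ρ := memLp_linNet hφ hφ1 hb α₀ (α - β) 2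
  have m1 := mf.comp_measurePreserving h1
  have m2 := mf.comp_measurePreserving h2
  have i1 : Integrable (fun z : X × X => f z.1 ^ 2) J := m1.integrable_sq
  have i2 : Integrable (fun z : X × X => f z.2 ^ 2) J := m2.integrable_sq
  have mD := (memLp_linNet (ρ := ρ) hφ hφ1 hb α₀ D 2).comp_measurePreserving h1
  have h : ‖D‖ ^ 2 ≤ ∫ z, (f z.1 ^ 2 + f z.2 ^ 2 + 1 / 2 * ‖D‖ ^ 2) ∂J := by
    conv_lhs => rw [e]
    refine integral_mono ((m1.sub (m2.const_mul μ)).integrable_mul mD)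
      ((i1.add i2).add (integrable_const _)) fun z => ?_
    have hk := abs_linNet_le hb α₀ D (hφ1 z.1)
    have hk2 : linNet b α₀ D (φ z.1) ^ 2 ≤ ‖D‖ ^ 2 := sq_le_sq' (by linarith [(abs_le.1 hk).1])
      (abs_le.1 hk).2
    change (f z.1 - μ * f z.2) * linNet b α₀ D (φ z.1) ≤ _
    have hμ2 : μ ^ 2 * f z.2 ^ 2 ≤ f z.2 ^ 2 :=
      mul_le_of_le_one_left (sq_nonneg _) (by nlinarith)
    nlinarith [sq_nonneg (f z.1 - μ * f z.2 - linNet b α₀ D (φ z.1)),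
      sq_nonneg (f z.1 + μ * f z.2)]
  have hint : ∫ z : X × X, (f z.1 ^ 2 + f z.2 ^ 2 + 1 / 2 * ‖D‖ ^ 2) ∂J
      = 2 * ∫ x, f x ^ 2 ∂ρ + 1 / 2 * ‖D‖ ^ 2 := by
    have i12 : Integrable (fun z : X × X => f z.1 ^ 2 + f z.2 ^ 2) J := i1.add i2
    rw [integral_add i12 (integrable_const _), integral_add i1 i2,
      integral_sq_fst h1 mf, integral_sq_snd h2 mf]
    simp; ring
  rw [hint] at h
  change _ ≤ 4 * ∫ x, f x ^ 2 ∂ρ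
  linarith

/-- The obtuse-angle characterization of the projection; the positive factor `η` drops out, so
stationarity does not depend on the step size. -/
theorem isStationaryPoint_iff {R η : ℝ} (hR : 0 ≤ R) (hη : 0 < η) {α : Params m d}
    (hα : α ∈ Metric.closedBall α₀ R) :
    IsStationaryPoint φ b α₀ v μ R η J α ↔
      ∀ β ∈ Metric.closedBall α₀ R, 0 ≤ inner ℝ (linMeanUpdate φ b α₀ v μ J α) (β - α) := by
  rw [IsStationaryPoint, eq_projBall_iff α₀ hR _ hα, and_iff_right hα]
  refine forall₂_congr fun β _ => ?_
  rw [sub_sub_cancel_left, inner_neg_left, real_inner_smul_left, neg_nonpos,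
    mul_nonneg_iff_of_pos_left hη]

theorem exists_isStationaryPoint (hφ : Measurable φ) (hφ1 : ∀ x, ‖φ x‖ ≤ 1)
    (hb : ∀ i, b i ^ 2 = 1) [IsFiniteMeasure ρ] [IsProbabilityMeasure J] (hv : MemLp v 2 ρ)
    (h1 : MeasurePreserving Prod.fst J ρ) (h2 : MeasurePreserving Prod.snd J ρ) (hμ0 : 0 ≤ μ)
    (hμ1 : μ < 1) {R η : ℝ} (hR : 0 ≤ R) (hη : 0 < η) (hη1 : 2 * η ≤ 1 - μ) :
    ∃ α, IsStationaryPoint φ b α₀ v μ R η J α := by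
  set G := linMeanUpdate φ b α₀ v μ J with hG
  obtain ⟨α, hα⟩ := exists_fixedPoint_of_nonexpansive (c := α₀) (R := R)
    (F := fun α => projBall α₀ R (α - η • G α)) (by
      refine LipschitzWith.of_dist_le_mul fun α β => ?_
      rw [NNReal.coe_one, one_mul, dist_eq_norm, dist_eq_norm]
      refine (norm_projBall_sub_projBall_le α₀ hR _ _).trans ?_
      have e : α - η • G α - (β - η • G β) = (α - β) - η • (G α - G β) := by module
      have hm := inner_linMeanUpdate_sub_ge (α₀ := α₀) hφ hφ1 hb hv h1 h2 hμ0 α β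
      have hl := norm_linMeanUpdate_sub_sq_le (α₀ := α₀) hφ hφ1 hb hv h1 h2 hμ0 hμ1 α β
      rw [← hG] at hm hl
      rw [e]
      refine abs_le_of_sq_le_sq' ?_ (norm_nonneg _) |>.2
      rw [norm_sub_sq_real, real_inner_smul_right, norm_smul, mul_pow, Real.norm_eq_abs, sq_abs,
        real_inner_comm]
      have hI : 0 ≤ ∫ x, linNet b α₀ (α - β) (φ x) ^ 2 ∂ρ :=
        integral_nonneg fun x => sq_nonneg _
      set I := ∫ x, linNet b α₀ (α - β) (φ x) ^ 2 ∂ρ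
      have a1 : η * ((1 - μ) * I) ≤ η * inner ℝ (G α - G β) (α - β) :=
        mul_le_mul_of_nonneg_left hm hη.le
      have a2 : η ^ 2 * ‖G α - G β‖ ^ 2 ≤ η ^ 2 * (4 * I) :=
        mul_le_mul_of_nonneg_left hl (sq_nonneg _)
      -- Expanding the square changes `‖α - β‖²` by at most `-2η(1 - μ) I + 4η² I`, which is
      -- nonpositive exactly thanks to this term.
      have a3 : 0 ≤ (1 - μ - 2 * η) * (η * I) :=
        mul_nonneg (by linarith) (mul_nonneg hη.le hI)
      nlinarith) (fun α => projBall_mem α₀ hR _)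
  exact ⟨α, by rw [← hα]; exact projBall_mem α₀ hR _, hα.symm⟩

/-- Any two solutions of the variational inequality agree in `L²(ρ)`. -/
theorem linNet_ae_eq_of_isStationaryPoint (hφ : Measurable φ) (hφ1 : ∀ x, ‖φ x‖ ≤ 1)
    (hb : ∀ i, b i ^ 2 = 1) [IsFiniteMeasure ρ] [IsProbabilityMeasure J] (hv : MemLp v 2 ρ)
    (h1 : MeasurePreserving Prod.fst J ρ) (h2 : MeasurePreserving Prod.snd J ρ) (hμ0 : 0 ≤ μ)
    (hμ1 : μ < 1) {R η : ℝ} (hR : 0 ≤ R) (hη : 0 < η) {α β : Params m d}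
    (hα : IsStationaryPoint φ b α₀ v μ R η J α) (hβ : IsStationaryPoint φ b α₀ v μ R η J β) :
    (fun x => linNet b α₀ α (φ x)) =ᵐ[ρ] fun x => linNet b α₀ β (φ x) := by
  have a1 := (isStationaryPoint_iff hR hη hα.1).1 hα β hβ.1
  have a2 := (isStationaryPoint_iff hR hη hβ.1).1 hβ α hα.1
  have hm := inner_linMeanUpdate_sub_ge (α₀ := α₀) hφ hφ1 hb hv h1 h2 hμ0 α β
  rw [inner_sub_left] at hm
  rw [← neg_sub α β, inner_neg_right] at a1
  have hI : ∫ x, linNet b α₀ (α - β) (φ x) ^ 2 ∂ρ ≤ 0 := by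
    by_contra h
    push Not at h
    nlinarith [mul_pos (sub_pos.2 hμ1) h]
  have hI0 := le_antisymm hI (integral_nonneg fun x => sq_nonneg _)
  rw [integral_eq_zero_iff_of_nonneg (fun x => sq_nonneg _)
    (memLp_linNet hφ hφ1 hb α₀ (α - β) 2).integrable_sq] at hI0
  filter_upwards [hI0] with x hx
  have hx' : linNet b α₀ (α - β) (φ x) ^ 2 = 0 := hx
  rw [linNet_sub] at hx'
  exact sub_eq_zero.1 (pow_eq_zero_iff two_ne_zero |>.1 hx')

/-- First-order characterization of the `L²(ρ)`-projection on the linearized class. -/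
theorem isL2Proj_linClass_iff (hφ : Measurable φ) (hφ1 : ∀ x, ‖φ x‖ ≤ 1)
    (hb : ∀ i, b i ^ 2 = 1) [IsFiniteMeasure ρ] {g : X → ℝ} (hg : MemLp g 2 ρ) {R : ℝ}
    {α : Params m d} (hα : α ∈ Metric.closedBall α₀ R) :
    IsL2Proj ρ (linClass φ b α₀ R) g (fun x => linNet b α₀ α (φ x)) ↔
      ∀ β ∈ Metric.closedBall α₀ R,
        0 ≤ ∫ x, (linNet b α₀ α (φ x) - g x) * linNet b α₀ (β - α) (φ x) ∂ρ := by
  have mf : ∀ β : Params m d, MemLp (fun x => linNet b α₀ β (φ x)) 2 ρ := fun β =>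
    memLp_linNet hφ hφ1 hb α₀ β 2
  have mfg : ∀ β : Params m d, MemLp (fun x => linNet b α₀ β (φ x) - g x) 2 ρ := fun β =>
    (mf β).sub hg
  have conv : ∀ β : Params m d, ∫⁻ x, ENNReal.ofReal ((linNet b α₀ β (φ x) - g x) ^ 2) ∂ρ
      = ENNReal.ofReal (∫ x, (linNet b α₀ β (φ x) - g x) ^ 2 ∂ρ) := fun β =>
    (ofReal_integral_eq_lintegral_ofReal (mfg β).integrable_sq
      (ae_of_all _ fun x => sq_nonneg _)).symm
  -- The squared distance along a segment is a quadratic in `t`; its linear coefficient carries the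
  -- first-order condition.
  have quad : ∀ (β : Params m d) (t : ℝ),
      ∫ x, (linNet b α₀ (α + t • (β - α)) (φ x) - g x) ^ 2 ∂ρ =
        ∫ x, (linNet b α₀ α (φ x) - g x) ^ 2 ∂ρ +
        2 * t * ∫ x, (linNet b α₀ α (φ x) - g x) * linNet b α₀ (β - α) (φ x) ∂ρ +
        t ^ 2 * ∫ x, linNet b α₀ (β - α) (φ x) ^ 2 ∂ρ := by
    intro β t
    have i1 := (mfg α).integrable_sq
    have i2 : Integrable (fun x => (linNet b α₀ α (φ x) - g x) * linNet b α₀ (β - α) (φ x)) ρ :=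
      (mfg α).integrable_mul (mf (β - α))
    have i3 := (mf (β - α)).integrable_sq
    have i12 : Integrable (fun x => (linNet b α₀ α (φ x) - g x) ^ 2 +
        2 * t * ((linNet b α₀ α (φ x) - g x) * linNet b α₀ (β - α) (φ x))) ρ :=
      i1.add (i2.const_mul _)
    rw [← integral_const_mul, ← integral_const_mul, ← integral_add i1 (i2.const_mul _),
      ← integral_add i12 (i3.const_mul _)]
    refine integral_congr_ae (ae_of_all _ fun x => ?_)
    simp only [← inner_netGrad, inner_add_right, real_inner_smul_right]
    ring
  have step : IsL2Proj ρ (linClass φ b α₀ R) g (fun x => linNet b α₀ α (φ x)) ↔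
      ∀ β ∈ Metric.closedBall α₀ R, ∫ x, (linNet b α₀ α (φ x) - g x) ^ 2 ∂ρ ≤
        ∫ x, (linNet b α₀ β (φ x) - g x) ^ 2 ∂ρ := by
    constructor
    · rintro ⟨-, h⟩ β hβ
      have := h _ ⟨β, hβ, rfl⟩
      rw [conv, conv] at this
      exact (ENNReal.ofReal_le_ofReal_iff (integral_nonneg fun x => sq_nonneg _)).1 this
    · refine fun h => ⟨⟨α, hα, rfl⟩, ?_⟩
      rintro _ ⟨β, hβ, rfl⟩
      simp only [conv]
      exact ENNReal.ofReal_le_ofReal (h β hβ)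
  rw [step]
  constructor
  · intro h β hβ
    by_contra! hneg
    set B := ∫ x, (linNet b α₀ α (φ x) - g x) * linNet b α₀ (β - α) (φ x) ∂ρ
    set D := ∫ x, linNet b α₀ (β - α) (φ x) ^ 2 ∂ρ with hD
    have hD0 : 0 ≤ D := integral_nonneg fun x => sq_nonneg _
    -- This `t` stays on the segment and satisfies `t (D + 1) ≤ -B`, so `2tB + t²D < 0` contradicts
    -- minimality; the `+ 1` covers `D = 0`.
    set t := min 1 (-B / (D + 1)) with ht
    have ht0 : 0 < t := lt_min one_pos (div_pos (by linarith) (by linarith))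
    have ht1 : t ≤ 1 := min_le_left _ _
    have htB : t * (D + 1) ≤ -B := by
      rw [← le_div_iff₀ (by linarith)]; exact min_le_right _ _
    have hmem : α + t • (β - α) ∈ Metric.closedBall α₀ R :=
      (convex_closedBall α₀ R).add_smul_sub_mem hα hβ ⟨ht0.le, ht1⟩
    have := h _ hmem
    rw [quad] at this
    nlinarith [mul_pos ht0 ht0]
  · intro h β hβ
    have e := quad β 1
    rw [one_smul, add_sub_cancel] at e
    have hD0 : 0 ≤ ∫ x, linNet b α₀ (β - α) (φ x) ^ 2 ∂ρ := integral_nonneg fun x => sq_nonneg _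
    rw [e]
    linarith [h β hβ]

end Stationary

/-! ### Stationary points as fixed points of the projected Bellman operator. -/

section Bellman

variable {S A : Type*} [MeasurableSpace S] [MeasurableSpace A] {m d : ℕ} {φ : S × A → Vec d}
  {b : Fin m → ℝ} {α₀ : Params m d} {v : S × A → ℝ} {μ : ℝ} {ρ : Measure (S × A)}
  {P : Kernel (S × A) S} {π : Kernel S A}

theorem measurePreserving_fst_transitionLaw [IsProbabilityMeasure ρ] [IsMarkovKernel P]
    [IsMarkovKernel π] : MeasurePreserving Prod.fst (transitionLaw P π ρ) ρ :=
  ⟨measurable_fst, Measure.fst_compProd ρ (nextPair P π)⟩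

theorem measurePreserving_snd_transitionLaw [IsProbabilityMeasure ρ] [IsMarkovKernel P]
    [IsMarkovKernel π] (hinv : (nextPair P π).Invariant ρ) :
    MeasurePreserving Prod.snd (transitionLaw P π ρ) ρ :=
  ⟨measurable_snd, (Measure.snd_compProd ρ (nextPair P π)).trans hinv.def⟩

theorem memLp_bellman (hφ : Measurable φ) (hφ1 : ∀ x, ‖φ x‖ ≤ 1) (hb : ∀ i, b i ^ 2 = 1)
    [IsProbabilityMeasure ρ] [IsMarkovKernel P] [IsMarkovKernel π] (hv : MemLp v 2 ρ)
    (α : Params m d) :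
    MemLp (bellman P π v μ fun x => linNet b α₀ α (φ x)) 2 ρ := by
  refine hv.add (MemLp.const_mul ?_ μ)
  refine MemLp.of_bound ?_ ‖α‖ (ae_of_all _ fun x => ?_)
  · exact (StronglyMeasurable.integral_kernel (κ := nextPair P π)
      (measurable_linNet_comp hφ b α₀ α).stronglyMeasurable).aestronglyMeasurable
  · have := norm_integral_le_of_norm_le_const (μ := nextPair P π x)
      (f := fun y => linNet b α₀ α (φ y)) (C := ‖α‖)
      (ae_of_all _ fun y => abs_linNet_le hb α₀ α (hφ1 y))
    simpa using this

/-- Given `x`, the residual has conditional mean `u⁰_α(x) - (𝒯u⁰_α)(x)`, and the test function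
`u⁰_{β-α}` depends on `x` only. The variational inequality and the first-order condition for the
projection are thus the same integrals. -/
theorem isL2Proj_bellman_iff (hφ : Measurable φ) (hφ1 : ∀ x, ‖φ x‖ ≤ 1) (hb : ∀ i, b i ^ 2 = 1)
    [IsProbabilityMeasure ρ] [IsMarkovKernel P] [IsMarkovKernel π]
    (hinv : (nextPair P π).Invariant ρ) (hv : MemLp v 2 ρ) {R η : ℝ} (hR : 0 ≤ R) (hη : 0 < η)
    {α : Params m d} (hα : α ∈ Metric.closedBall α₀ R) :
    IsStationaryPoint φ b α₀ v μ R η (transitionLaw P π ρ) α ↔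
      IsL2Proj ρ (linClass φ b α₀ R) (bellman P π v μ fun x => linNet b α₀ α (φ x))
        (fun x => linNet b α₀ α (φ x)) := by
  have h1 := measurePreserving_fst_transitionLaw (P := P) (π := π) (ρ := ρ)
  have h2 := measurePreserving_snd_transitionLaw hinv
  rw [isStationaryPoint_iff hR hη hα,
    isL2Proj_linClass_iff hφ hφ1 hb (memLp_bellman hφ hφ1 hb hv α) hα]
  refine forall₂_congr fun β _ => ?_
  rw [inner_linMeanUpdate hφ hφ1 hb hv h1 h2]
  have hi : Integrable (fun z : (S × A) × (S × A) =>
      residual (fun x => linNet b α₀ α (φ x)) v μ z * linNet b α₀ (β - α) (φ z.1))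
      (transitionLaw P π ρ) :=
    (memLp_residual (memLp_linNet hφ hφ1 hb α₀ α 2) hv h1 h2).integrable_mul
      ((memLp_linNet (ρ := ρ) hφ hφ1 hb α₀ (β - α) 2).comp_measurePreserving h1)
  rw [Measure.integral_compProd hi]
  have e : ∀ x, ∫ y, residual (fun x => linNet b α₀ α (φ x)) v μ (x, y) *
      linNet b α₀ (β - α) (φ x) ∂(nextPair P π x) =
      (linNet b α₀ α (φ x) - bellman P π v μ (fun x => linNet b α₀ α (φ x)) x) *
        linNet b α₀ (β - α) (φ x) := by
    intro x
    have iy : Integrable (fun y => linNet b α₀ α (φ y)) (nextPair P π x) :=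
      (memLp_linNet hφ hφ1 hb α₀ α 1).integrable le_rfl
    rw [integral_mul_const]
    congr 1
    simp only [residual, bellman]
    rw [integral_sub (integrable_const _) (iy.const_mul μ), integral_const_mul]
    simp; ring
  simp only [e]

end Bellman

/-! ### Projected stochastic approximation with i.i.d. samples. -/

section ProjectedSGD

/-- Under an i.i.d. stream, a functional of the first `t` samples is independent of sample `t`. -/
theorem lintegral_infinitePi_adapted {E Y : Type*} [MeasurableSpace E] [MeasurableSpace Y]
    (J : Measure Y) [IsProbabilityMeasure J] {t : ℕ} {a : (ℕ → Y) → E} (ha : Measurable a)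
    (hdep : ∀ z z' : ℕ → Y, (∀ s < t, z s = z' s) → a z = a z') {H : E × Y → ℝ≥0∞}
    (hH : Measurable H) :
    ∫⁻ z, H (a z, z t) ∂(Measure.infinitePi fun _ : ℕ => J) =
      ∫⁻ z, ∫⁻ y, H (a z, y) ∂J ∂(Measure.infinitePi fun _ : ℕ => J) := by
  set Q := Measure.infinitePi fun _ : ℕ => J
  obtain ⟨y₀⟩ : Nonempty Y := J.nonempty_of_neZero
  have hind : iIndepFun (fun (i : ℕ) (z : ℕ → Y) => z i) Q :=
    iIndepFun_infinitePi (P := fun _ : ℕ => J) (X := fun _ y => y) fun _ => measurable_id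
  have h2 := hind.indepFun_finset (Finset.range t) {t} (by simp) fun i => measurable_pi_apply i
  -- Padding with an arbitrary `y₀` writes `a` as a measurable function of the first `t` samples; by
  -- `hdep` the padding has no effect.
  let ext : (Finset.range t → Y) → ℕ → Y := fun w n =>
    if h : n ∈ Finset.range t then w ⟨n, h⟩ else y₀
  have hext : Measurable ext := by
    refine measurable_pi_lambda _ fun n => ?_
    by_cases h : n ∈ Finset.range t
    · simp only [ext, h, dite_true]; exact measurable_pi_apply _
    · simp only [ext, h, dite_false]; exact measurable_const
  have h3 := h2.comp (ha.comp hext) (measurable_pi_apply (⟨t, by simp⟩ : ({t} : Finset ℕ)))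
  have h4 : IndepFun a (fun z : ℕ → Y => z t) Q := by
    have e : a = (a ∘ ext) ∘ fun (z : ℕ → Y) (i : Finset.range t) => z i := by
      funext z
      refine hdep _ _ fun s hs => ?_
      simp [ext, hs]
    rw [e]
    exact h3
  have ht : Measurable fun z : ℕ → Y => z t := measurable_pi_apply t
  rw [indepFun_iff_map_prod_eq_prod_map_map ha.aemeasurable ht.aemeasurable] at h4
  have h5 : Measure.map (fun z : ℕ → Y => z t) Q = J :=
    Measure.infinitePi_map_eval (fun _ : ℕ => J) t
  calc ∫⁻ z, H (a z, z t) ∂Q = ∫⁻ p, H p ∂(Measure.map (fun z => (a z, z t)) Q) :=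
        (lintegral_map hH (ha.prodMk ht)).symm
    _ = ∫⁻ z, ∫⁻ y, H (a z, y) ∂J ∂Q := by
        rw [h4, h5, lintegral_prod _ hH.aemeasurable, lintegral_map hH.lintegral_prod_right' ha]

variable {E : Type*} [NormedAddCommGroup E] [InnerProductSpace ℝ E] [MeasurableSpace E]
  [BorelSpace E] [SecondCountableTopology E] {Y : Type*} [MeasurableSpace Y]

theorem measurable_projBall (c : E) (R : ℝ) : Measurable (projBall c R) := by
  unfold projBall
  have h : Measurable fun y : E => ‖y - c‖ := by fun_prop
  refine Measurable.ite (measurableSet_le h measurable_const) measurable_id ?_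
  exact measurable_const.add ((measurable_const.div h).smul (by fun_prop))

variable {J : Measure Y} [IsProbabilityMeasure J] {c αs : E} {R η κ ε G : ℝ} {g : E → Y → E}
  {F : E → ℝ}

/-- Projecting does not increase the distance to `αs`, which lies in the ball. Expanding the square,
the cross term yields the drift and the quadratic term `η² G`. The gain is kept on the left to avoid
truncated subtraction. -/
theorem lintegral_projBall_step (hR : 0 ≤ R) (hη : 0 < η) (hκ : 0 ≤ κ)
    (hs : αs ∈ Metric.closedBall c R) (hg : Measurable (Function.uncurry g)) {α : E}
    (hF0 : 0 ≤ F α)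
    (hgi : Integrable (fun y => ‖g α y‖ ^ 2) J) (hg2 : ∫ y, ‖g α y‖ ^ 2 ∂J ≤ G)
    (hdrift : κ * F α ≤ ∫ y, inner ℝ (α - αs) (g α y) ∂J + ε) :
    ∫⁻ y, ENNReal.ofReal (‖projBall c R (α - η • g α y) - αs‖ ^ 2) ∂J +
        ENNReal.ofReal (2 * η * κ * F α) ≤
      ENNReal.ofReal (‖α - αs‖ ^ 2 + (2 * η * ε + η ^ 2 * G)) := by
  have hgα : Measurable (g α) := hg.of_uncurry_left
  have hin : Integrable (fun y => (inner ℝ (α - αs) (g α y) : ℝ)) J := by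
    refine ((integrable_const (‖α - αs‖ ^ 2)).add hgi).mono
      (measurable_const.inner hgα).aestronglyMeasurable (ae_of_all _ fun y => ?_)
    have h1 := abs_real_inner_le_norm (α - αs) (g α y)
    simp only [Pi.add_apply, Real.norm_eq_abs]
    rw [abs_of_nonneg (a := ‖α - αs‖ ^ 2 + ‖g α y‖ ^ 2) (by positivity)]
    nlinarith [sq_nonneg (‖α - αs‖ - ‖g α y‖), sq_nonneg (‖α - αs‖ + ‖g α y‖)]
  have hexp : ∀ y, ‖α - η • g α y - αs‖ ^ 2 =
      ‖α - αs‖ ^ 2 - 2 * η * inner ℝ (α - αs) (g α y) + η ^ 2 * ‖g α y‖ ^ 2 := by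
    intro y
    rw [sub_right_comm, norm_sub_sq_real, real_inner_smul_right, norm_smul, mul_pow,
      Real.norm_eq_abs, sq_abs]
    ring
  have hI1 : Integrable (fun y => ‖α - αs‖ ^ 2 - 2 * η * inner ℝ (α - αs) (g α y)) J :=
    (integrable_const _).sub (hin.const_mul _)
  have hI : Integrable (fun y => ‖α - η • g α y - αs‖ ^ 2) J := by
    simp only [hexp]; exact hI1.add (hgi.const_mul _)
  have hle : ∫⁻ y, ENNReal.ofReal (‖projBall c R (α - η • g α y) - αs‖ ^ 2) ∂J ≤
      ENNReal.ofReal (∫ y, ‖α - η • g α y - αs‖ ^ 2 ∂J) := by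
    rw [ofReal_integral_eq_lintegral_ofReal hI (ae_of_all _ fun y => sq_nonneg _)]
    refine lintegral_mono fun y => ENNReal.ofReal_le_ofReal ?_
    have := norm_projBall_sub_le c hR (α - η • g α y) hs
    gcongr
  refine (add_le_add_left hle _).trans ?_
  rw [← ENNReal.ofReal_add (integral_nonneg fun y => sq_nonneg _) (by positivity)]
  refine ENNReal.ofReal_le_ofReal ?_
  simp only [hexp]
  rw [integral_add hI1 (hgi.const_mul _), integral_sub (integrable_const _) (hin.const_mul _),
    integral_const_mul, integral_const_mul]
  simp only [integral_const, probReal_univ, one_smul]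
  have a1 := mul_le_mul_of_nonneg_left hdrift hη.le
  have a2 := mul_le_mul_of_nonneg_left hg2 (sq_nonneg η)
  nlinarith

/-- Projected stochastic approximation with drift `⟨α - αs, E g⟩ ≥ κ F - ε`. -/
theorem sum_lintegral_projected_sgd_le (hR : 0 ≤ R) (hη : 0 < η) (hκ : 0 ≤ κ) (hε : 0 ≤ ε)
    (hG : 0 ≤ G) (hs : αs ∈ Metric.closedBall c R) (hg : Measurable (Function.uncurry g))
    (hF : Measurable F) (hF0 : ∀ α, 0 ≤ F α)
    (hgi : ∀ α ∈ Metric.closedBall c R, Integrable (fun y => ‖g α y‖ ^ 2) J)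
    (hg2 : ∀ α ∈ Metric.closedBall c R, ∫ y, ‖g α y‖ ^ 2 ∂J ≤ G)
    (hdrift : ∀ α ∈ Metric.closedBall c R,
      κ * F α ≤ ∫ y, inner ℝ (α - αs) (g α y) ∂J + ε)
    {a : (ℕ → Y) → ℕ → E} (ha0 : ∀ z, a z 0 = c)
    (ha : ∀ z t, a z (t + 1) = projBall c R (a z t - η • g (a z t) (z t))) (T : ℕ) :
    (∀ t, Measurable fun z => a z t) ∧ (∀ z t, a z t ∈ Metric.closedBall c R) ∧
    ∑ t ∈ Finset.range T,
        ∫⁻ z, ENNReal.ofReal (2 * η * κ * F (a z t)) ∂(Measure.infinitePi fun _ : ℕ => J) ≤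
      ENNReal.ofReal (R ^ 2 + T * (2 * η * ε + η ^ 2 * G)) := by
  set Q := Measure.infinitePi fun _ : ℕ => J
  have hstep : Measurable fun p : E × Y => projBall c R (p.1 - η • g p.1 p.2) :=
    (measurable_projBall c R).comp (measurable_fst.sub (hg.const_smul η))
  have hmeas : ∀ t, Measurable fun z => a z t := by
    intro t
    induction t with
    | zero => simp only [ha0]; exact measurable_const
    | succ t ih =>
      simp only [ha]
      exact hstep.comp (ih.prodMk (measurable_pi_apply t))
  have hdep : ∀ t, ∀ z z' : ℕ → Y, (∀ s < t, z s = z' s) → a z t = a z' t := by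
    intro t
    induction t with
    | zero => intro z z' _; rw [ha0, ha0]
    | succ t ih =>
      intro z z' h
      rw [ha, ha, ih z z' fun s hs => h s (by omega), h t (by omega)]
  have hmem : ∀ z t, a z t ∈ Metric.closedBall c R := by
    intro z t
    cases t with
    | zero => rw [ha0]; exact Metric.mem_closedBall_self hR
    | succ t => rw [ha]; exact projBall_mem c hR _
  refine ⟨hmeas, hmem, ?_⟩
  have hK : 0 ≤ 2 * η * ε + η ^ 2 * G := by positivity
  -- The induction must carry the current potential, which is discarded only at the end.
  suffices h : ∫⁻ z, ENNReal.ofReal (‖a z T - αs‖ ^ 2) ∂Q + ∑ t ∈ Finset.range T,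
      ∫⁻ z, ENNReal.ofReal (2 * η * κ * F (a z t)) ∂Q ≤
      ENNReal.ofReal (R ^ 2 + T * (2 * η * ε + η ^ 2 * G)) from le_add_self.trans h
  induction T with
  | zero =>
    have : ‖c - αs‖ ^ 2 ≤ R ^ 2 := by
      rw [← dist_eq_norm, dist_comm]
      exact pow_le_pow_left₀ dist_nonneg hs 2
    simpa [ha0] using ENNReal.ofReal_le_ofReal this
  | succ T ih =>
    have hH : Measurable fun p : E × Y =>
        ENNReal.ofReal (‖projBall c R (p.1 - η • g p.1 p.2) - αs‖ ^ 2) :=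
      ((hstep.sub_const αs).norm.pow_const 2).ennreal_ofReal
    have hstepz : ∫⁻ z, ENNReal.ofReal (‖a z (T + 1) - αs‖ ^ 2) ∂Q +
        ∫⁻ z, ENNReal.ofReal (2 * η * κ * F (a z T)) ∂Q ≤
        ∫⁻ z, ENNReal.ofReal (‖a z T - αs‖ ^ 2) ∂Q +
          ENNReal.ofReal (2 * η * ε + η ^ 2 * G) := by
      simp only [ha]
      have e := lintegral_infinitePi_adapted J (hmeas T) (hdep T) hH
      simp only at e
      have hFT : Measurable fun z => ENNReal.ofReal (2 * η * κ * F (a z T)) :=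
        ((hF.comp (hmeas T)).const_mul _).ennreal_ofReal
      rw [e, ← lintegral_add_right _ hFT]
      have e2 : ∫⁻ z, ENNReal.ofReal (‖a z T - αs‖ ^ 2) ∂Q +
          ENNReal.ofReal (2 * η * ε + η ^ 2 * G) =
          ∫⁻ z, ENNReal.ofReal (‖a z T - αs‖ ^ 2 + (2 * η * ε + η ^ 2 * G)) ∂Q := by
        simp only [ENNReal.ofReal_add (sq_nonneg _) hK]
        rw [lintegral_add_right _ measurable_const]
        simp
      rw [e2]
      exact lintegral_mono fun z => lintegral_projBall_step hR hη hκ hs hg (hF0 _)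
        (hgi _ (hmem z T)) (hg2 _ (hmem z T)) (hdrift _ (hmem z T))
    rw [Finset.sum_range_succ, add_comm (∑ t ∈ Finset.range T, _), ← add_assoc]
    refine (add_le_add_left hstepz _).trans ?_
    rw [add_right_comm]
    refine (add_le_add_left ih _).trans ?_
    rw [← ENNReal.ofReal_add (by positivity) hK]
    refine ENNReal.ofReal_le_ofReal (le_of_eq ?_)
    push_cast; ring

end ProjectedSGD

/-! ### The error of the algorithm for a fixed initialization. -/

section Run

variable {X : Type*} [MeasurableSpace X] {m d : ℕ} {φ : X → Vec d} {b : Fin m → ℝ}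
  {α₀ : Params m d} {v : X → ℝ} {μ : ℝ} {ρ : Measure X} {J : Measure (X × X)} {R : ℝ}

/-- Stated for any `f` within `R` of the initial network, so that one constant serves both the true
residuals in the update and the linearized ones in the drift error. -/
theorem integral_residual_sq_le (hφ : Measurable φ) (hφ1 : ∀ x, ‖φ x‖ ≤ 1)
    (hb : ∀ i, b i ^ 2 = 1) [IsProbabilityMeasure ρ] (hv : MemLp v 2 ρ)
    (h1 : MeasurePreserving Prod.fst J ρ) (h2 : MeasurePreserving Prod.snd J ρ) (hμ0 : 0 ≤ μ)
    (hμ1 : μ < 1) {f : X → ℝ} (hf : MemLp f 2 ρ)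
    (hfR : ∀ x, |f x - net b α₀ (φ x)| ≤ R) :
    ∫ z, residual f v μ z ^ 2 ∂J ≤
      12 * ∫ x, net b α₀ (φ x) ^ 2 ∂ρ + 12 * R ^ 2 + 3 * ∫ x, v x ^ 2 ∂ρ := by
  have i1 : Integrable (fun z : X × X => f z.1 ^ 2) J :=
    (hf.comp_measurePreserving h1).integrable_sq
  have i2 : Integrable (fun z : X × X => f z.2 ^ 2) J :=
    (hf.comp_measurePreserving h2).integrable_sq
  have i3 : Integrable (fun z : X × X => v z.1 ^ 2) J :=
    (hv.comp_measurePreserving h1).integrable_sq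
  have hn : Integrable (fun x => net b α₀ (φ x) ^ 2) ρ := (memLp_net hφ hφ1 hb α₀ 2).integrable_sq
  have hf2 : ∫ x, f x ^ 2 ∂ρ ≤ 2 * ∫ x, net b α₀ (φ x) ^ 2 ∂ρ + 2 * R ^ 2 := by
    calc ∫ x, f x ^ 2 ∂ρ ≤ ∫ x, (2 * net b α₀ (φ x) ^ 2 + 2 * R ^ 2) ∂ρ := by
          refine integral_mono hf.integrable_sq ((hn.const_mul 2).add (integrable_const _))
            fun x => ?_
          have h := hfR x
          have h' : (f x - net b α₀ (φ x)) ^ 2 ≤ R ^ 2 := by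
            rw [← sq_abs]; exact pow_le_pow_left₀ (abs_nonneg _) h 2
          simp only
          nlinarith [sq_nonneg (f x - 2 * net b α₀ (φ x))]
      _ = _ := by
          rw [integral_add (hn.const_mul 2) (integrable_const _), integral_const_mul]
          simp
  have i13 : Integrable (fun z : X × X => f z.1 ^ 2 + v z.1 ^ 2) J := i1.add i3
  calc ∫ z, residual f v μ z ^ 2 ∂J
      ≤ ∫ z : X × X, 3 * (f z.1 ^ 2 + v z.1 ^ 2 + f z.2 ^ 2) ∂J := by
        refine integral_mono (memLp_residual hf hv h1 h2).integrable_sq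
          ((i13.add i2).const_mul 3) fun z => ?_
        have hμ2 : (μ * f z.2) ^ 2 ≤ f z.2 ^ 2 := by
          rw [mul_pow]; exact mul_le_of_le_one_left (sq_nonneg _) (by nlinarith)
        simp only [residual]
        nlinarith [sq_nonneg (f z.1 + v z.1), sq_nonneg (f z.1 + μ * f z.2),
          sq_nonneg (v z.1 - μ * f z.2)]
    _ = 3 * (∫ x, f x ^ 2 ∂ρ + ∫ x, v x ^ 2 ∂ρ + ∫ x, f x ^ 2 ∂ρ) := by
        rw [integral_const_mul, integral_add i13 i2, integral_add i1 i3, integral_sq_fst h1 hf,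
          integral_sq_fst h1 hv, integral_sq_snd h2 hf]
    _ ≤ _ := by linarith

theorem measurable_update (hφ : Measurable φ) (hv : Measurable v) :
    Measurable (Function.uncurry (update (m := m) φ b v μ)) := by
  have m1 : Measurable fun p : Params m d × (X × X) => p.2.1 := measurable_fst.comp measurable_snd
  have m2 : Measurable fun p : Params m d × (X × X) => p.2.2 := measurable_snd.comp measurable_snd
  have hn1 : Measurable fun p : Params m d × (X × X) => net b p.1 (φ p.2.1) :=
    measurable_net_of_measurable b measurable_fst (hφ.comp m1)
  have hn2 : Measurable fun p : Params m d × (X × X) => net b p.1 (φ p.2.2) :=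
    measurable_net_of_measurable b measurable_fst (hφ.comp m2)
  have hg : Measurable fun p : Params m d × (X × X) => netGrad b p.1 (φ p.2.1) :=
    measurable_netGrad_of_measurable b measurable_fst (hφ.comp m1)
  have hr : Measurable fun p : Params m d × (X × X) =>
      net b p.1 (φ p.2.1) - v p.2.1 - μ * net b p.1 (φ p.2.2) :=
    (hn1.sub (hv.comp m1)).sub (hn2.const_mul μ)
  exact hr.smul hg

omit [MeasurableSpace X] in
theorem norm_update_sq_le (hφ1 : ∀ x, ‖φ x‖ ≤ 1) (hb : ∀ i, b i ^ 2 = 1) (α : Params m d)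
    (z : X × X) :
    ‖update φ b v μ α z‖ ^ 2 ≤ residual (fun x => net b α (φ x)) v μ z ^ 2 := by
  rw [update, norm_smul, mul_pow, Real.norm_eq_abs, sq_abs]
  exact mul_le_of_le_one_right (sq_nonneg _)
    (pow_le_one₀ (norm_nonneg _) (norm_netGrad_le_one hb α (hφ1 z.1)))

theorem integrable_norm_update_sq (hφ : Measurable φ) (hφ1 : ∀ x, ‖φ x‖ ≤ 1)
    (hb : ∀ i, b i ^ 2 = 1) [IsProbabilityMeasure ρ] (hvm : Measurable v) (hv : MemLp v 2 ρ)
    (h1 : MeasurePreserving Prod.fst J ρ) (h2 : MeasurePreserving Prod.snd J ρ)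
    (α : Params m d) : Integrable (fun z => ‖update φ b v μ α z‖ ^ 2) J := by
  have hm : Measurable (update φ b v μ α) := (measurable_update hφ hvm).of_uncurry_left
  refine (memLp_residual (μ := μ) (memLp_net hφ hφ1 hb α 2) hv h1 h2).integrable_sq.mono
    (hm.norm.pow_const 2).aestronglyMeasurable (ae_of_all _ fun z => ?_)
  rw [Real.norm_of_nonneg (sq_nonneg _), Real.norm_of_nonneg (sq_nonneg _)]
  exact norm_update_sq_le hφ1 hb α z

theorem integrable_mismatchFrac (hφ : Measurable φ) [IsFiniteMeasure ρ] (α₀ α : Params m d) :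
    Integrable (fun x => mismatchFrac α₀ α (φ x)) ρ :=
  Integrable.of_bound ((measurable_mismatchFrac α₀ α).comp hφ).aestronglyMeasurable 1
    (ae_of_all _ fun x => by
      rw [Real.norm_of_nonneg (mismatchFrac_nonneg _ _ _)]; exact mismatchFrac_le_one _ _ _)

omit [MeasurableSpace X] in
/-- Pointwise comparison of the semigradient with its linearization; `l`, `τ` are the weights of
Young's inequality. -/
theorem inner_update_ge (hφ1 : ∀ x, ‖φ x‖ ≤ 1) (hb : ∀ i, b i ^ 2 = 1) (hμ0 : 0 ≤ μ)
    (hμ1 : μ < 1) {l τ : ℝ} (hl : 0 < l) (hτ : 0 < τ) (hR : 0 ≤ R) {α Δ : Params m d}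
    (hα : ‖α - α₀‖ ≤ R) (hΔ : ‖Δ‖ ≤ 2 * R) (z : X × X) :
    residual (fun x => linNet b α₀ α (φ x)) v μ z * linNet b α₀ Δ (φ z.1) -
      2 * R * (l + R ^ 2 / (2 * l) * (mismatchFrac α₀ α (φ z.1) + mismatchFrac α₀ α (φ z.2)) +
        (τ / 2 * residual (fun x => linNet b α₀ α (φ x)) v μ z ^ 2 +
          1 / (2 * τ) * mismatchFrac α₀ α (φ z.1))) ≤
      inner ℝ Δ (update φ b v μ α z) := by
  set δ := residual (fun x => net b α (φ x)) v μ z with hδ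
  set δ₀ := residual (fun x => linNet b α₀ α (φ x)) v μ z with hδ₀
  set e : X → ℝ := fun x => net b α (φ x) - linNet b α₀ α (φ x) with he
  have hR2 : ‖α - α₀‖ ^ 2 ≤ R ^ 2 := pow_le_pow_left₀ (norm_nonneg _) hα 2
  have he2 : ∀ x, e x ^ 2 ≤ R ^ 2 * mismatchFrac α₀ α (φ x) := fun x =>
    (sq_net_sub_linNet_le hb α₀ α (hφ1 x)).trans
      (mul_le_mul_of_nonneg_right hR2 (mismatchFrac_nonneg _ _ _))
  have young : ∀ {s : ℝ}, 0 < s → ∀ t : ℝ, |t| ≤ s / 2 + 1 / (2 * s) * t ^ 2 := by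
    intro s hs t
    have : s / 2 + 1 / (2 * s) * t ^ 2 - |t| = 1 / (2 * s) * (s - |t|) ^ 2 := by
      rw [← sq_abs t]; field_simp; ring
    have h : 0 ≤ 1 / (2 * s) * (s - |t|) ^ 2 := by positivity
    linarith
  have hδe : |δ - δ₀| ≤
      l + R ^ 2 / (2 * l) * (mismatchFrac α₀ α (φ z.1) + mismatchFrac α₀ α (φ z.2)) := by
    have e1 : δ - δ₀ = e z.1 - μ * e z.2 := by simp only [hδ, hδ₀, he, residual]; ring
    have h3 : |δ - δ₀| ≤ |e z.1| + |e z.2| := by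
      rw [e1]
      refine (abs_sub _ _).trans (add_le_add_right ?_ _)
      rw [abs_mul, abs_of_nonneg hμ0]
      exact mul_le_of_le_one_left (abs_nonneg _) hμ1.le
    have h4 : ∀ x, |e x| ≤ l / 2 + 1 / (2 * l) * (R ^ 2 * mismatchFrac α₀ α (φ x)) := fun x =>
      (young hl _).trans (by have := he2 x; gcongr)
    calc |δ - δ₀| ≤ _ := h3.trans (add_le_add (h4 z.1) (h4 z.2))
      _ = _ := by ring
  set h := ‖netGrad b α (φ z.1) - netGrad b α₀ (φ z.1)‖ with hh
  have hh2 : h ^ 2 ≤ mismatchFrac α₀ α (φ z.1) := norm_netGrad_sub_sq_le hb α₀ α (hφ1 z.1)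
  have hδh : |δ₀| * h ≤ τ / 2 * δ₀ ^ 2 + 1 / (2 * τ) * mismatchFrac α₀ α (φ z.1) := by
    have h5 : τ / 2 * δ₀ ^ 2 + 1 / (2 * τ) * h ^ 2 - |δ₀| * h = 1 / (2 * τ) * (τ * |δ₀| - h) ^ 2 := by
      rw [← sq_abs δ₀]; field_simp; ring
    have h6 : 0 ≤ 1 / (2 * τ) * (τ * |δ₀| - h) ^ 2 := by positivity
    have h7 : 1 / (2 * τ) * h ^ 2 ≤ 1 / (2 * τ) * mismatchFrac α₀ α (φ z.1) := by gcongr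
    linarith
  have i1 : |(inner ℝ (netGrad b α (φ z.1)) Δ : ℝ)| ≤ 2 * R :=
    (abs_real_inner_le_norm _ _).trans ((mul_le_of_le_one_left (norm_nonneg _)
      (norm_netGrad_le_one hb α (hφ1 z.1))).trans hΔ)
  have i2 : |(inner ℝ (netGrad b α (φ z.1) - netGrad b α₀ (φ z.1)) Δ : ℝ)| ≤ h * (2 * R) :=
    (abs_real_inner_le_norm _ _).trans (mul_le_mul_of_nonneg_left hΔ (norm_nonneg _))
  -- The two errors are separated: the residual error meets a gradient of norm at most 1, and the
  -- gradient error meets the linearized residual, which is controlled only in mean square.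
  have split : (inner ℝ Δ (update φ b v μ α z) : ℝ) = δ₀ * linNet b α₀ Δ (φ z.1) +
      ((δ - δ₀) * inner ℝ (netGrad b α (φ z.1)) Δ +
        δ₀ * inner ℝ (netGrad b α (φ z.1) - netGrad b α₀ (φ z.1)) Δ) := by
    rw [← inner_netGrad, update, real_inner_smul_right, real_inner_comm, inner_sub_left]
    ring
  have j1 : |(δ - δ₀) * inner ℝ (netGrad b α (φ z.1)) Δ| ≤ |δ - δ₀| * (2 * R) := by
    rw [abs_mul]; gcongr
  have j2 : |δ₀ * inner ℝ (netGrad b α (φ z.1) - netGrad b α₀ (φ z.1)) Δ| ≤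
      |δ₀| * h * (2 * R) := by
    rw [abs_mul, mul_assoc]; gcongr
  have k1 := mul_le_mul_of_nonneg_right hδe (by linarith : 0 ≤ 2 * R)
  have k2 := mul_le_mul_of_nonneg_right hδh (by linarith : 0 ≤ 2 * R)
  rw [split]
  have l1 := (abs_le.1 j1).1
  have l2 := (abs_le.1 j2).1
  linarith

/-- Monotonicity bounds `⟨G α - G αs, α - αs⟩` below, and the variational inequality at `αs` lets `G
αs` be dropped. What remains is the integral of the pointwise comparison `inner_update_ge`. -/
theorem drift_update_ge (hφ : Measurable φ) (hφ1 : ∀ x, ‖φ x‖ ≤ 1) (hb : ∀ i, b i ^ 2 = 1)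
    [IsProbabilityMeasure ρ] [IsProbabilityMeasure J] (hvm : Measurable v) (hv : MemLp v 2 ρ)
    (h1 : MeasurePreserving Prod.fst J ρ) (h2 : MeasurePreserving Prod.snd J ρ) (hμ0 : 0 ≤ μ)
    (hμ1 : μ < 1) {l τ η p G : ℝ} (hl : 0 < l) (hτ : 0 < τ) (hR : 0 ≤ R) (hη : 0 < η)
    {αs : Params m d} (hs : IsStationaryPoint φ b α₀ v μ R η J αs)
    (hp : ∀ α ∈ Metric.closedBall α₀ R, ∫ x, mismatchFrac α₀ α (φ x) ∂ρ ≤ p)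
    (hG : ∀ α ∈ Metric.closedBall α₀ R,
      ∫ z, residual (fun x => linNet b α₀ α (φ x)) v μ z ^ 2 ∂J ≤ G)
    {α : Params m d} (hα : α ∈ Metric.closedBall α₀ R) :
    (1 - μ) * ∫ x, linNet b α₀ (α - αs) (φ x) ^ 2 ∂ρ ≤
      ∫ z, inner ℝ (α - αs) (update φ b v μ α z) ∂J +
        2 * R * (l + R ^ 2 / l * p + (τ / 2 * G + 1 / (2 * τ) * p)) := by
  have hαR : ‖α - α₀‖ ≤ R := by rw [← dist_eq_norm]; exact hα
  have hΔ : ‖α - αs‖ ≤ 2 * R := by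
    have h3 : dist αs α₀ ≤ R := hs.1
    have h4 : dist α α₀ ≤ R := hα
    rw [← dist_eq_norm]
    linarith [dist_triangle_right α αs α₀]
  have mres : MemLp (residual (fun x => linNet b α₀ α (φ x)) v μ) 2 J :=
    memLp_residual (memLp_linNet hφ hφ1 hb α₀ α 2) hv h1 h2
  have iq := integrable_mismatchFrac (ρ := ρ) hφ α₀ α
  have iq1 : Integrable (fun z : X × X => mismatchFrac α₀ α (φ z.1)) J :=
    h1.integrable_comp_of_integrable iq
  have iq2 : Integrable (fun z : X × X => mismatchFrac α₀ α (φ z.2)) J :=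
    h2.integrable_comp_of_integrable iq
  have eq1 : ∫ z : X × X, mismatchFrac α₀ α (φ z.1) ∂J = ∫ x, mismatchFrac α₀ α (φ x) ∂ρ := by
    rw [← h1.map_eq, integral_map h1.measurable.aemeasurable]
    rw [h1.map_eq]; exact iq.1
  have eq2 : ∫ z : X × X, mismatchFrac α₀ α (φ z.2) ∂J = ∫ x, mismatchFrac α₀ α (φ x) ∂ρ := by
    rw [← h2.map_eq, integral_map h2.measurable.aemeasurable]
    rw [h2.map_eq]; exact iq.1
  have iδ : Integrable (fun z : X × X => residual (fun x => linNet b α₀ α (φ x)) v μ z *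
      linNet b α₀ (α - αs) (φ z.1)) J :=
    mres.integrable_mul
      ((memLp_linNet (ρ := ρ) hφ hφ1 hb α₀ (α - αs) 2).comp_measurePreserving h1)
  have iA : Integrable (fun z : X × X => l + R ^ 2 / (2 * l) *
      (mismatchFrac α₀ α (φ z.1) + mismatchFrac α₀ α (φ z.2))) J :=
    (integrable_const _).add ((iq1.add iq2).const_mul _)
  have iB : Integrable (fun z : X × X => τ / 2 *
      residual (fun x => linNet b α₀ α (φ x)) v μ z ^ 2 +
        1 / (2 * τ) * mismatchFrac α₀ α (φ z.1)) J :=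
    (mres.integrable_sq.const_mul _).add (iq1.const_mul _)
  have iC := (iA.add iB).const_mul (2 * R)
  have hm : Measurable (update φ b v μ α) := (measurable_update hφ hvm).of_uncurry_left
  have iin : Integrable (fun z => (inner ℝ (α - αs) (update φ b v μ α z) : ℝ)) J := by
    refine ((integrable_const (‖α - αs‖ ^ 2)).add
      (integrable_norm_update_sq (μ := μ) hφ hφ1 hb hvm hv h1 h2 α)).mono
      (measurable_const.inner hm).aestronglyMeasurable (ae_of_all _ fun y => ?_)
    have h1 := abs_real_inner_le_norm (α - αs) (update φ b v μ α y)
    simp only [Pi.add_apply, Real.norm_eq_abs]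
    rw [abs_of_nonneg (a := ‖α - αs‖ ^ 2 + ‖update φ b v μ α y‖ ^ 2) (by positivity)]
    nlinarith [sq_nonneg (‖α - αs‖ - ‖update φ b v μ α y‖),
      sq_nonneg (‖α - αs‖ + ‖update φ b v μ α y‖)]
  have hmono := integral_mono (iδ.sub iC) iin fun z =>
    inner_update_ge (v := v) hφ1 hb hμ0 hμ1 hl hτ hR hαR hΔ z
  have eA : ∫ z : X × X, (l + R ^ 2 / (2 * l) *
      (mismatchFrac α₀ α (φ z.1) + mismatchFrac α₀ α (φ z.2))) ∂J =
      l + R ^ 2 / l * ∫ x, mismatchFrac α₀ α (φ x) ∂ρ := by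
    have iq12 : Integrable (fun z : X × X => mismatchFrac α₀ α (φ z.1) +
      mismatchFrac α₀ α (φ z.2)) J := iq1.add iq2
    rw [integral_add (integrable_const _) (iq12.const_mul _), integral_const_mul,
      integral_add iq1 iq2, eq1, eq2]
    simp only [integral_const, probReal_univ, one_smul]
    field_simp; ring
  have eB : ∫ z : X × X, (τ / 2 * residual (fun x => linNet b α₀ α (φ x)) v μ z ^ 2 +
        1 / (2 * τ) * mismatchFrac α₀ α (φ z.1)) ∂J =
      τ / 2 * ∫ z, residual (fun x => linNet b α₀ α (φ x)) v μ z ^ 2 ∂J +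
        1 / (2 * τ) * ∫ x, mismatchFrac α₀ α (φ x) ∂ρ := by
    rw [integral_add (mres.integrable_sq.const_mul _) (iq1.const_mul _), integral_const_mul,
      integral_const_mul, eq1]
  have eC : ∫ z : X × X, 2 * R * ((l + R ^ 2 / (2 * l) *
      (mismatchFrac α₀ α (φ z.1) + mismatchFrac α₀ α (φ z.2))) +
      (τ / 2 * residual (fun x => linNet b α₀ α (φ x)) v μ z ^ 2 +
        1 / (2 * τ) * mismatchFrac α₀ α (φ z.1))) ∂J ≤
      2 * R * (l + R ^ 2 / l * p + (τ / 2 * G + 1 / (2 * τ) * p)) := by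
    rw [integral_const_mul, integral_add iA iB, eA, eB]
    have := hp α hα
    have := hG α hα
    gcongr
  have esub := integral_sub iδ iC
  have hlin := inner_linMeanUpdate (α₀ := α₀) (μ := μ) hφ hφ1 hb hv h1 h2 α (α - αs)
  have hge := inner_linMeanUpdate_sub_ge (α₀ := α₀) hφ hφ1 hb hv h1 h2 hμ0 α αs
  have hvi := (isStationaryPoint_iff hR hη hs.1).1 hs α hα
  rw [inner_sub_left] at hge
  simp only [Pi.add_apply, Pi.sub_apply] at esub hmono eC
  linarith

/-- The error of the averaged iterate, conditionally on the initialization. -/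
theorem lintegral_error_le (hφ : Measurable φ) (hφ1 : ∀ x, ‖φ x‖ ≤ 1) (hb : ∀ i, b i ^ 2 = 1)
    [IsProbabilityMeasure ρ] [IsProbabilityMeasure J] (hvm : Measurable v) (hv : MemLp v 2 ρ)
    (h1 : MeasurePreserving Prod.fst J ρ) (h2 : MeasurePreserving Prod.snd J ρ) (hμ0 : 0 ≤ μ)
    (hμ1 : μ < 1) {l τ η p G : ℝ} (hl : 0 < l) (hτ : 0 < τ) (hR : 0 ≤ R) (hη : 0 < η)
    {αs : Params m d} (hs : IsStationaryPoint φ b α₀ v μ R η J αs) (hp0 : 0 ≤ p)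
    (hp : ∀ α ∈ Metric.closedBall α₀ R, ∫ x, mismatchFrac α₀ α (φ x) ∂ρ ≤ p)
    (hG : G = 12 * ∫ x, net b α₀ (φ x) ^ 2 ∂ρ + 12 * R ^ 2 + 3 * ∫ x, v x ^ 2 ∂ρ)
    {T : ℕ} (hT : 0 < T) :
    ∫⁻ z, ∫⁻ x, ENNReal.ofReal
        ((net b (averagedIterate φ b α₀ v μ R η T z) (φ x) - linNet b α₀ αs (φ x)) ^ 2)
      ∂ρ ∂(Measure.infinitePi fun _ : ℕ => J) ≤
    ENNReal.ofReal (2 * (R ^ 2 * p) + 1 / (η * (1 - μ) * T) *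
      (R ^ 2 + T * (2 * η * (2 * R * (l + R ^ 2 / l * p + (τ / 2 * G + 1 / (2 * τ) * p))) +
        η ^ 2 * G))) := by
  have hT' : (0 : ℝ) < T := by exact_mod_cast hT
  have hκ : 0 < 1 - μ := sub_pos.2 hμ1
  have hG0 : 0 ≤ G := by
    rw [hG]
    have a1 : 0 ≤ ∫ x, net b α₀ (φ x) ^ 2 ∂ρ := integral_nonneg fun x => sq_nonneg _
    have a2 : 0 ≤ ∫ x, v x ^ 2 ∂ρ := integral_nonneg fun x => sq_nonneg _
    positivity
  set ε := 2 * R * (l + R ^ 2 / l * p + (τ / 2 * G + 1 / (2 * τ) * p)) with hε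
  have hε0 : 0 ≤ ε := by positivity
  set F : Params m d → ℝ := fun α => ∫ x, linNet b α₀ (α - αs) (φ x) ^ 2 ∂ρ with hF
  have hF0 : ∀ α, 0 ≤ F α := fun α => integral_nonneg fun x => sq_nonneg _
  have hFm : Measurable F := by
    have hm : Measurable fun q : Params m d × X => linNet b α₀ (q.1 - αs) (φ q.2) ^ 2 :=
      ((measurable_linNet b α₀).comp
        ((measurable_fst.sub_const αs).prodMk (hφ.comp measurable_snd))).pow_const 2
    exact hm.stronglyMeasurable.integral_prod_right'.measurable
  have hdist : ∀ {α : Params m d}, α ∈ Metric.closedBall α₀ R → ‖α - α₀‖ ≤ R := fun h => by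
    rw [← dist_eq_norm]; exact h
  obtain ⟨hmeas, hmem, hsum⟩ := sum_lintegral_projected_sgd_le (J := J) (c := α₀) (αs := αs)
    (R := R) (η := η) (κ := 1 - μ) (ε := ε) (G := G) (g := update φ b v μ) (F := F)
    hR hη hκ.le hε0 hG0 hs.1 (measurable_update hφ hvm) hFm hF0
    (fun α _ => integrable_norm_update_sq hφ hφ1 hb hvm hv h1 h2 α)
    (fun α hα => by
      rw [hG]
      refine (integral_mono (integrable_norm_update_sq hφ hφ1 hb hvm hv h1 h2 α)
        (memLp_residual (memLp_net hφ hφ1 hb α 2) hv h1 h2).integrable_sq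
        fun z => norm_update_sq_le hφ1 hb α z).trans ?_
      exact integral_residual_sq_le hφ hφ1 hb hv h1 h2 hμ0 hμ1 (memLp_net hφ hφ1 hb α 2)
        fun x => (abs_net_sub_net_le hb α₀ α (hφ1 x)).trans (hdist hα))
    (fun α hα => drift_update_ge hφ hφ1 hb hvm hv h1 h2 hμ0 hμ1 hl hτ hR hη hs hp
      (fun β hβ => by
        rw [hG]
        exact integral_residual_sq_le hφ hφ1 hb hv h1 h2 hμ0 hμ1 (memLp_linNet hφ hφ1 hb α₀ β 2)
          fun x => (abs_linNet_sub_net_le hb α₀ β (hφ1 x)).trans (hdist hβ)) hα)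
    (a := iterate φ b α₀ v μ R η) (fun z => rfl) (fun z t => rfl) T
  have hpt : ∀ z, ∫⁻ x, ENNReal.ofReal
      ((net b (averagedIterate φ b α₀ v μ R η T z) (φ x) - linNet b α₀ αs (φ x)) ^ 2) ∂ρ ≤
      ENNReal.ofReal (2 * (R ^ 2 * p)) + ENNReal.ofReal (1 / (η * (1 - μ) * T)) *
        ∑ t ∈ Finset.range T,
          ENNReal.ofReal (2 * η * (1 - μ) * F (iterate φ b α₀ v μ R η z t)) := by
    intro z
    set αb := averagedIterate φ b α₀ v μ R η T z with hαb
    set a := iterate φ b α₀ v μ R η z with ha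
    have hsub : αb - αs = (1 / (T : ℝ)) • ∑ t ∈ Finset.range T, (a t - αs) := by
      rw [Finset.sum_sub_distrib, smul_sub, Finset.sum_const, Finset.card_range,
        ← Nat.cast_smul_eq_nsmul ℝ, smul_smul, one_div_mul_cancel hT'.ne', one_smul]
      rfl
    have hαbm : αb ∈ Metric.closedBall α₀ R := by
      have hw : ∑ _t ∈ Finset.range T, 1 / (T : ℝ) = 1 := by
        rw [Finset.sum_const, Finset.card_range, nsmul_eq_mul, mul_one_div_cancel hT'.ne']
      have := (convex_closedBall α₀ R).sum_mem (t := Finset.range T)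
        (w := fun _ => 1 / (T : ℝ)) (z := a) (fun _ _ => by positivity) hw (fun t _ => hmem z t)
      rwa [← Finset.smul_sum] at this
    -- Jensen's inequality for the average, available because the linearized network is linear in
    -- the weights; the true network is compared with it only at `αb`.
    have hlin : ∀ x, linNet b α₀ (αb - αs) (φ x) ^ 2 ≤
        1 / T * ∑ t ∈ Finset.range T, linNet b α₀ (a t - αs) (φ x) ^ 2 := by
      intro x
      rw [hsub]
      simp only [← inner_netGrad]
      rw [real_inner_smul_right, inner_sum, mul_pow]
      have := sq_sum_le_card_mul_sum_sq (s := Finset.range T)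
        (f := fun t => (inner ℝ (netGrad b α₀ (φ x)) (a t - αs) : ℝ))
      rw [Finset.card_range] at this
      calc (1 / (T : ℝ)) ^ 2 * _ ≤ (1 / (T : ℝ)) ^ 2 * _ :=
            mul_le_mul_of_nonneg_left this (sq_nonneg _)
        _ = _ := by field_simp
    have isq : ∀ t, Integrable (fun x => linNet b α₀ (a t - αs) (φ x) ^ 2) ρ := fun t =>
      (memLp_linNet hφ hφ1 hb α₀ (a t - αs) 2).integrable_sq
    have isum : Integrable (fun x => 2 / T * ∑ t ∈ Finset.range T,
        linNet b α₀ (a t - αs) (φ x) ^ 2) ρ :=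
      (integrable_finsetSum _ fun t _ => isq t).const_mul _
    have iq := (integrable_mismatchFrac (ρ := ρ) hφ α₀ αb).const_mul (2 * R ^ 2)
    have hle : ∀ x, (net b αb (φ x) - linNet b α₀ αs (φ x)) ^ 2 ≤
        2 * R ^ 2 * mismatchFrac α₀ αb (φ x) +
          2 / T * ∑ t ∈ Finset.range T, linNet b α₀ (a t - αs) (φ x) ^ 2 := by
      intro x
      have q1 := sq_net_sub_linNet_le hb α₀ αb (hφ1 x)
      have q2 : ‖αb - α₀‖ ^ 2 * mismatchFrac α₀ αb (φ x) ≤ R ^ 2 * mismatchFrac α₀ αb (φ x) :=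
        mul_le_mul_of_nonneg_right (pow_le_pow_left₀ (norm_nonneg _) (hdist hαbm) 2)
          (mismatchFrac_nonneg _ _ _)
      have q3 := hlin x
      rw [linNet_sub] at q3
      have q4 : 2 / (T : ℝ) * ∑ t ∈ Finset.range T, linNet b α₀ (a t - αs) (φ x) ^ 2 =
          2 * (1 / T * ∑ t ∈ Finset.range T, linNet b α₀ (a t - αs) (φ x) ^ 2) := by ring
      rw [q4]
      nlinarith [sq_nonneg (net b αb (φ x) - linNet b α₀ αb (φ x) -
        (linNet b α₀ αb (φ x) - linNet b α₀ αs (φ x)))]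
    -- The scaling turns the summands `2η(1 - μ)F` of the potential argument into the `2F / T`
    -- required by `(a + b)² ≤ 2a² + 2b²` and averaging.
    have hscale : ∀ t, ENNReal.ofReal (1 / (η * (1 - μ) * T)) *
        ENNReal.ofReal (2 * η * (1 - μ) * F (a t)) = ENNReal.ofReal (2 / T * F (a t)) := by
      intro t
      rw [← ENNReal.ofReal_mul (by positivity)]
      congr 1
      field_simp
    rw [Finset.mul_sum]
    simp only [hscale]
    rw [← ENNReal.ofReal_sum_of_nonneg fun t _ => mul_nonneg (by positivity) (hF0 _),
      ← Finset.mul_sum, ← ENNReal.ofReal_add (by positivity)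
        (mul_nonneg (by positivity) (Finset.sum_nonneg fun t _ => hF0 _))]
    calc ∫⁻ x, ENNReal.ofReal ((net b αb (φ x) - linNet b α₀ αs (φ x)) ^ 2) ∂ρ
        ≤ ∫⁻ x, ENNReal.ofReal (2 * R ^ 2 * mismatchFrac α₀ αb (φ x) +
          2 / T * ∑ t ∈ Finset.range T, linNet b α₀ (a t - αs) (φ x) ^ 2) ∂ρ :=
          lintegral_mono fun x => ENNReal.ofReal_le_ofReal (hle x)
      _ = ENNReal.ofReal (∫ x, (2 * R ^ 2 * mismatchFrac α₀ αb (φ x) +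
          2 / T * ∑ t ∈ Finset.range T, linNet b α₀ (a t - αs) (φ x) ^ 2) ∂ρ) :=
          (ofReal_integral_eq_lintegral_ofReal (iq.add isum)
            (ae_of_all _ fun x => (sq_nonneg _).trans (hle x))).symm
      _ ≤ _ := by
          refine ENNReal.ofReal_le_ofReal ?_
          rw [integral_add iq isum, integral_const_mul, integral_const_mul,
            integral_finsetSum _ fun t _ => isq t]
          have := mul_le_mul_of_nonneg_left (hp αb hαbm) (by positivity : 0 ≤ 2 * R ^ 2)
          linarith
  refine (lintegral_mono hpt).trans ?_
  have hmF : ∀ t, Measurable fun z =>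
      ENNReal.ofReal (2 * η * (1 - μ) * F (iterate φ b α₀ v μ R η z t)) := fun t =>
    ((hFm.comp (hmeas t)).const_mul _).ennreal_ofReal
  rw [lintegral_add_left measurable_const, lintegral_const_mul _
    (Finset.measurable_fun_sum _ fun t _ => hmF t), lintegral_finsetSum _ fun t _ => hmF t]
  rw [ENNReal.ofReal_add (by positivity) (by positivity),
    ENNReal.ofReal_mul (p := 1 / (η * (1 - μ) * T)) (by positivity)]
  simp only [lintegral_const, measure_univ, mul_one]
  gcongr

end Run

/-! ### Second and inverse second moments of the Gaussian blocks. -/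

section Gaussian

theorem integral_exp_neg_mul_sq_gaussianReal {v : NNReal} (hv : v ≠ 0) {s : ℝ} (hs : 0 ≤ s) :
    ∫ x, Real.exp (-(s * x ^ 2)) ∂(gaussianReal 0 v) = (√(1 + 2 * v * s))⁻¹ := by
  have hv' : (0 : ℝ) < v := by positivity
  rw [integral_gaussianReal_eq_integral_smul hv]
  have e : ∀ x : ℝ, gaussianPDFReal 0 v x • Real.exp (-(s * x ^ 2)) =
      (√(2 * Real.pi * v))⁻¹ * Real.exp (-(1 / (2 * v) + s) * x ^ 2) := by
    intro x
    rw [gaussianPDFReal, smul_eq_mul, mul_assoc, ← Real.exp_add]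
    congr 2
    field_simp; ring
  simp only [e]
  rw [integral_const_mul, integral_gaussian, ← Real.sqrt_inv, ← Real.sqrt_inv,
    ← Real.sqrt_mul (by positivity)]
  congr 1
  have := Real.pi_pos
  field_simp

theorem integral_exp_neg_mul_sum_sq {m d : ℕ} (hd : 0 < d) (i : Fin m) {s : ℝ} (hs : 0 ≤ s) :
    ∫ a : Fin m × Fin d → ℝ, Real.exp (-(s * ∑ j, a (i, j) ^ 2))
      ∂(Measure.pi fun _ => gaussianReal 0 (1 / (d : NNReal))) =
      (√(1 + 2 / d * s))⁻¹ ^ d := by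
  have hv : (1 / (d : NNReal)) ≠ 0 := by
    have : (d : NNReal) ≠ 0 := by exact_mod_cast hd.ne'
    exact one_div_ne_zero this
  -- Factors equal to 1 outside block `i` extend the product to all coordinates, where independence
  -- applies.
  let f : Fin m × Fin d → ℝ → ℝ := fun p x => if p.1 = i then Real.exp (-(s * x ^ 2)) else 1
  have e : ∀ a : Fin m × Fin d → ℝ, Real.exp (-(s * ∑ j, a (i, j) ^ 2)) = ∏ p, f p (a p) := by
    intro a
    simp only [f]
    rw [Fintype.prod_prod_type, Finset.prod_eq_single i]
    · simp only [if_true]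
      rw [← Real.exp_sum, Finset.mul_sum, Finset.sum_neg_distrib]
    · intro k _ hk; simp [hk]
    · simp
  rw [integral_congr_ae (ae_of_all _ e), integral_fintype_prod_eq_prod f, Fintype.prod_prod_type,
    Finset.prod_eq_single i]
  · simp only [f, if_true]
    rw [Finset.prod_const, Finset.card_univ, Fintype.card_fin,
      integral_exp_neg_mul_sq_gaussianReal hv hs]
    push_cast
    rw [mul_one_div]
  · intro k _ hk; simp [f, hk]
  · simp

/-- Laplace representation of `1 / r`, which reduces the inverse moment to Gaussian exponential
moments. At `r = 0` both sides are infinite. -/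
theorem inv_ofReal_le_lintegral_exp (r : ℝ) (hr : 0 ≤ r) :
    (ENNReal.ofReal r)⁻¹ ≤ ∫⁻ s in Set.Ioi (0 : ℝ), ENNReal.ofReal (Real.exp (-(s * r))) := by
  rcases hr.eq_or_lt with rfl | hr
  · simp
  · have h1 := integral_exp_mul_Ioi (neg_lt_zero.2 hr) 0
    have h2 : Integrable (fun s => Real.exp (-(s * r))) (volume.restrict (Set.Ioi (0 : ℝ))) := by
      have := integrableOn_exp_mul_Ioi (neg_lt_zero.2 hr) 0
      refine this.congr (ae_of_all _ fun s => ?_)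
      simp only; congr 1; ring
    rw [← ofReal_integral_eq_lintegral_ofReal h2 (ae_of_all _ fun s => (Real.exp_pos _).le),
      ← ENNReal.ofReal_inv_of_pos hr]
    refine ENNReal.ofReal_le_ofReal (le_of_eq ?_)
    calc r⁻¹ = - Real.exp (-r * 0) / -r := by simp
      _ = _ := by
        rw [← h1]
        refine integral_congr_ae (ae_of_all _ fun s => ?_)
        simp only; congr 1; ring

theorem lintegral_rpow_le {d : ℕ} (hd : 3 ≤ d) :
    ∫⁻ s in Set.Ioi (0 : ℝ), ENNReal.ofReal ((√(1 + 2 / d * s))⁻¹ ^ d) ≤ 3 := by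
  have hd' : (3 : ℝ) ≤ d := by exact_mod_cast hd
  have hd0 : (0 : ℝ) < d := by linarith
  set q : ℝ := 1 - d / 2 with hq
  have hq0 : q < 0 := by rw [hq]; linarith
  -- An antiderivative of `(1 + 2s/d)^{-d/2}`. Because `d ≥ 3` the exponent `q` is negative, so `g`
  -- vanishes at infinity and the integral is `-g 0 = d / (d - 2)`.
  set g : ℝ → ℝ := fun s => d / (2 * q) * (1 + 2 / d * s) ^ q with hg
  have hpos : ∀ s : ℝ, 0 ≤ s → 0 < 1 + 2 / d * s := fun s hs => by positivity
  have hderiv : ∀ s ∈ Set.Ici (0 : ℝ), HasDerivAt g ((√(1 + 2 / d * s))⁻¹ ^ d) s := by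
    intro s hs
    have hp := hpos s hs
    have h1 : HasDerivAt (fun s : ℝ => 1 + 2 / d * s) (2 / d) s := by
      simpa using ((hasDerivAt_id s).const_mul (2 / (d : ℝ))).const_add 1
    have h2 := (h1.rpow_const (p := q) (Or.inl hp.ne')).const_mul (d / (2 * q))
    refine h2.congr_deriv ?_
    have h3 : q - 1 = -((1 / 2) * d) := by rw [hq]; ring
    rw [h3, Real.rpow_neg hp.le, Real.rpow_mul hp.le, Real.rpow_natCast, ← Real.sqrt_eq_rpow,
      inv_pow]
    have hq0' := hq0.ne
    field_simp
  have hnn : ∀ s ∈ Set.Ioi (0 : ℝ), 0 ≤ (√(1 + 2 / d * s))⁻¹ ^ d := fun s _ => by positivity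
  have hlim : Filter.Tendsto g Filter.atTop (nhds 0) := by
    have h1 : Filter.Tendsto (fun s : ℝ => 1 + 2 / d * s) Filter.atTop Filter.atTop :=
      Filter.tendsto_atTop_add_const_left _ _
        (Filter.tendsto_id.const_mul_atTop (by positivity))
    have h2 := ((tendsto_rpow_neg_atTop (neg_pos.2 hq0)).comp h1).const_mul (d / (2 * q))
    simpa [Function.comp_def, hg] using h2
  have hint := integrableOn_Ioi_deriv_of_nonneg' hderiv hnn hlim
  have hval := integral_Ioi_of_hasDerivAt_of_nonneg' hderiv hnn hlim
  rw [← ofReal_integral_eq_lintegral_ofReal hint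
    (by filter_upwards with s; positivity), hval]
  have : 0 - g 0 ≤ 3 := by
    have e : 0 - g 0 = d / (d - 2) := by
      have h2 : (d : ℝ) - 2 ≠ 0 := by linarith
      have h3 : 2 * q = -(d - 2) := by rw [hq]; ring
      simp only [hg, mul_zero, add_zero, Real.one_rpow, mul_one, h3]
      rw [div_neg]; ring
    rw [e, div_le_iff₀ (by linarith)]
    linarith
  calc ENNReal.ofReal (0 - g 0) ≤ ENNReal.ofReal 3 := ENNReal.ofReal_le_ofReal this
    _ = 3 := by simp

/-- `E ‖[α(0)]_i‖⁻² = d / (d - 2) ≤ 3`. -/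
theorem lintegral_inv_sum_sq_le {m d : ℕ} (hd : 3 ≤ d) (i : Fin m) :
    ∫⁻ a : Fin m × Fin d → ℝ, (ENNReal.ofReal (∑ j, a (i, j) ^ 2))⁻¹
      ∂(Measure.pi fun _ => gaussianReal 0 (1 / (d : NNReal))) ≤ 3 := by
  set γ : Measure (Fin m × Fin d → ℝ) := Measure.pi fun _ => gaussianReal 0 (1 / (d : NNReal))
  have hmeas : Measurable fun q : (Fin m × Fin d → ℝ) × ℝ =>
      ENNReal.ofReal (Real.exp (-(q.2 * ∑ j, q.1 (i, j) ^ 2))) := by fun_prop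
  calc ∫⁻ a, (ENNReal.ofReal (∑ j, a (i, j) ^ 2))⁻¹ ∂γ
      ≤ ∫⁻ a, (∫⁻ s in Set.Ioi (0 : ℝ),
          ENNReal.ofReal (Real.exp (-(s * ∑ j, a (i, j) ^ 2)))) ∂γ :=
        lintegral_mono fun a => inv_ofReal_le_lintegral_exp _
          (Finset.sum_nonneg fun j _ => sq_nonneg _)
    _ = ∫⁻ s in Set.Ioi (0 : ℝ), ∫⁻ a,
          ENNReal.ofReal (Real.exp (-(s * ∑ j, a (i, j) ^ 2))) ∂γ :=
        lintegral_lintegral_swap hmeas.aemeasurable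
    _ ≤ ∫⁻ s in Set.Ioi (0 : ℝ), ENNReal.ofReal ((√(1 + 2 / d * s))⁻¹ ^ d) := by
        refine setLIntegral_mono' measurableSet_Ioi fun s hs => ?_
        have hs' : 0 ≤ s := le_of_lt hs
        have hi : Integrable (fun a => Real.exp (-(s * ∑ j, a (i, j) ^ 2))) γ := by
          refine Integrable.of_bound (Measurable.aestronglyMeasurable (by fun_prop)) 1 (ae_of_all _ fun a => ?_)
          rw [Real.norm_of_nonneg (Real.exp_pos _).le, Real.exp_le_one_iff, neg_nonpos]
          exact mul_nonneg hs' (Finset.sum_nonneg fun j _ => sq_nonneg _)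
        rw [← ofReal_integral_eq_lintegral_ofReal hi (ae_of_all _ fun a => (Real.exp_pos _).le),
          integral_exp_neg_mul_sum_sq (by omega) i hs']
    _ ≤ 3 := lintegral_rpow_le hd

theorem lintegral_sq_gaussianReal (v : NNReal) :
    ∫⁻ x, ENNReal.ofReal (x ^ 2) ∂(gaussianReal 0 v) = v := by
  have h : MemLp (fun x : ℝ => x) 2 (gaussianReal 0 v) := memLp_id_gaussianReal 2
  rw [← ofReal_integral_eq_lintegral_ofReal h.integrable_sq (ae_of_all _ fun x => sq_nonneg _)]
  have h2 := variance_fun_id_gaussianReal (μ := 0) (v := v)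
  rw [variance_of_integral_eq_zero h.1.aemeasurable (by simp [integral_id_gaussianReal])] at h2
  rw [h2]
  simp

/-- `E ‖[α(0)]_i‖² = 1`. -/
theorem lintegral_sum_sq {m d : ℕ} (hd : 0 < d) (i : Fin m) :
    ∫⁻ a : Fin m × Fin d → ℝ, ENNReal.ofReal (∑ j, a (i, j) ^ 2)
      ∂(Measure.pi fun _ => gaussianReal 0 (1 / (d : NNReal))) = 1 := by
  have hmp := fun p : Fin m × Fin d =>
    measurePreserving_eval (fun _ : Fin m × Fin d => gaussianReal 0 (1 / (d : NNReal))) p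
  simp only [ENNReal.ofReal_sum_of_nonneg fun (j : Fin d) _ => sq_nonneg _]
  rw [lintegral_finsetSum _ fun j _ => by fun_prop]
  have e : ∀ j : Fin d, ∫⁻ a : Fin m × Fin d → ℝ, ENNReal.ofReal (a (i, j) ^ 2)
      ∂(Measure.pi fun _ => gaussianReal 0 (1 / (d : NNReal))) = ((1 / d : NNReal) : ℝ≥0∞) := by
    intro j
    rw [← lintegral_sq_gaussianReal]
    exact (hmp (i, j)).lintegral_comp (f := fun x => ENNReal.ofReal (x ^ 2)) (by fun_prop)
  simp only [e]
  rw [Finset.sum_const, Finset.card_univ, Fintype.card_fin, nsmul_eq_mul]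
  have : (d : NNReal) * (1 / d) = 1 := by
    have : (d : NNReal) ≠ 0 := by exact_mod_cast hd.ne'
    field_simp
  exact_mod_cast congrArg ((↑) : NNReal → ℝ≥0∞) this

end Gaussian

/-! ### Random signs, contraction, and moments of the initialization. -/

section Signs

/-- Weak majorization of pairs: the sum of squares of nonnegative numbers is monotone for it. -/
theorem sq_add_sq_le_of_majorized {A B C D : ℝ≥0∞} (hsum : A + B ≤ C + D) (hA : A ≤ max C D)
    (hB : B ≤ max C D) : A ^ 2 + B ^ 2 ≤ C ^ 2 + D ^ 2 := by
  by_cases hC : C = ∞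
  · simp [hC]
  by_cases hD : D = ∞
  · simp [hD]
  have hmax : max C D ≠ ∞ := by simp [hC, hD]
  lift A to NNReal using ne_top_of_le_ne_top hmax hA
  lift B to NNReal using ne_top_of_le_ne_top hmax hB
  lift C to NNReal using hC
  lift D to NNReal using hD
  norm_cast at *
  rw [← NNReal.coe_le_coe] at *
  push_cast at *
  have a0 := A.coe_nonneg
  have b0 := B.coe_nonneg
  have c0 := C.coe_nonneg
  have d0 := D.coe_nonneg
  generalize (A : ℝ) = a at *
  generalize (B : ℝ) = b at *
  generalize (C : ℝ) = x at *
  generalize (D : ℝ) = y at *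
  rcases le_total y x with h | h
  · rw [max_eq_left h] at hA hB
    rcases le_total (a + b) x with h1 | h1
    · nlinarith [mul_nonneg a0 b0]
    -- From `(x - a)(x - b) ≥ 0` one gets `a² + b² ≤ x² + (a + b - x)²`, and `0 ≤ a + b - x ≤ y`.
    · nlinarith [mul_nonneg (sub_nonneg.2 hA) (sub_nonneg.2 hB)]
  · rw [max_eq_right h] at hA hB
    rcases le_total (a + b) y with h1 | h1
    · nlinarith [mul_nonneg a0 b0]
    · nlinarith [mul_nonneg (sub_nonneg.2 hA) (sub_nonneg.2 hB)]

/-- Two-point case of the contraction principle for squared suprema. -/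
theorem sq_iSup_contraction {ι : Type*} [Nonempty ι] {ψ : ℝ → ℝ}
    (hψ : ∀ s t, |ψ s - ψ t| ≤ |s - t|) (hψ0 : ∀ t, |ψ t| ≤ |t|) (f h : ι → ℝ) :
    (⨆ n, ENNReal.ofReal (f n + ψ (h n))) ^ 2 + (⨆ n, ENNReal.ofReal (f n - ψ (h n))) ^ 2 ≤
      (⨆ n, ENNReal.ofReal (f n + h n)) ^ 2 + (⨆ n, ENNReal.ofReal (f n - h n)) ^ 2 := by
  set C := ⨆ n, ENNReal.ofReal (f n + h n) with hC
  set D := ⨆ n, ENNReal.ofReal (f n - h n) with hD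
  have c1 : ∀ n, ENNReal.ofReal (f n + h n) ≤ C := fun n => le_iSup_of_le n le_rfl
  have d1 : ∀ n, ENNReal.ofReal (f n - h n) ≤ D := fun n => le_iSup_of_le n le_rfl
  have habs : ∀ n, ENNReal.ofReal (f n + |h n|) ≤ max C D := by
    intro n
    rcases abs_cases (h n) with ⟨e, -⟩ | ⟨e, -⟩ <;> rw [e]
    · exact (c1 n).trans (le_max_left _ _)
    · exact (d1 n).trans (le_max_right _ _)
  have hp : ∀ n, ENNReal.ofReal (f n + ψ (h n)) ≤ max C D := fun n =>
    (ENNReal.ofReal_le_ofReal (by linarith [le_abs_self (ψ (h n)), hψ0 (h n)])).trans (habs n)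
  have hm : ∀ n, ENNReal.ofReal (f n - ψ (h n)) ≤ max C D := fun n =>
    (ENNReal.ofReal_le_ofReal (by linarith [neg_abs_le (ψ (h n)), hψ0 (h n)])).trans (habs n)
  have hmaxle : max C D ≤ C + D := max_le le_self_add le_add_self
  refine sq_add_sq_le_of_majorized (ENNReal.iSup_add_iSup_le fun n k => ?_) (iSup_le hp)
    (iSup_le hm)
  rcases le_total 0 (f n + ψ (h n)) with h1 | h1
  · rcases le_total 0 (f k - ψ (h k)) with h2 | h2
    · rw [← ENNReal.ofReal_add h1 h2]
      have h3 := (le_abs_self _).trans (hψ (h n) (h k))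
      -- The sign of `h n - h k` decides which of the two indices is used in the supremum with `+ h`
      -- and which in the one with `- h`.
      rcases abs_cases (h n - h k) with ⟨e, -⟩ | ⟨e, -⟩ <;> rw [e] at h3
      · calc ENNReal.ofReal (f n + ψ (h n) + (f k - ψ (h k)))
            ≤ ENNReal.ofReal ((f n + h n) + (f k - h k)) :=
              ENNReal.ofReal_le_ofReal (by linarith)
          _ ≤ _ := ENNReal.ofReal_add_le.trans (add_le_add (c1 n) (d1 k))
      · calc ENNReal.ofReal (f n + ψ (h n) + (f k - ψ (h k)))
            ≤ ENNReal.ofReal ((f k + h k) + (f n - h n)) :=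
              ENNReal.ofReal_le_ofReal (by linarith)
          _ ≤ _ := ENNReal.ofReal_add_le.trans (add_le_add (c1 k) (d1 n))
    · rw [ENNReal.ofReal_of_nonpos h2, add_zero]
      exact (hp n).trans hmaxle
  · rw [ENNReal.ofReal_of_nonpos h1, zero_add]
    exact (hm k).trans hmaxle

variable {m d : ℕ}

/-- The uniform distribution on `{-1, 1}`. -/
noncomputable def signLaw : Measure ℝ :=
  (2⁻¹ : ℝ≥0∞) • Measure.dirac (-1 : ℝ) + (2⁻¹ : ℝ≥0∞) • Measure.dirac (1 : ℝ)

instance : IsProbabilityMeasure signLaw :=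
  ⟨by simp [signLaw, ENNReal.inv_two_add_inv_two]⟩

theorem measurePreserving_neg_signLaw : MeasurePreserving (fun x : ℝ => -x) signLaw signLaw := by
  refine ⟨measurable_neg, ?_⟩
  have e : ∀ x : ℝ, Measure.map (fun x : ℝ => -x) (Measure.dirac x) = Measure.dirac (-x) :=
    fun x => Measure.map_dirac' measurable_neg x
  rw [signLaw, Measure.map_add _ _ measurable_neg, Measure.map_smul, Measure.map_smul, e, e,
    neg_neg, add_comm]

theorem signLaw_ae_sq : ∀ᵐ x ∂signLaw, x ^ 2 = 1 := by
  rw [signLaw, ae_add_measure_iff]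
  constructor <;> refine Measure.ae_smul_measure ?_ _ <;> simp [ae_dirac_eq]

theorem initLaw_eq (m d : ℕ) : initLaw m d = (Measure.pi fun _ : Fin m => signLaw).prod
    (Measure.pi fun _ : Fin m × Fin d => gaussianReal 0 (1 / (d : NNReal))) := rfl

instance (m d : ℕ) : IsProbabilityMeasure (initLaw m d) := by
  rw [initLaw_eq]; infer_instance

theorem initLaw_ae_sq (m d : ℕ) : ∀ᵐ q ∂(initLaw m d), ∀ i, q.1 i ^ 2 = 1 := by
  rw [initLaw_eq, ae_all_iff]
  intro i
  exact ((measurePreserving_eval (fun _ : Fin m => signLaw) i).comp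
    measurePreserving_fst).quasiMeasurePreserving.ae signLaw_ae_sq

/-- Change of the sign of `b_i`. -/
def flipSign (i : Fin m) (b : Fin m → ℝ) : Fin m → ℝ := fun j => if j = i then -b j else b j

theorem measurePreserving_flipSign (i : Fin m) :
    MeasurePreserving (Prod.map (flipSign i) id) (initLaw m d) (initLaw m d) := by
  rw [initLaw_eq]
  refine MeasurePreserving.prod (f := flipSign i) ?_ (MeasurePreserving.id _)
  refine measurePreserving_pi (f := fun j x => if j = i then -x else x) _ _ fun j => ?_
  by_cases h : j = i
  · simpa [h] using measurePreserving_neg_signLaw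
  · simp only [h, if_false]
    exact MeasurePreserving.id signLaw

/-- A comparison of integrals that holds on average over a sign flip. -/
theorem lintegral_initLaw_le_of_flip (i : Fin m)
    {H K : (Fin m → ℝ) × (Fin m × Fin d → ℝ) → ℝ≥0∞} (hH : Measurable H) (hK : Measurable K)
    (h : ∀ q : (Fin m → ℝ) × (Fin m × Fin d → ℝ), (∀ i, q.1 i ^ 2 = 1) →
      H q + H (flipSign i q.1, q.2) ≤ K q + K (flipSign i q.1, q.2)) :
    ∫⁻ q, H q ∂(initLaw m d) ≤ ∫⁻ q, K q ∂(initLaw m d) := by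
  have hmp := measurePreserving_flipSign (d := d) i
  have e : ∀ {L : (Fin m → ℝ) × (Fin m × Fin d → ℝ) → ℝ≥0∞}, Measurable L →
      ∫⁻ q, (L q + L (flipSign i q.1, q.2)) ∂(initLaw m d) = 2 * ∫⁻ q, L q ∂(initLaw m d) := by
    intro L hL
    rw [lintegral_add_left hL, two_mul]
    congr 1
    exact hmp.lintegral_comp hL
  have h2 : 2 * ∫⁻ q, H q ∂(initLaw m d) ≤ 2 * ∫⁻ q, K q ∂(initLaw m d) := by
    rw [← e hH, ← e hK]
    refine lintegral_mono_ae ?_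
    filter_upwards [initLaw_ae_sq m d] with q hq using h q hq
  exact (ENNReal.mul_le_mul_iff_right (by norm_num) (by norm_num)).1 h2

theorem sum_flipSign_mul (i : Fin m) (b : Fin m → ℝ) (y : Fin m → ℝ) :
    ∑ j, flipSign i b j * y j = ∑ j ∈ Finset.univ.erase i, b j * y j - b i * y i := by
  rw [← Finset.add_sum_erase _ _ (Finset.mem_univ i), sub_eq_neg_add]
  congr 1
  · simp [flipSign]
  · exact Finset.sum_congr rfl fun j hj => by simp [flipSign, Finset.ne_of_mem_erase hj]

theorem measurable_block_inner (i : Fin m) (x : Vec d) :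
    Measurable fun a : Fin m × Fin d → ℝ => (inner ℝ (block (WithLp.toLp 2 a) i) x : ℝ) := by
  simp only [block, PiLp.inner_apply]
  fun_prop

/-- One step of the coordinate-by-coordinate replacement: with all other coordinates frozen, the sum
over the flip of `b i` is the two-point inequality, and `b i = -1` merely exchanges its two terms.
-/
theorem sq_iSup_contraction_flipSign {ψ : ℝ → ℝ} (hψ : ∀ s t, |ψ s - ψ t| ≤ |s - t|)
    (hψ0 : ∀ t, |ψ t| ≤ |t|) {b : Fin m → ℝ} {i : Fin m} (hb : b i ^ 2 = 1)
    (h : Fin m → ℕ → ℝ) {I : Finset (Fin m)} (hi : i ∉ I) :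
    (⨆ n, ENNReal.ofReal (∑ j, b j * (if j ∈ insert i I then ψ (h j n) else h j n))) ^ 2 +
      (⨆ n, ENNReal.ofReal
        (∑ j, flipSign i b j * (if j ∈ insert i I then ψ (h j n) else h j n))) ^ 2 ≤
    (⨆ n, ENNReal.ofReal (∑ j, b j * (if j ∈ I then ψ (h j n) else h j n))) ^ 2 +
      (⨆ n, ENNReal.ofReal (∑ j, flipSign i b j * (if j ∈ I then ψ (h j n) else h j n))) ^ 2 := by
  simp only [sum_flipSign_mul]
  have e1 : ∀ n, ∑ j, b j * (if j ∈ insert i I then ψ (h j n) else h j n) =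
      ∑ j ∈ Finset.univ.erase i, b j * (if j ∈ I then ψ (h j n) else h j n) +
        b i * ψ (h i n) := by
    intro n
    rw [← Finset.add_sum_erase _ _ (Finset.mem_univ i), add_comm]
    congr 1
    · refine Finset.sum_congr rfl fun j hj => ?_
      simp [Finset.mem_insert, Finset.ne_of_mem_erase hj]
    · simp
  have e2 : ∀ n, ∑ j, b j * (if j ∈ I then ψ (h j n) else h j n) =
      ∑ j ∈ Finset.univ.erase i, b j * (if j ∈ I then ψ (h j n) else h j n) +
        b i * h i n := by
    intro n
    rw [← Finset.add_sum_erase _ _ (Finset.mem_univ i), add_comm]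
    simp [hi]
  have e3 : ∀ n, ∑ j ∈ Finset.univ.erase i,
      b j * (if j ∈ insert i I then ψ (h j n) else h j n) =
      ∑ j ∈ Finset.univ.erase i, b j * (if j ∈ I then ψ (h j n) else h j n) := fun n =>
    Finset.sum_congr rfl fun j hj => by
      simp [Finset.mem_insert, Finset.ne_of_mem_erase hj]
  simp only [e1, e2, e3, Finset.mem_insert_self, if_true, if_neg hi]
  rcases sq_eq_one_iff.1 hb with h1 | h1
  · simp only [h1, one_mul]
    exact sq_iSup_contraction hψ hψ0 _ _
  · simp only [h1, neg_mul, one_mul, sub_neg_eq_add, ← sub_eq_add_neg]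
    exact (add_comm _ _).trans_le ((sq_iSup_contraction (ι := ℕ) hψ hψ0 _ _).trans_eq
      (add_comm _ _))

/-- Contraction principle for the squared supremum of a Rademacher process. -/
theorem lintegral_sq_iSup_contraction {ψ : ℝ → ℝ} (hψm : Measurable ψ)
    (hψ : ∀ s t, |ψ s - ψ t| ≤ |s - t|) (hψ0 : ∀ t, |ψ t| ≤ |t|) (x : ℕ → Vec d)
    (I : Finset (Fin m)) :
    ∫⁻ q, (⨆ n, ENNReal.ofReal (∑ i, q.1 i * (if i ∈ I then
        ψ (inner ℝ (block (WithLp.toLp 2 q.2) i) (x n)) else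
          inner ℝ (block (WithLp.toLp 2 q.2) i) (x n)))) ^ 2 ∂(initLaw m d) ≤
      ∫⁻ q, (⨆ n, ENNReal.ofReal (∑ i, q.1 i *
        inner ℝ (block (WithLp.toLp 2 q.2) i) (x n))) ^ 2 ∂(initLaw m d) := by
  set h : Fin m → ℕ → (Fin m × Fin d → ℝ) → ℝ := fun i n a =>
    inner ℝ (block (WithLp.toLp 2 a) i) (x n) with hh
  have hhm : ∀ i n, Measurable (h i n) := fun i n => measurable_block_inner i (x n)
  have hmeas : ∀ I : Finset (Fin m), Measurable fun q : (Fin m → ℝ) × (Fin m × Fin d → ℝ) =>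
      (⨆ n, ENNReal.ofReal (∑ i, q.1 i * (if i ∈ I then ψ (h i n q.2) else h i n q.2))) ^ 2 := by
    intro I
    have hs : ∀ n, Measurable fun q : (Fin m → ℝ) × (Fin m × Fin d → ℝ) =>
        ∑ i, q.1 i * (if i ∈ I then ψ (h i n q.2) else h i n q.2) := by
      intro n
      refine Finset.measurable_fun_sum _ fun i _ => Measurable.mul (by fun_prop) ?_
      split_ifs
      · exact hψm.comp ((hhm i n).comp measurable_snd)
      · exact (hhm i n).comp measurable_snd
    exact (Measurable.iSup fun n => (hs n).ennreal_ofReal).pow_const 2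
  induction I using Finset.induction_on with
  | empty => simp
  | insert i I hi ih =>
    refine le_trans (lintegral_initLaw_le_of_flip i (hmeas (insert i I)) (hmeas I) ?_) ih
    rintro ⟨b, a⟩ hb
    exact sq_iSup_contraction_flipSign hψ hψ0 (hb i) (fun j n => h j n a) hi

theorem norm_block_sq (a : Fin m × Fin d → ℝ) (i : Fin m) :
    ‖block (WithLp.toLp 2 a : Params m d) i‖ ^ 2 = ∑ j, a (i, j) ^ 2 := by
  rw [EuclideanSpace.norm_sq_eq]
  simp [block]

theorem measurable_block_toLp (i : Fin m) :
    Measurable fun a : Fin m × Fin d → ℝ => block (WithLp.toLp 2 a : Params m d) i := by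
  unfold block; fun_prop

/-- The cross terms cancel between `b` and its flip (parallelogram identity). This is orthogonality
of the signs without any integrability to check. -/
theorem norm_sum_sq_flipSign_le {b : Fin m → ℝ} {i : Fin m} (hb : b i ^ 2 = 1)
    (w : Fin m → Vec d) {I : Finset (Fin m)} (hi : i ∉ I) :
    ENNReal.ofReal (‖∑ j ∈ insert i I, b j • w j‖ ^ 2) +
        ENNReal.ofReal (‖∑ j ∈ insert i I, flipSign i b j • w j‖ ^ 2) ≤
      (ENNReal.ofReal (‖w i‖ ^ 2) + ENNReal.ofReal (‖∑ j ∈ I, b j • w j‖ ^ 2)) +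
        (ENNReal.ofReal (‖w i‖ ^ 2) + ENNReal.ofReal (‖∑ j ∈ I, flipSign i b j • w j‖ ^ 2)) := by
  have e1 : ∑ j ∈ I, flipSign i b j • w j = ∑ j ∈ I, b j • w j :=
    Finset.sum_congr rfl fun j hj => by
      have : j ≠ i := fun h => hi (h ▸ hj)
      simp [flipSign, this]
  simp only [Finset.sum_insert hi, e1]
  rw [← ENNReal.ofReal_add (by positivity) (by positivity),
    ← ENNReal.ofReal_add (by positivity) (by positivity),
    ← ENNReal.ofReal_add (by positivity) (by positivity)]
  refine ENNReal.ofReal_le_ofReal (le_of_eq ?_)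
  have e2 : flipSign i b i = -b i := by simp [flipSign]
  rw [e2, neg_smul, norm_add_sq_real, norm_add_sq_real, norm_neg, inner_neg_left, norm_smul,
    mul_pow, Real.norm_eq_abs, sq_abs, hb]
  ring

theorem lintegral_norm_sum_sq_le (I : Finset (Fin m)) :
    ∫⁻ q, ENNReal.ofReal (‖∑ i ∈ I, q.1 i • block (WithLp.toLp 2 q.2 : Params m d) i‖ ^ 2)
        ∂(initLaw m d) ≤
      ∫⁻ q, ∑ i ∈ I, ENNReal.ofReal (‖block (WithLp.toLp 2 q.2 : Params m d) i‖ ^ 2)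
        ∂(initLaw m d) := by
  have hbm : ∀ i, Measurable fun q : (Fin m → ℝ) × (Fin m × Fin d → ℝ) =>
      block (WithLp.toLp 2 q.2 : Params m d) i := fun i =>
    (measurable_block_toLp i).comp measurable_snd
  have hsm : ∀ I : Finset (Fin m), Measurable fun q : (Fin m → ℝ) × (Fin m × Fin d → ℝ) =>
      ENNReal.ofReal (‖∑ i ∈ I, q.1 i • block (WithLp.toLp 2 q.2 : Params m d) i‖ ^ 2) := by
    intro I
    have h : Measurable fun q : (Fin m → ℝ) × (Fin m × Fin d → ℝ) =>
        ∑ i ∈ I, q.1 i • block (WithLp.toLp 2 q.2 : Params m d) i :=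
      Finset.measurable_fun_sum _ fun i _ =>
        Measurable.smul ((measurable_pi_apply i).comp measurable_fst) (hbm i)
    exact (h.norm.pow_const 2).ennreal_ofReal
  have hnm : ∀ i, Measurable fun q : (Fin m → ℝ) × (Fin m × Fin d → ℝ) =>
      ENNReal.ofReal (‖block (WithLp.toLp 2 q.2 : Params m d) i‖ ^ 2) := fun i =>
    ((hbm i).norm.pow_const 2).ennreal_ofReal
  induction I using Finset.induction_on with
  | empty => simp
  | insert i I hi ih =>
    refine le_trans (lintegral_initLaw_le_of_flip i (hsm (insert i I))
      ((hnm i).add (hsm I)) ?_) ?_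
    · rintro ⟨b, a⟩ hb
      exact norm_sum_sq_flipSign_le (hb i) _ hi
    · simp only [Finset.sum_insert hi, Pi.add_apply]
      rw [lintegral_add_left (hnm i), lintegral_add_left (hnm i)]
      gcongr

theorem measurePreserving_snd_initLaw (m d : ℕ) : MeasurePreserving Prod.snd (initLaw m d)
    (Measure.pi fun _ : Fin m × Fin d => gaussianReal 0 (1 / (d : NNReal))) := by
  rw [initLaw_eq]; exact measurePreserving_snd

theorem lintegral_norm_block_sq (hd : 0 < d) (i : Fin m) :
    ∫⁻ q, ENNReal.ofReal (‖block (WithLp.toLp 2 q.2 : Params m d) i‖ ^ 2) ∂(initLaw m d) = 1 := by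
  rw [← lintegral_sum_sq hd i]
  simp only [norm_block_sq]
  exact (measurePreserving_snd_initLaw m d).lintegral_comp
    (f := fun a => ENNReal.ofReal (∑ j, a (i, j) ^ 2)) (by fun_prop)

theorem lintegral_inv_norm_block_sq_le (hd : 3 ≤ d) (i : Fin m) :
    ∫⁻ q, (ENNReal.ofReal (‖block (WithLp.toLp 2 q.2 : Params m d) i‖ ^ 2))⁻¹ ∂(initLaw m d)
      ≤ 3 := by
  refine le_trans (le_of_eq ?_) (lintegral_inv_sum_sq_le hd i)
  simp only [norm_block_sq]
  exact (measurePreserving_snd_initLaw m d).lintegral_comp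
    (f := fun a => (ENNReal.ofReal (∑ j, a (i, j) ^ 2))⁻¹) (by fun_prop)

/-- Contraction removes `ψ`; the supremum of the resulting linear process over unit-ball points is
at most `‖∑ b_i [α₀]_i‖`, whose second moment is at most `m`, free of the dimension. -/
theorem lintegral_sq_iSup_net_le (hd : 0 < d) {ψ : ℝ → ℝ} (hψm : Measurable ψ)
    (hψ : ∀ s t, |ψ s - ψ t| ≤ |s - t|) (hψ0 : ∀ t, |ψ t| ≤ |t|) {x : ℕ → Vec d}
    (hx : ∀ n, ‖x n‖ ≤ 1) :
    ∫⁻ q, (⨆ n, ENNReal.ofReal (∑ i, q.1 i *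
        ψ (inner ℝ (block (WithLp.toLp 2 q.2) i) (x n)))) ^ 2 ∂(initLaw m d) ≤ m := by
  have h := lintegral_sq_iSup_contraction (m := m) hψm hψ hψ0 x Finset.univ
  simp only [Finset.mem_univ, if_true] at h
  refine h.trans ?_
  calc _ ≤ ∫⁻ q, ENNReal.ofReal (‖∑ i, q.1 i • block (WithLp.toLp 2 q.2 : Params m d) i‖ ^ 2)
        ∂(initLaw m d) := by
        refine lintegral_mono fun q => ?_
        rw [ENNReal.ofReal_pow (norm_nonneg _)]
        gcongr
        refine iSup_le fun n => ENNReal.ofReal_le_ofReal ?_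
        have e : ∑ i, q.1 i * (inner ℝ (block (WithLp.toLp 2 q.2 : Params m d) i) (x n) : ℝ) =
            inner ℝ (∑ i, q.1 i • block (WithLp.toLp 2 q.2 : Params m d) i) (x n) := by
          rw [sum_inner]
          simp only [real_inner_smul_left]
        rw [e]
        exact (real_inner_le_norm _ _).trans (mul_le_of_le_one_right (norm_nonneg _) (hx n))
    _ ≤ _ := lintegral_norm_sum_sq_le Finset.univ
    _ = m := by
        rw [lintegral_finsetSum _ fun i _ => ?_]
        · simp only [lintegral_norm_block_sq hd]
          simp
        · exact (((measurable_block_toLp i).comp measurable_snd).norm.pow_const 2).ennreal_ofReal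

/-- A dense sequence in the closed unit ball of `ℝ^d`. -/
noncomputable def unitBallSeq (d : ℕ) (n : ℕ) : Vec d :=
  haveI : Nonempty (Metric.closedBall (0 : Vec d) 1) := ⟨⟨0, by simp⟩⟩
  (TopologicalSpace.denseSeq (Metric.closedBall (0 : Vec d) 1) n : Vec d)

theorem norm_unitBallSeq_le (d n : ℕ) : ‖unitBallSeq d n‖ ≤ 1 := by
  unfold unitBallSeq
  exact mem_closedBall_zero_iff.1 (Subtype.coe_prop _)

theorem continuous_net (b : Fin m → ℝ) (α : Params m d) : Continuous (net b α) := by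
  unfold net; fun_prop

/-- The squared supremum norm of the network on the unit ball. -/
noncomputable def supNetSq (b : Fin m → ℝ) (α : Params m d) : ℝ≥0∞ :=
  ⨆ n, ENNReal.ofReal (net b α (unitBallSeq d n) ^ 2)

/-- By continuity the countable dense supremum, chosen for measurability, already bounds the network
on the whole ball. -/
theorem ofReal_net_sq_le_supNetSq (b : Fin m → ℝ) (α : Params m d) {x : Vec d} (hx : ‖x‖ ≤ 1) :
    ENNReal.ofReal (net b α x ^ 2) ≤ supNetSq b α := by
  have : Nonempty (Metric.closedBall (0 : Vec d) 1) := ⟨⟨0, by simp⟩⟩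
  have hc : Continuous fun y : Metric.closedBall (0 : Vec d) 1 =>
      ENNReal.ofReal (net b α y ^ 2) :=
    ENNReal.continuous_ofReal.comp (((continuous_net b α).comp continuous_subtype_val).pow 2)
  have hd := TopologicalSpace.denseRange_denseSeq (Metric.closedBall (0 : Vec d) 1)
  have := hd.induction_on (p := fun y : Metric.closedBall (0 : Vec d) 1 =>
    ENNReal.ofReal (net b α y ^ 2) ≤ supNetSq b α) ⟨x, mem_closedBall_zero_iff.2 hx⟩
    (isClosed_le hc continuous_const) fun n => ?_
  · exact this
  · exact le_iSup (fun n => ENNReal.ofReal (net b α (unitBallSeq d n) ^ 2)) n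

theorem measurable_net_toLp (x : Vec d) : Measurable fun q : (Fin m → ℝ) × (Fin m × Fin d → ℝ) =>
    net q.1 (WithLp.toLp 2 q.2) x := by
  unfold net
  have h : ∀ i, Measurable fun q : (Fin m → ℝ) × (Fin m × Fin d → ℝ) =>
      (inner ℝ (block (WithLp.toLp 2 q.2) i) x : ℝ) := fun i =>
    (measurable_block_inner i x).comp measurable_snd
  refine measurable_const.mul (Finset.measurable_fun_sum _ fun i _ => Measurable.mul ?_ ?_)
  · fun_prop
  · exact measurable_const.max (h i)

theorem measurable_supNetSq : Measurable fun q : (Fin m → ℝ) × (Fin m × Fin d → ℝ) =>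
    supNetSq q.1 (WithLp.toLp 2 q.2 : Params m d) :=
  Measurable.iSup fun _ => ((measurable_net_toLp _).pow_const 2).ennreal_ofReal

/-- The contraction bound is one-sided, so it is applied to the ReLU and to its negative. Each
contributes `m`, and the normalization `1 / m` leaves 2. -/
theorem lintegral_supNetSq_le (hm : 0 < m) (hd : 0 < d) :
    ∫⁻ q, supNetSq q.1 (WithLp.toLp 2 q.2 : Params m d) ∂(initLaw m d) ≤ 2 := by
  have hm' : (0 : ℝ) < m := by exact_mod_cast hm
  set Pp : (Fin m → ℝ) × (Fin m × Fin d → ℝ) → ℝ≥0∞ := fun q =>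
    (⨆ n, ENNReal.ofReal (∑ i, q.1 i *
        max 0 (inner ℝ (block (WithLp.toLp 2 q.2) i) (unitBallSeq d n)))) ^ 2 with hP
  set Nn : (Fin m → ℝ) × (Fin m × Fin d → ℝ) → ℝ≥0∞ := fun q =>
    (⨆ n, ENNReal.ofReal (∑ i, q.1 i *
        -max 0 (inner ℝ (block (WithLp.toLp 2 q.2) i) (unitBallSeq d n)))) ^ 2 with hN
  have relu1 : ∀ s t : ℝ, |max 0 s - max 0 t| ≤ |s - t| := fun s t => by
    simpa using abs_max_sub_max_le_max 0 s 0 t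
  have relu0 : ∀ t : ℝ, |max 0 t| ≤ |t| := fun t => by simpa using relu1 t 0
  have hPle : ∫⁻ q, Pp q ∂(initLaw m d) ≤ m :=
    lintegral_sq_iSup_net_le hd (ψ := fun t => max 0 t) (by fun_prop) relu1 relu0
      (norm_unitBallSeq_le d)
  have hNle : ∫⁻ q, Nn q ∂(initLaw m d) ≤ m :=
    lintegral_sq_iSup_net_le hd (ψ := fun t => -max 0 t) (by fun_prop)
      (fun s t => by rw [neg_sub_neg, abs_sub_comm]; exact relu1 s t)
      (fun t => by rw [abs_neg]; exact relu0 t) (norm_unitBallSeq_le d)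
  have hinner : ∀ (i : Fin m) (n : ℕ), Measurable fun q : (Fin m → ℝ) × (Fin m × Fin d → ℝ) =>
      max 0 (inner ℝ (block (WithLp.toLp 2 q.2) i) (unitBallSeq d n) : ℝ) := fun i n =>
    measurable_const.max ((measurable_block_inner i _).comp measurable_snd)
  have hPm : Measurable Pp := by
    refine Measurable.pow_const (Measurable.iSup fun n => Measurable.ennreal_ofReal
      (Finset.measurable_fun_sum _ fun i _ => Measurable.mul (by fun_prop) (hinner i n))) 2
  have hpt : ∀ q : (Fin m → ℝ) × (Fin m × Fin d → ℝ),
      supNetSq q.1 (WithLp.toLp 2 q.2 : Params m d) ≤ ENNReal.ofReal (1 / m) * (Pp q + Nn q) := by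
    intro q
    refine iSup_le fun n => ?_
    rw [net, mul_pow, one_div_sqrt_sq, ENNReal.ofReal_mul (by positivity)]
    gcongr
    set s := ∑ i, q.1 i * max 0 (inner ℝ (block (WithLp.toLp 2 q.2) i) (unitBallSeq d n) : ℝ)
      with hs
    rcases le_total 0 s with h | h
    · rw [ENNReal.ofReal_pow h]
      refine le_trans ?_ le_self_add
      simp only [hP]
      gcongr
      exact le_iSup_of_le n le_rfl
    · rw [← neg_sq, ENNReal.ofReal_pow (neg_nonneg.2 h)]
      refine le_trans ?_ le_add_self
      simp only [hN]
      gcongr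
      refine le_iSup_of_le n (le_of_eq ?_)
      simp only [hs, mul_neg, Finset.sum_neg_distrib]
  calc _ ≤ ∫⁻ q, ENNReal.ofReal (1 / m) * (Pp q + Nn q) ∂(initLaw m d) := lintegral_mono hpt
    _ = ENNReal.ofReal (1 / m) * (∫⁻ q, Pp q ∂(initLaw m d) + ∫⁻ q, Nn q ∂(initLaw m d)) := by
        rw [lintegral_const_mul' _ _ ENNReal.ofReal_ne_top, lintegral_add_left hPm]
    _ ≤ ENNReal.ofReal (1 / m) * (m + m) := by gcongr
    _ = 2 := by
        have : ((m : ℝ≥0∞) + m) = ENNReal.ofReal (m + m) := by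
          rw [ENNReal.ofReal_add hm'.le hm'.le, ENNReal.ofReal_natCast]
        rw [this, ← ENNReal.ofReal_mul (by positivity)]
        have e : 1 / (m : ℝ) * (m + m) = 2 := by field_simp; norm_num
        rw [e]; simp

/-- The `ℝ≥0∞`-valued version of `invMoment`, infinite if some block vanishes. -/
noncomputable def einvMoment (α : Params m d) : ℝ≥0∞ :=
  ENNReal.ofReal (1 / m) * ∑ i, (ENNReal.ofReal (‖block α i‖ ^ 2))⁻¹

theorem block_ne_zero_of_einvMoment_ne_top (hm : 0 < m) {α : Params m d}
    (h : einvMoment α ≠ ∞) (i : Fin m) : block α i ≠ 0 := by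
  intro h0
  apply h
  have hm' : (0 : ℝ) < m := by exact_mod_cast hm
  rw [einvMoment, ENNReal.mul_eq_top]
  left
  refine ⟨(ENNReal.ofReal_pos.2 (by positivity)).ne', ?_⟩
  rw [ENNReal.sum_eq_top]
  exact ⟨i, Finset.mem_univ _, by simp [h0]⟩

theorem ofReal_invMoment {α : Params m d} (h : ∀ i, block α i ≠ 0) :
    ENNReal.ofReal (invMoment α) = einvMoment α := by
  rw [invMoment, einvMoment, ENNReal.ofReal_mul (by positivity),
    ENNReal.ofReal_sum_of_nonneg fun i _ => by positivity]
  congr 1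
  refine Finset.sum_congr rfl fun i _ => ENNReal.ofReal_inv_of_pos ?_
  have := norm_pos_iff.2 (h i)
  positivity

theorem measurable_einvMoment : Measurable fun q : (Fin m → ℝ) × (Fin m × Fin d → ℝ) =>
    einvMoment (WithLp.toLp 2 q.2 : Params m d) := by
  unfold einvMoment
  refine measurable_const.mul (Finset.measurable_fun_sum _ fun i _ => Measurable.inv ?_)
  exact (((measurable_block_toLp i).comp measurable_snd).norm.pow_const 2).ennreal_ofReal

theorem lintegral_einvMoment_le (hm : 0 < m) (hd : 3 ≤ d) :
    ∫⁻ q, einvMoment (WithLp.toLp 2 q.2 : Params m d) ∂(initLaw m d) ≤ 3 := by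
  have hm' : (0 : ℝ) < m := by exact_mod_cast hm
  unfold einvMoment
  rw [lintegral_const_mul' _ _ ENNReal.ofReal_ne_top, lintegral_finsetSum _ fun i _ => ?_]
  · calc _ ≤ ENNReal.ofReal (1 / m) * ∑ _i : Fin m, 3 := by
          gcongr with i; exact lintegral_inv_norm_block_sq_le hd i
      _ = 3 := by
          rw [Finset.sum_const, Finset.card_univ, Fintype.card_fin, nsmul_eq_mul, ← mul_assoc,
            ← ENNReal.ofReal_natCast m, ← ENNReal.ofReal_mul (by positivity),
            one_div_mul_cancel hm'.ne']
          simp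
  · exact Measurable.inv
      (((measurable_block_toLp i).comp measurable_snd).norm.pow_const 2).ennreal_ofReal

end Signs

/-! ### Choice of parameters and the explicit rate. -/

section Rate

theorem two_mul_stepSize_le {μ η : ℝ} (hμ1 : μ < 1) {T : ℕ} (hT : 64 / (1 - μ) ^ 2 ≤ (T : ℝ))
    (hη : η = (T : ℝ) ^ (-(1 / 2) : ℝ)) : 0 < T ∧ 0 < η ∧ η ^ 2 * T = 1 ∧ 2 * η ≤ 1 - μ := by
  have hκ : 0 < 1 - μ := sub_pos.2 hμ1
  have hT0 : (0 : ℝ) < T := lt_of_lt_of_le (by positivity) hT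
  have hη0 : 0 < η := hη ▸ Real.rpow_pos_of_pos hT0 _
  have hη2 : η ^ 2 * T = 1 := by
    rw [hη, Real.rpow_neg hT0.le, ← Real.sqrt_eq_rpow, inv_pow, Real.sq_sqrt hT0.le,
      inv_mul_cancel₀ hT0.ne']
  refine ⟨by exact_mod_cast hT0, hη0, hη2, ?_⟩
  rw [div_le_iff₀ (by positivity)] at hT
  have h : (2 * η) ^ 2 ≤ (1 - μ) ^ 2 := by
    have : η ^ 2 * 64 ≤ η ^ 2 * (T * (1 - μ) ^ 2) := mul_le_mul_of_nonneg_left hT (sq_nonneg _)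
    rw [← mul_assoc, hη2] at this
    nlinarith [sq_nonneg η]
  exact abs_le_of_sq_le_sq' h hκ.le |>.2

/-- The second-moment constant of the temporal-difference error. -/
noncomputable def tdConst (v₁ v₂ v₃ R₀ : ℝ) : ℝ :=
  (12 + 3 * v₁) / R₀ ^ 2 + (12 + 3 * v₂) + 3 * v₃ / R₀ ^ 2

/-- The conditional rate constant. -/
noncomputable def rateConst (μ c v₁ v₂ v₃ R₀ : ℝ) : ℝ :=
  c + 1 / (1 - μ) * (1 + tdConst v₁ v₂ v₃ R₀ + 4 * (1 + 3 * c / 4 + tdConst v₁ v₂ v₃ R₀ / 2))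

/-- The final arithmetic. With `h = √R` and `q = m^{-1/4}` as variables, all fractional powers
become polynomial. -/
theorem error_bound_le {μ c v₁ v₂ v₃ R₀ R η h q U V W : ℝ} {T : ℕ} (hμ1 : μ < 1) (hc : 0 < c)
    (hv₁ : 0 ≤ v₁) (hv₂ : 0 ≤ v₂) (hv₃ : 0 ≤ v₃) (hR₀ : 0 < R₀) (hR : R₀ ≤ R) (hη : 0 < η)
    (hηT : η ^ 2 * T = 1) (hh : 0 < h) (hhR : h ^ 2 = R) (hq : 0 < q) (hU : 0 ≤ U) (hW : 0 ≤ W)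
    (hV : V ≤ v₁ * U + v₂ * R ^ 2 + v₃) :
    2 * (R ^ 2 * (c / 2 * (R * q ^ 2) * (1 + W))) + 1 / (η * (1 - μ) * T) *
      (R ^ 2 + T * (2 * η * (2 * R * (h ^ 3 * q + R ^ 2 / (h ^ 3 * q) *
        (c / 2 * (R * q ^ 2) * (1 + W)) + (q / h / 2 * (12 * U + 12 * R ^ 2 + 3 * V) +
          1 / (2 * (q / h)) * (c / 2 * (R * q ^ 2) * (1 + W))))) +
        η ^ 2 * (12 * U + 12 * R ^ 2 + 3 * V))) ≤
    rateConst μ c v₁ v₂ v₃ R₀ * (R ^ 2 * η + h ^ 5 * q + R ^ 3 * q ^ 2) * (1 + U + W) := by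
  have hκ : 0 < 1 - μ := sub_pos.2 hμ1
  have hT0 : (0 : ℝ) < T := by
    by_contra h0
    push Not at h0
    nlinarith [mul_nonneg (sq_nonneg η) (neg_nonneg.2 h0)]
  set K := tdConst v₁ v₂ v₃ R₀ with hK
  set G := 12 * U + 12 * R ^ 2 + 3 * V with hG
  have hR0 : 0 < R := lt_of_lt_of_le hR₀ hR
  -- The lower bound on `R` enters only here: it absorbs the terms of `G` without a factor `R²`.
  have hRR : 1 ≤ R ^ 2 / R₀ ^ 2 := by
    rw [one_le_div (by positivity)]; exact pow_le_pow_left₀ hR₀.le hR 2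
  have hK0 : 0 ≤ K := by rw [hK, tdConst]; positivity
  have hGK : G ≤ K * R ^ 2 * (1 + U) := by
    have e : K * R ^ 2 = (12 + 3 * v₁) * (R ^ 2 / R₀ ^ 2) + (12 + 3 * v₂) * R ^ 2 +
        3 * v₃ * (R ^ 2 / R₀ ^ 2) := by rw [hK, tdConst]; ring
    have a1 : (12 + 3 * v₁) * U ≤ (12 + 3 * v₁) * (R ^ 2 / R₀ ^ 2) * U := by
      have := mul_le_mul_of_nonneg_left hRR (by positivity : 0 ≤ (12 + 3 * v₁) * U)
      linarith
    have a2 : 3 * v₃ ≤ 3 * v₃ * (R ^ 2 / R₀ ^ 2) := le_mul_of_one_le_right (by positivity) hRR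
    have a3 : 0 ≤ (12 + 3 * v₁) * (R ^ 2 / R₀ ^ 2) := by positivity
    have a4 : 0 ≤ ((12 + 3 * v₂) * R ^ 2 + 3 * v₃ * (R ^ 2 / R₀ ^ 2)) * U := by positivity
    rw [e]
    nlinarith
  set s := 1 + U + W with hs
  have hs1 : 1 ≤ s := by linarith
  have hsU : 1 + U ≤ s := by linarith
  have hsW : 1 + W ≤ s := by linarith
  have hGs : G ≤ K * R ^ 2 * s := hGK.trans (mul_le_mul_of_nonneg_left hsU (by positivity))
  have expand : 2 * (R ^ 2 * (c / 2 * (R * q ^ 2) * (1 + W))) + 1 / (η * (1 - μ) * T) *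
      (R ^ 2 + T * (2 * η * (2 * R * (h ^ 3 * q + R ^ 2 / (h ^ 3 * q) *
        (c / 2 * (R * q ^ 2) * (1 + W)) + (q / h / 2 * G +
          1 / (2 * (q / h)) * (c / 2 * (R * q ^ 2) * (1 + W))))) + η ^ 2 * G)) =
      c * (R ^ 3 * q ^ 2) * (1 + W) + 1 / (1 - μ) *
        (R ^ 2 * η + (4 * (h ^ 5 * q) * (1 + 3 * c / 4 * (1 + W)) + 2 * (h * q) * G) + η * G) := by
    have hTe : (T : ℝ) = 1 / η ^ 2 := by field_simp; linarith
    rw [hTe, ← hhR]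
    field_simp
    ring
  rw [expand]
  have b1 : c * (R ^ 3 * q ^ 2) * (1 + W) ≤ c * (R ^ 3 * q ^ 2) * s :=
    mul_le_mul_of_nonneg_left hsW (by positivity)
  have b2 : R ^ 2 * η ≤ R ^ 2 * η * s := le_mul_of_one_le_right (by positivity) hs1
  have b3 : 4 * (h ^ 5 * q) * (1 + 3 * c / 4 * (1 + W)) ≤
      4 * (h ^ 5 * q) * ((1 + 3 * c / 4) * s) := by
    refine mul_le_mul_of_nonneg_left ?_ (by positivity)
    have := mul_le_mul_of_nonneg_left hsW (by positivity : 0 ≤ 3 * c / 4)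
    linarith
  have b4 : 2 * (h * q) * G ≤ 4 * (h ^ 5 * q) * (K / 2 * s) := by
    have := mul_le_mul_of_nonneg_left hGs (by positivity : 0 ≤ 2 * (h * q))
    rw [← hhR] at this
    linarith [show 2 * (h * q) * (K * (h ^ 2) ^ 2 * s) = 4 * (h ^ 5 * q) * (K / 2 * s) by ring]
  have b5 : η * G ≤ η * (K * R ^ 2 * s) := mul_le_mul_of_nonneg_left hGs hη.le
  have inner : R ^ 2 * η + (4 * (h ^ 5 * q) * (1 + 3 * c / 4 * (1 + W)) + 2 * (h * q) * G) + η * G ≤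
      (1 + K) * (R ^ 2 * η * s) + 4 * (1 + 3 * c / 4 + K / 2) * (h ^ 5 * q * s) := by
    linarith
  have c1 : 0 ≤ R ^ 2 * η * s := by positivity
  have c2 : 0 ≤ h ^ 5 * q * s := by positivity
  have c3 : 0 ≤ R ^ 3 * q ^ 2 * s := by positivity
  have d1 : (0 : ℝ) ≤ 1 + K := by positivity
  have d2 : 0 ≤ 4 * (1 + 3 * c / 4 + K / 2) := by positivity
  have inner2 : (1 + K) * (R ^ 2 * η * s) + 4 * (1 + 3 * c / 4 + K / 2) * (h ^ 5 * q * s) ≤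
      (1 + K + 4 * (1 + 3 * c / 4 + K / 2)) * ((R ^ 2 * η + h ^ 5 * q + R ^ 3 * q ^ 2) * s) := by
    have e1 := mul_nonneg d1 c2
    have e2 := mul_nonneg d1 c3
    have e3 := mul_nonneg d2 c1
    have e4 := mul_nonneg d2 c3
    linarith
  have outer := mul_le_mul_of_nonneg_left (inner.trans inner2) (by positivity : 0 ≤ 1 / (1 - μ))
  have fin : c * (R ^ 3 * q ^ 2) * s ≤ c * ((R ^ 2 * η + h ^ 5 * q + R ^ 3 * q ^ 2) * s) := by
    have e1 := mul_nonneg hc.le c1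
    have e2 := mul_nonneg hc.le c2
    linarith
  have total : rateConst μ c v₁ v₂ v₃ R₀ * (R ^ 2 * η + h ^ 5 * q + R ^ 3 * q ^ 2) * s =
      c * ((R ^ 2 * η + h ^ 5 * q + R ^ 3 * q ^ 2) * s) + 1 / (1 - μ) *
        ((1 + K + 4 * (1 + 3 * c / 4 + K / 2)) *
          ((R ^ 2 * η + h ^ 5 * q + R ^ 3 * q ^ 2) * s)) := by
    rw [rateConst, ← hK]; ring
  rw [total]
  linarith

theorem memLp_two_of_lintegral_le {X : Type*} [MeasurableSpace X] {ρ : Measure X} {v : X → ℝ}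
    (hv : Measurable v) {B : ℝ} (h : ∫⁻ x, ENNReal.ofReal (v x ^ 2) ∂ρ ≤ ENNReal.ofReal B) :
    MemLp v 2 ρ := by
  rw [memLp_two_iff_integrable_sq hv.aestronglyMeasurable]
  exact (lintegral_ofReal_ne_top_iff_integrable (hv.pow_const 2).aestronglyMeasurable
    (ae_of_all _ fun x => sq_nonneg _)).1 (ne_top_of_le_ne_top ENNReal.ofReal_ne_top h)

variable {X : Type*} [MeasurableSpace X] {m d : ℕ} {φ : X → Vec d} {b : Fin m → ℝ}
  {α₀ : Params m d} {v : X → ℝ} {μ : ℝ} {ρ : Measure X} {J : Measure (X × X)} {R : ℝ}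

/-- Passing to the supremum removes `ρ`, so the dependence of `ρ` on the initialization becomes
harmless. -/
theorem ofReal_integral_net_sq_le (hφ : Measurable φ) (hφ1 : ∀ x, ‖φ x‖ ≤ 1)
    (hb : ∀ i, b i ^ 2 = 1) [IsProbabilityMeasure ρ] :
    ENNReal.ofReal (∫ x, net b α₀ (φ x) ^ 2 ∂ρ) ≤ supNetSq b α₀ := by
  rw [ofReal_integral_eq_lintegral_ofReal (memLp_net hφ hφ1 hb α₀ 2).integrable_sq
    (ae_of_all _ fun x => sq_nonneg _)]
  calc _ ≤ ∫⁻ _x, supNetSq b α₀ ∂ρ :=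
        lintegral_mono fun x => ofReal_net_sq_le_supNetSq b α₀ (hφ1 x)
    _ = supNetSq b α₀ := by simp

/-- The error bound conditionally on the initialization, in terms of `supNetSq` and
`einvMoment`. -/
theorem lintegral_error_le_rate {c v₁ v₂ v₃ R₀ : ℝ} (hμ0 : 0 ≤ μ) (hμ1 : μ < 1) (hc : 0 < c)
    (hv₁ : 0 ≤ v₁) (hv₂ : 0 ≤ v₂) (hv₃ : 0 ≤ v₃) (hR₀ : 0 < R₀) (hR : R₀ ≤ R)
    (hφ : Measurable φ) (hφ1 : ∀ x, ‖φ x‖ ≤ 1) (hb : ∀ i, b i ^ 2 = 1)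
    [IsProbabilityMeasure ρ] [IsProbabilityMeasure J] (hvm : Measurable v)
    (h1 : MeasurePreserving Prod.fst J ρ) (h2 : MeasurePreserving Prod.snd J ρ)
    (hρ : AntiConcentrated φ c ρ)
    (hv : ∫⁻ x, ENNReal.ofReal (v x ^ 2) ∂ρ ≤
      ENNReal.ofReal (v₁ * ∫ x, net b α₀ (φ x) ^ 2 ∂ρ + v₂ * R ^ 2 + v₃))
    (hm : 0 < m) (h0 : ∀ i, block α₀ i ≠ 0) {T : ℕ} (hT : 64 / (1 - μ) ^ 2 ≤ (T : ℝ)) {η : ℝ}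
    (hη : η = (T : ℝ) ^ (-(1 / 2) : ℝ)) {αs : Params m d}
    (hs : IsStationaryPoint φ b α₀ v μ R η J αs) :
    ∫⁻ z, ∫⁻ x, ENNReal.ofReal
        ((net b (averagedIterate φ b α₀ v μ R η T z) (φ x) - linNet b α₀ αs (φ x)) ^ 2)
      ∂ρ ∂(Measure.infinitePi fun _ : ℕ => J) ≤
    ENNReal.ofReal (rateConst μ c v₁ v₂ v₃ R₀ * (R ^ 2 * (T : ℝ) ^ (-(1 / 2) : ℝ)
        + R ^ (5 / 2 : ℝ) * (m : ℝ) ^ (-(1 / 4) : ℝ) + R ^ 3 * (m : ℝ) ^ (-(1 / 2) : ℝ))) *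
      (1 + supNetSq b α₀ + einvMoment α₀) := by
  obtain ⟨hT0, hη0, hηT, -⟩ := two_mul_stepSize_le hμ1 hT hη
  have hm' : (0 : ℝ) < m := by exact_mod_cast hm
  have hR0 : 0 < R := lt_of_lt_of_le hR₀ hR
  set h := √R with hh
  have hh0 : 0 < h := Real.sqrt_pos.2 hR0
  have hhR : h ^ 2 = R := Real.sq_sqrt hR0.le
  set q := (m : ℝ) ^ (-(1 / 4) : ℝ) with hq
  have hq0 : 0 < q := Real.rpow_pos_of_pos hm' _
  have hq2 : (m : ℝ) ^ (-(1 / 2) : ℝ) = q ^ 2 := by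
    rw [hq, ← Real.rpow_natCast, ← Real.rpow_mul hm'.le]; norm_num
  have hqs : R / √(m : ℝ) = R * q ^ 2 := by
    rw [← hq2, Real.rpow_neg hm'.le, ← Real.sqrt_eq_rpow, div_eq_mul_inv]
  have hR52 : R ^ (5 / 2 : ℝ) = h ^ 5 := by
    rw [hh, Real.sqrt_eq_rpow, ← Real.rpow_natCast, ← Real.rpow_mul hR0.le]; norm_num
  have hvL : MemLp v 2 ρ := memLp_two_of_lintegral_le hvm hv
  set U := ∫ x, net b α₀ (φ x) ^ 2 ∂ρ with hU
  have hU0 : 0 ≤ U := integral_nonneg fun x => sq_nonneg _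
  have hV : ∫ x, v x ^ 2 ∂ρ ≤ v₁ * U + v₂ * R ^ 2 + v₃ := by
    rw [← ofReal_integral_eq_lintegral_ofReal hvL.integrable_sq
      (ae_of_all _ fun x => sq_nonneg _)] at hv
    exact (ENNReal.ofReal_le_ofReal_iff (by positivity)).1 hv
  have hW := invMoment_nonneg α₀
  have hp : ∀ α ∈ Metric.closedBall α₀ R, ∫ x, mismatchFrac α₀ α (φ x) ∂ρ ≤
      c / 2 * (R * q ^ 2) * (1 + invMoment α₀) := by
    intro α hα
    rw [← hqs]
    exact integral_mismatchFrac_le hφ hφ1 hc hρ hm h0 hR0 (by rw [← dist_eq_norm]; exact hα)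
  -- With `p` of order `R q²` and `G` of order `R²`, `l = R^{3/2} m^{-1/4}` balances `l` against `R²
  -- p / l`, and `τ = R^{-1/2} m^{-1/4}` makes both remaining terms of order `R^{3/2} m^{-1/4}`.
  have key := lintegral_error_le (l := h ^ 3 * q) (τ := q / h) hφ hφ1 hb hvm hvL h1 h2 hμ0 hμ1
    (by positivity) (by positivity) hR0.le hη0 hs (by positivity) hp rfl hT0
  refine key.trans ?_
  have hK0 : 0 ≤ rateConst μ c v₁ v₂ v₃ R₀ := by
    have : 0 < 1 - μ := sub_pos.2 hμ1
    unfold rateConst tdConst; positivity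
  refine (ENNReal.ofReal_le_ofReal (error_bound_le hμ1 hc hv₁ hv₂ hv₃ hR₀ hR hη0 hηT hh0 hhR hq0
    hU0 hW hV)).trans ?_
  rw [hq2, hR52, ← hη, ENNReal.ofReal_mul (by positivity),
    ENNReal.ofReal_add (by positivity) hW, ENNReal.ofReal_add zero_le_one hU0, ENNReal.ofReal_one,
    ofReal_invMoment h0]
  gcongr
  exact ofReal_integral_net_sq_le hφ hφ1 hb

end Rate

end NeuralTD

open NeuralTD
theorem mainTheorem3
    (μ : ℝ) (hμ0 : 0 ≤ μ) (hμ1 : μ < 1)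
    (c : ℝ) (hc : 0 < c)
    (v₁ v₂ v₃ : ℝ) (hv₁ : 0 ≤ v₁) (hv₂ : 0 ≤ v₂) (hv₃ : 0 ≤ v₃)
    (R₀ : ℝ) (hR₀ : 0 < R₀) :
    -- the constant depends only on `μ`, `c`, `v₁`, `v₂`, `v₃` and the lower bound `R₀` on `R`
    ∃ C : ℝ, 0 < C ∧
      ∀ (d m T : ℕ) (R : ℝ), 3 ≤ d → 0 < m → 64 / (1 - μ) ^ 2 ≤ (T : ℝ) → R₀ ≤ R →
      -- state and action spaces, and the probability space that carries the initialization
      -- (and possibly other randomness prior to the run of the algorithm)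
      ∀ (S : Type u) [MeasurableSpace S] (A : Type v) [MeasurableSpace A]
        (Ω : Type w) [MeasurableSpace Ω] (Pr : Measure Ω) [IsProbabilityMeasure Pr]
        (φ : S × A → Vec d), Measurable φ → (∀ x, ‖φ x‖ ≤ 1) →
      -- random initialization
      ∀ (b : Ω → Fin m → ℝ) (α₀ : Ω → Params m d),
        HasLaw (fun ω => (b ω, fun p => α₀ ω p)) (initLaw m d) Pr →
      -- transition kernel, policy, stationary distribution and `v`;
      -- the last three may depend on the initialization
      ∀ (P : Kernel (S × A) S) [IsMarkovKernel P]
        (π : Kernel (Ω × S) A) [IsMarkovKernel π]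
        (ρ : Kernel Ω (S × A)) [IsMarkovKernel ρ]
        (v : Ω → S × A → ℝ), Measurable (Function.uncurry v) →
        (∀ᵐ ω ∂Pr, (nextPair P (π.sectR ω)).Invariant (ρ ω)) →
        (∀ᵐ ω ∂Pr, AntiConcentrated φ c (ρ ω)) →
        (∀ᵐ ω ∂Pr, ∫⁻ x, ENNReal.ofReal (v ω x ^ 2) ∂(ρ ω) ≤
          ENNReal.ofReal
            (v₁ * ∫ x, net (b ω) (α₀ ω) (φ x) ^ 2 ∂(ρ ω) + v₂ * R ^ 2 + v₃)) →
      ∀ η : ℝ, η = (T : ℝ) ^ (-(1 / 2) : ℝ) →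
      -- stationary points exist, they are the parameters of the fixed points of `Π_F 𝒯`,
      -- and this fixed point is unique in `L²(ρ)`
      (∀ᵐ ω ∂Pr,
        (∃ α, IsStationaryPoint φ (b ω) (α₀ ω) (v ω) μ R η
          (transitionLaw P (π.sectR ω) (ρ ω)) α) ∧
        (∀ α ∈ Metric.closedBall (α₀ ω) R,
          (IsStationaryPoint φ (b ω) (α₀ ω) (v ω) μ R η
              (transitionLaw P (π.sectR ω) (ρ ω)) α ↔
            IsL2Proj (ρ ω) (linClass φ (b ω) (α₀ ω) R)
              (bellman P (π.sectR ω) (v ω) μ fun x => linNet (b ω) (α₀ ω) α (φ x))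
              (fun x => linNet (b ω) (α₀ ω) α (φ x)))) ∧
        (∀ f g : S × A → ℝ,
          IsL2Proj (ρ ω) (linClass φ (b ω) (α₀ ω) R) (bellman P (π.sectR ω) (v ω) μ f) f →
          IsL2Proj (ρ ω) (linClass φ (b ω) (α₀ ω) R) (bellman P (π.sectR ω) (v ω) μ g) g →
          f =ᵐ[ρ ω] g)) ∧
      -- the error bound; the samples are i.i.d. given the initialization,
      -- and `x ∼ ρ` is independent of them
      (∀ αstar : Ω → Params m d,
        (∀ᵐ ω ∂Pr, IsStationaryPoint φ (b ω) (α₀ ω) (v ω) μ R η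
          (transitionLaw P (π.sectR ω) (ρ ω)) (αstar ω)) →
        ∫⁻ ω, ∫⁻ z, ∫⁻ x,
            ENNReal.ofReal
              ((net (b ω) (averagedIterate φ (b ω) (α₀ ω) (v ω) μ R η T z) (φ x)
                - linNet (b ω) (α₀ ω) (αstar ω) (φ x)) ^ 2)
          ∂(ρ ω) ∂(Measure.infinitePi fun _ : ℕ => transitionLaw P (π.sectR ω) (ρ ω)) ∂Pr ≤
        ENNReal.ofReal
          (C * (R ^ 2 * (T : ℝ) ^ (-(1 / 2) : ℝ)
            + R ^ (5 / 2 : ℝ) * (m : ℝ) ^ (-(1 / 4) : ℝ)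
            + R ^ 3 * (m : ℝ) ^ (-(1 / 2) : ℝ)))) := by

  have hκ : 0 < 1 - μ := sub_pos.2 hμ1
  have hK0 : 0 < rateConst μ c v₁ v₂ v₃ R₀ := by
    unfold rateConst tdConst; positivity
  -- The factor `6 = 1 + 2 + 3` bounds the mean of `1 + supNetSq + einvMoment` over the
  -- initialization.
  refine ⟨6 * rateConst μ c v₁ v₂ v₃ R₀, by positivity, ?_⟩
  intro d m T R hd hm hT hR S _ A _ Ω _ Pr _ φ hφ hφ1 b α₀ hlaw P _ π _ ρ _ v hv hinv hanti hvbound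
    η hη
  obtain ⟨hT0, hη0, -, hη1⟩ := two_mul_stepSize_le hμ1 hT hη
  have hR0 : 0 < R := lt_of_lt_of_le hR₀ hR
  have hvm : ∀ ω, Measurable (v ω) := fun ω => hv.of_uncurry_left
  have hbsq : ∀ᵐ ω ∂Pr, ∀ i, b ω i ^ 2 = 1 := by
    refine ae_of_ae_map (p := fun q => ∀ i, q.1 i ^ 2 = 1) hlaw.aemeasurable ?_
    rw [hlaw.map_eq]
    exact initLaw_ae_sq m d
  -- A finite mean inverse moment already excludes vanishing blocks almost surely.
  have hblock : ∀ᵐ ω ∂Pr, ∀ i, block (α₀ ω) i ≠ 0 := by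
    have h : ∀ᵐ q ∂(initLaw m d), einvMoment (WithLp.toLp 2 q.2 : Params m d) < ∞ :=
      ae_lt_top measurable_einvMoment
        (ne_top_of_le_ne_top (by norm_num) (lintegral_einvMoment_le hm hd))
    rw [← hlaw.map_eq] at h
    filter_upwards [ae_of_ae_map hlaw.aemeasurable h] with ω hω
    exact block_ne_zero_of_einvMoment_ne_top hm hω.ne
  refine ⟨?_, fun αstar hstar => ?_⟩
  · filter_upwards [hbsq, hinv, hvbound] with ω hb hi hvb
    have hvL := memLp_two_of_lintegral_le (hvm ω) hvb
    have h1 := measurePreserving_fst_transitionLaw (P := P) (π := π.sectR ω) (ρ := ρ ω)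
    have h2 := measurePreserving_snd_transitionLaw hi
    refine ⟨exists_isStationaryPoint hφ hφ1 hb hvL h1 h2 hμ0 hμ1 hR0.le hη0 hη1,
      fun α hα => isL2Proj_bellman_iff hφ hφ1 hb hi hvL hR0.le hη0 hα, fun f g hf hg => ?_⟩
    obtain ⟨α, hα, rfl⟩ := hf.1
    obtain ⟨β, hβ, rfl⟩ := hg.1
    exact linNet_ae_eq_of_isStationaryPoint hφ hφ1 hb hvL h1 h2 hμ0 hμ1 hR0.le hη0
      ((isL2Proj_bellman_iff hφ hφ1 hb hi hvL hR0.le hη0 hα).2 hf)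
      ((isL2Proj_bellman_iff hφ hφ1 hb hi hvL hR0.le hη0 hβ).2 hg)
  · set rate := R ^ 2 * (T : ℝ) ^ (-(1 / 2) : ℝ) + R ^ (5 / 2 : ℝ) * (m : ℝ) ^ (-(1 / 4) : ℝ)
      + R ^ 3 * (m : ℝ) ^ (-(1 / 2) : ℝ) with hrate
    set H : (Fin m → ℝ) × (Fin m × Fin d → ℝ) → ℝ≥0∞ := fun q =>
      1 + supNetSq q.1 (WithLp.toLp 2 q.2 : Params m d) +
        einvMoment (WithLp.toLp 2 q.2 : Params m d) with hH
    have hHm : Measurable H :=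
      (measurable_const.add measurable_supNetSq).add measurable_einvMoment
    -- The bound depends on `ω` through the initialization alone, so it can be integrated against
    -- `initLaw`, and no measurability of `αstar` is required.
    have hpt : ∀ᵐ ω ∂Pr, ∫⁻ z, ∫⁻ x,
        ENNReal.ofReal
          ((net (b ω) (averagedIterate φ (b ω) (α₀ ω) (v ω) μ R η T z) (φ x)
            - linNet (b ω) (α₀ ω) (αstar ω) (φ x)) ^ 2)
        ∂(ρ ω) ∂(Measure.infinitePi fun _ : ℕ => transitionLaw P (π.sectR ω) (ρ ω)) ≤
        ENNReal.ofReal (rateConst μ c v₁ v₂ v₃ R₀ * rate) * H (b ω, fun p => α₀ ω p) := by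
      filter_upwards [hbsq, hblock, hinv, hanti, hvbound, hstar] with ω hb h0 hi ha hvb hs
      exact lintegral_error_le_rate hμ0 hμ1 hc hv₁ hv₂ hv₃ hR₀ hR hφ hφ1 hb (hvm ω)
        measurePreserving_fst_transitionLaw (measurePreserving_snd_transitionLaw hi) ha hvb hm h0
        hT hη hs
    have hHint : ∫⁻ ω, H (b ω, fun p => α₀ ω p) ∂Pr ≤ 6 := by
      have e : ∫⁻ ω, H (b ω, fun p => α₀ ω p) ∂Pr = ∫⁻ q, H q ∂(initLaw m d) := by
        rw [← hlaw.map_eq, lintegral_map' hHm.aemeasurable hlaw.aemeasurable]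
      rw [e, hH, lintegral_add_right _ measurable_einvMoment, lintegral_add_left measurable_const]
      calc _ ≤ (1 : ℝ≥0∞) + 2 + 3 := by
            gcongr
            · simp
            · exact lintegral_supNetSq_le hm (by omega)
            · exact lintegral_einvMoment_le hm hd
        _ = 6 := by norm_num
    calc _ ≤ ∫⁻ ω, ENNReal.ofReal (rateConst μ c v₁ v₂ v₃ R₀ * rate) *
          H (b ω, fun p => α₀ ω p) ∂Pr := lintegral_mono_ae hpt
      _ ≤ ENNReal.ofReal (rateConst μ c v₁ v₂ v₃ R₀ * rate) * 6 := by
          rw [lintegral_const_mul' _ _ ENNReal.ofReal_ne_top]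
          gcongr
      _ = ENNReal.ofReal (6 * rateConst μ c v₁ v₂ v₃ R₀ * rate) := by
          have e : (6 : ℝ≥0∞) = ENNReal.ofReal 6 := by simp
          have hrate0 : 0 ≤ rate := by positivity
          rw [e, ← ENNReal.ofReal_mul (by positivity)]
          congr 1; ring
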